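/- **Setting.** Let $R$ be a noetherian commutative ring, let $H,G,F$ be free $R$-modules of finite ranks $l,n,m$ with $n\ge l$, $r=n-m\ge 0$, and let $H\xrightarrow{\varphi}G\xrightarrow{\psi}F$ be $R$-linear maps with $\psi\varphi=0$. Let $I_\varphi$, $I_\psi$ be the ideals generated by the maximal minors ($l$-minors, respectively $m$-minors) of matrices representing $\varphi$ and $\psi$, and put $h=\operatorname{grade} I_\varphi$, $g=\operatorname{grade} I_\psi$ (the grade of the unit ideal being $\infty$), $C=\operatorname{Coker}\psi$. Write $S_p$ for the $p$-th symmetric power; exterior powers with negative exponent are zero. Let $t<0$ be an integer. For $p,q\ge 0$ set $$C^{p,q}=\begin{cases}S_p(H^*)\otimes\bigwedge^{t+l+p-q}G\otimes S_q(F)&\text{if } t+l\ge 0,\\ S_{p-t-l}(H^*)\otimes\bigwedge^{p-q}G\otimes S_q(F)&\text{if } t+l\le 0.\end{cases}$$ With dual bases $(h_j),(h_j^*)$ of $H,H^*$ and $(f_j),(f_j^*)$ of $F,F^*$, let $$d_\varphi:C^{p,q}\to C^{p+1,q},\quad a\otimes y\otimes z\mapsto\sum_j h_j^*a\otimes(\varphi(h_j)\wedge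 y)\otimes z,$$ $$\partial_\psi:C^{p,q}\to C^{p,q+1},\quad a\otimes y\otimes z\mapsto\sum_j a\otimes\bigl(y\leftarrow\psi^*(f_j^*)\bigr)\otimes zf_j,$$ where $(y_1\wedge\dots\wedge y_k)\leftarrow y^*=\sum_i(-1)^{i-1}y^*(y_i)\,y_1\wedge\dots\widehat{y_i}\dots\wedge y_k$. Let $N^p=\operatorname{Ker}(C^{p,0}\xrightarrow{\partial_\psi}C^{p,1})$, let $\bar H^p$ be the homology at $N^p$ of the complex $0\to N^0\to N^1\to\cdots$ with maps induced by $d_\varphi$, and let $H_\psi^{p,q}$ be the homology at $C^{p,q}$ of the column $0\to N^p\to C^{p,0}\xrightarrow{\partial_\psi}C^{p,1}\xrightarrow{\partial_\psi}\cdots$. For $i=p+q+1$, call $w\in C^{p,q}$ and $x\in N^i$ *linked* if there are $w_j\in C^{i-1-j,j}$ ($0\le j\le q$) with $w_q=w$, $d_\varphi w_{j+1}=\partial_\psi w_j$ for $0\le j<q$, and $d_\varphi w_0=x$. **Theorem 2.3.** Let $t<0$ be an integer and assume $1\le r\le g$. (a) Suppose that $t+l>0$ (this implies $l>1$). Then (i)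 $\bar H^i=0$ for $0\le i<\min(h,\max(2,t+l))$; (ii) if $2\le t+l<h$, then $\bar H^{t+l}\cong H_\psi^{0,t+l-1}$ canonically: there is an isomorphism $H_\psi^{0,t+l-1}\to\bar H^{t+l}$ sending $[z]$ to $[x]$ whenever the cycles $z$ and $x$ are linked; (iii) if $i-t-l$ is odd and $t+l+1\le i<h-1$, then one has a natural exact sequence $$0\to\bar H^i\to S_{\frac{i-t-l-1}2}(H^*)\otimes S_{\frac{i+t+l-1}2}(C)\to H_\psi^{\frac{i-t-l+1}2,\frac{i+t+l-1}2}\to\bar H^{i+1}\to 0.$$ (b) Suppose that $t+l\le 0$. Then $\bar H^i=0$ for $i=0,\dots,\min(2,h-1)$. For $i$ odd, $3\le i<\min(h-1,2r)$, one has a natural exact sequence $$0\to\bar H^i\to S_{\frac{i-1}2-t-l}(H^*)\otimes S_{\frac{i-1}2}(C)\to H_\psi^{\frac{i+1}2,\frac{i-1}2}\to\bar H^{i+1}\to 0.$$ In (iii) and (b), write $(p,q)$ for $\left(\frac{i-t-l-1}2,\frac{i+t+l-1}2\right)$, respectively $\left(\frac{i-1}2,\frac{i-1}2\right)$; then the exterior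 factor of $C^{p,q}$ is $\bigwedge^0G=R$ and $C^{p,q}$ maps canonically onto the second term of the sequence. "Natural" means: the first map sends $[x]$ to the image of $w$ whenever $w\in C^{p,q}$ and the cycle $x\in N^i$ are linked; the middle map sends the image of $w\in C^{p,q}$ to $[d_\varphi w]$; the last map sends $[z]$ to $[x]$ whenever the cycles $z\in C^{p+1,q}$ and $x\in N^{i+1}$ are linked. -/

import Mathlib

open scoped TensorProduct

noncomputable section

namespace KoszulBicomplex

universe u v w x

/-! ### Grade and determinantal ideals -/

section Grade

variable {R : Type u} [CommRing R]

/-- The grade of an ideal `I` of a (noetherian) ring `R`: the supremum of the lengths of the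
`R`-regular sequences contained in `I`.  For `I ≠ R` a weakly regular sequence in `I` is
automatically regular; for `I = R` the supremum is `∞`, which is the usual convention. -/
def idealGrade (I : Ideal R) : ℕ∞ :=
  ⨆ rs : {rs : List R // (∀ x ∈ rs, x ∈ I) ∧ RingTheory.Sequence.IsWeaklyRegular R rs},
    (rs.1.length : ℕ∞)

/-- The ideal generated by the `k`-minors of a matrix.  (Selections of rows and columns with
repetitions contribute zero, and reordering a selection only changes the sign.) -/
def minorIdeal {ι κ : Type*} (k : ℕ) (A : Matrix ι κ R) : Ideal R :=
  Ideal.span {x | ∃ (f : Fin k → ι) (g : Fin k → κ), x = (A.submatrix f g).det}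

end Grade

/-! ### Homogeneous components of the symmetric and the exterior algebra -/

section Powers

variable (R : Type u) [CommRing R] (M : Type v) [AddCommGroup M] [Module R M]

/-- The symmetric power `S_p(M)`, the component of degree `p` of the symmetric algebra. -/
abbrev symPow (p : ℕ) : Submodule R (SymmetricAlgebra R M) :=
  LinearMap.range (SymmetricAlgebra.ι R M) ^ p

/-- The exterior power `⋀ᵏ M` for an integer `k`; it is zero if `k < 0`. -/
def extPow (k : ℤ) : Submodule R (ExteriorAlgebra R M) :=
  if 0 ≤ k then ⋀[R]^(k.toNat) M else ⊥

variable {R M}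

theorem extPow_natCast (k : ℕ) : extPow R M (k : ℤ) = ⋀[R]^k M := by
  simp [extPow]

theorem extPow_of_neg {k : ℤ} (hk : k < 0) : extPow R M k = ⊥ := by
  simp [extPow, hk]

/-- Multiplication by `x ∈ M` on the symmetric algebra, as a map `S_p(M) → S_{p'}(M)`,
`p' = p + 1`. -/
def symMul (x : M) {p p' : ℕ} (h : p' = p + 1) : symPow R M p →ₗ[R] symPow R M p' :=
  (LinearMap.mulLeft R (SymmetricAlgebra.ι R M x)).restrict (fun y hy => by
    subst h
    rw [LinearMap.mulLeft_apply, symPow, pow_succ']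
    exact Submodule.mul_mem_mul ⟨x, rfl⟩ hy)

/-- The map `S_p(M) → S_p(M')` induced by a linear map `M → M'`. -/
def symMap {M' : Type*} [AddCommGroup M'] [Module R M'] (f : M →ₗ[R] M') (p : ℕ) :
    symPow R M p →ₗ[R] symPow R M' p :=
  (SymmetricAlgebra.lift (SymmetricAlgebra.ι R M' ∘ₗ f)).toLinearMap.restrict (fun y hy => by
    have h := Submodule.mem_map_of_mem
      (f := (SymmetricAlgebra.lift (SymmetricAlgebra.ι R M' ∘ₗ f)).toLinearMap) hy
    rw [symPow, Submodule.map_pow] at h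
    have h2 : (LinearMap.range (SymmetricAlgebra.ι R M)).map
        (SymmetricAlgebra.lift (SymmetricAlgebra.ι R M' ∘ₗ f)).toLinearMap
        ≤ LinearMap.range (SymmetricAlgebra.ι R M') := by
      rintro _ ⟨_, ⟨m, rfl⟩, rfl⟩
      exact ⟨f m, by simp⟩
    exact pow_le_pow_left' h2 p h)

theorem wedge_mem (x : M) {k k' : ℤ} (h : k' = k + 1) {y : ExteriorAlgebra R M}
    (hy : y ∈ extPow R M k) : ExteriorAlgebra.ι R x * y ∈ extPow R M k' := by
  subst h
  by_cases hk : 0 ≤ k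
  · obtain ⟨j, rfl⟩ := Int.eq_ofNat_of_zero_le hk
    rw [extPow_natCast] at hy
    rw [show ((j : ℤ) + 1) = ((j + 1 : ℕ) : ℤ) by push_cast; rfl, extPow_natCast,
      ExteriorAlgebra.exteriorPower, pow_succ']
    exact Submodule.mul_mem_mul ⟨x, rfl⟩ hy
  · rw [extPow_of_neg (by omega), Submodule.mem_bot] at hy
    rw [hy, mul_zero]
    exact zero_mem _

theorem contract_mem (d : Module.Dual R M) {k k' : ℤ} (h : k = k' + 1) {y : ExteriorAlgebra R M}
    (hy : y ∈ extPow R M k) : CliffordAlgebra.contractLeft d y ∈ extPow R M k' := by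
  subst h
  by_cases hk : 0 ≤ k' + 1
  · obtain ⟨j, hj⟩ := Int.eq_ofNat_of_zero_le hk
    rw [hj, extPow_natCast] at hy
    induction j generalizing k' y with
    | zero =>
      rw [ExteriorAlgebra.exteriorPower, pow_zero, Submodule.mem_one] at hy
      obtain ⟨r, rfl⟩ := hy
      rw [CliffordAlgebra.contractLeft_algebraMap]
      exact zero_mem _
    | succ j ih =>
      rw [ExteriorAlgebra.exteriorPower, pow_succ'] at hy
      have hk' : k' = (j : ℤ) := by push_cast at hj; omega
      induction hy using Submodule.mul_induction_on' with
      | mem_mul_mem a ha b hb =>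
        obtain ⟨x, rfl⟩ := ha
        have e : CliffordAlgebra.contractLeft d (ExteriorAlgebra.ι R x * b)
            = d x • b - ExteriorAlgebra.ι R x * CliffordAlgebra.contractLeft d b :=
          CliffordAlgebra.contractLeft_ι_mul d x b
        rw [e]
        refine sub_mem (Submodule.smul_mem _ _ ?_) ?_
        · rw [hk', extPow_natCast]; exact hb
        · refine wedge_mem x (k := k' - 1) (by ring) (ih (by omega) hb (by omega))
      | add a _ b _ ha hb => rw [map_add]; exact add_mem ha hb
  · rw [extPow_of_neg (by omega), Submodule.mem_bot] at hy
    rw [hy, map_zero]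
    exact zero_mem _

/-- Left multiplication `y ↦ x ∧ y`, as a map `⋀ᵏ M → ⋀ᵏ' M`, `k' = k + 1`. -/
def wedge (x : M) {k k' : ℤ} (h : k' = k + 1) : extPow R M k →ₗ[R] extPow R M k' :=
  (LinearMap.mulLeft R (ExteriorAlgebra.ι R x)).restrict (fun _ hy => wedge_mem x h hy)

/-- The (right) multiplication `y ↦ y ↼ d` by a linear form `d`, as a map `⋀ᵏ M → ⋀ᵏ' M`,
`k = k' + 1`.  It sends `y₁ ∧ ⋯ ∧ yₖ` to
`∑ᵢ (-1)^(i-1) d(yᵢ) y₁ ∧ ⋯ ∧ ŷᵢ ∧ ⋯ ∧ yₖ`. -/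
def contract (d : Module.Dual R M) {k k' : ℤ} (h : k = k' + 1) :
    extPow R M k →ₗ[R] extPow R M k' :=
  (CliffordAlgebra.contractLeft d).restrict (fun _ hy => contract_mem d h hy)

/-- The identification `⋀⁰ M = R`, extended by the projection of `⋀ M` onto its component of
degree zero to all the `⋀ᵏ M` (so it is zero if `k ≠ 0`). -/
def extCounit (k : ℤ) : extPow R M k →ₗ[R] R :=
  ExteriorAlgebra.algebraMapInv.toLinearMap ∘ₗ (extPow R M k).subtype

end Powers

/-! ### The lower part of the Koszul bicomplex for `t < 0`

Here `H`, `G`, `F` are free modules with bases `bH`, `bG`, `bF`, and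
`φ : H → G`, `ψ : G → F` are linear maps with `ψ ∘ φ = 0`.  The bicomplex belonging to an integer
`t < 0` depends on `t` and the rank `l` of `H` only through `e = t + l`. -/

section Bicomplex

variable (R : Type u) [CommRing R]
variable (H : Type v) (G : Type w) (F : Type x) [AddCommGroup H] [Module R H]
  [AddCommGroup G] [Module R G] [AddCommGroup F] [Module R F]

/-- The module `C^{p,q}` (`p` numbers the columns, `q` the rows):
if `e ≥ 0` it is `S_p(H*) ⊗ ⋀^{e+p-q} G ⊗ S_q(F)`, and
if `e ≤ 0` it is `S_{p-e}(H*) ⊗ ⋀^{p-q} G ⊗ S_q(F)`. -/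
def C (e : ℤ) (p q : ℕ) : Type _ :=
  symPow R (Module.Dual R H) (p + (-e).toNat) ⊗[R]
    (extPow R G ((e.toNat : ℤ) + p - q) ⊗[R] symPow R F q)

instance (e : ℤ) (p q : ℕ) : AddCommGroup (C R H G F e p q) :=
  inferInstanceAs (AddCommGroup (_ ⊗[R] _))

instance (e : ℤ) (p q : ℕ) : Module R (C R H G F e p q) :=
  inferInstanceAs (Module R (_ ⊗[R] _))

variable {R H G F}

/-- The tensor `a ⊗ y ⊗ z` in `C^{p,q}`. -/
def C.tmul {e : ℤ} {p q : ℕ} (a : symPow R (Module.Dual R H) (p + (-e).toNat))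
    (y : extPow R G ((e.toNat : ℤ) + p - q)) (z : symPow R F q) : C R H G F e p q :=
  a ⊗ₜ[R] (y ⊗ₜ[R] z)

/-- The tensor product of three linear maps, as a map between two of the modules `C^{p,q}`. -/
def C.map {e : ℤ} {p q p' q' : ℕ}
    (f : symPow R (Module.Dual R H) (p + (-e).toNat) →ₗ[R]
      symPow R (Module.Dual R H) (p' + (-e).toNat))
    (g : extPow R G ((e.toNat : ℤ) + p - q) →ₗ[R] extPow R G ((e.toNat : ℤ) + p' - q'))
    (h : symPow R F q →ₗ[R] symPow R F q') : C R H G F e p q →ₗ[R] C R H G F e p' q' :=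
  TensorProduct.map f (TensorProduct.map g h)

theorem C.map_tmul {e : ℤ} {p q p' q' : ℕ}
    (f : symPow R (Module.Dual R H) (p + (-e).toNat) →ₗ[R]
      symPow R (Module.Dual R H) (p' + (-e).toNat))
    (g : extPow R G ((e.toNat : ℤ) + p - q) →ₗ[R] extPow R G ((e.toNat : ℤ) + p' - q'))
    (h : symPow R F q →ₗ[R] symPow R F q') (a : symPow R (Module.Dual R H) (p + (-e).toNat))
    (y : extPow R G ((e.toNat : ℤ) + p - q)) (z : symPow R F q) :
    C.map f g h (C.tmul a y z) = C.tmul (f a) (g y) (h z) := rfl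

theorem C.neg_tmul {e : ℤ} {p q : ℕ} (a : symPow R (Module.Dual R H) (p + (-e).toNat))
    (y : extPow R G ((e.toNat : ℤ) + p - q)) (z : symPow R F q) :
    -C.tmul a y z = C.tmul a (-y) z := by
  refine neg_eq_of_add_eq_zero_left ?_
  change a ⊗ₜ[R] ((-y) ⊗ₜ[R] z) + a ⊗ₜ[R] (y ⊗ₜ[R] z) = 0
  rw [← TensorProduct.tmul_add, ← TensorProduct.add_tmul, neg_add_cancel, TensorProduct.zero_tmul,
    TensorProduct.tmul_zero]

theorem C.induction {e : ℤ} {p q : ℕ} {P : C R H G F e p q → Prop} (h0 : P 0)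
    (ht : ∀ a y z, P (C.tmul a y z)) (ha : ∀ c c', P c → P c' → P (c + c'))
    (c : C R H G F e p q) : P c := by
  refine TensorProduct.induction_on (motive := P) c h0 (fun a b => ?_) ha
  refine TensorProduct.induction_on (motive := fun b => P (a ⊗ₜ[R] b)) b ?_ (fun y z => ht a y z)
    (fun b b' hb hb' => ?_)
  · rw [TensorProduct.tmul_zero]; exact h0
  · rw [TensorProduct.tmul_add]; exact ha _ _ hb hb'

variable {l m : ℕ} (bH : Module.Basis (Fin l) R H) (bF : Module.Basis (Fin m) R F)
  (φ : H →ₗ[R] G) (ψ : G →ₗ[R] F) (e : ℤ)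

/-- The row map `d_φ : C^{p,q} → C^{p+1,q}`, multiplication by
`φ = ∑ⱼ hⱼ* ⊗ φ(hⱼ) ∈ S(H*) ⊗ ⋀ G`. -/
def d (p q : ℕ) : C R H G F e p q →ₗ[R] C R H G F e (p + 1) q :=
  ∑ j : Fin l,
    C.map (symMul (bH.coord j) (by omega)) (wedge (φ (bH j)) (by push_cast; ring)) LinearMap.id

/-- The column map `∂_ψ : C^{p,q} → C^{p,q+1}`,
`a ⊗ y ⊗ z ↦ ∑ⱼ a ⊗ (y ↼ ψ*(fⱼ*)) ⊗ z fⱼ`. -/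
def del (p q : ℕ) : C R H G F e p q →ₗ[R] C R H G F e p (q + 1) :=
  ∑ j : Fin m,
    C.map LinearMap.id (contract (bF.coord j ∘ₗ ψ) (by push_cast; ring)) (symMul (bF j) rfl)

/-- The two families of maps anticommute, so that a bicomplex is obtained. -/
theorem del_d (hψφ : ψ ∘ₗ φ = 0) (p q : ℕ) (c : C R H G F e p q) :
    del bF ψ e (p + 1) q (d bH φ e p q c) = -d bH φ e p (q + 1) (del bF ψ e p q c) := by
  induction c using C.induction with
  | h0 => simp
  | ha c c' hc hc' => rw [map_add, map_add, map_add, map_add, hc, hc', neg_add]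
  | ht a y z =>
    simp only [d, del, LinearMap.coe_sum, Finset.sum_apply, map_sum, C.map_tmul,
      LinearMap.id_apply, ← Finset.sum_neg_distrib, C.neg_tmul]
    rw [Finset.sum_comm]
    refine Finset.sum_congr rfl fun i _ => Finset.sum_congr rfl fun j _ => ?_
    congr 1
    apply Subtype.ext
    have h0 : (bF.coord i ∘ₗ ψ) (φ (bH j)) = 0 := by
      have := LinearMap.congr_fun hψφ (bH j)
      simp only [LinearMap.comp_apply, LinearMap.zero_apply] at this
      simp [this]
    have e1 := CliffordAlgebra.contractLeft_ι_mul (Q := (0 : QuadraticForm R G))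
      (bF.coord i ∘ₗ ψ) (φ (bH j)) (y : ExteriorAlgebra R G)
    rw [h0, zero_smul, zero_sub] at e1
    exact e1

/-- `N^p`, the kernel of `∂_ψ : C^{p,0} → C^{p,1}`. -/
abbrev N (p : ℕ) : Submodule R (C R H G F e p 0) := LinearMap.ker (del bF ψ e p 0)

variable {φ ψ} in
/-- The map `N^p → N^{p+1}` induced by `d_φ`. -/
def dbar (hψφ : ψ ∘ₗ φ = 0) (p : ℕ) : N (H := H) bF ψ e p →ₗ[R] N (H := H) bF ψ e (p + 1) :=
  (d bH φ e p 0).restrict (fun c hc => by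
    rw [LinearMap.mem_ker] at hc ⊢
    rw [del_d bH bF φ ψ e hψφ, hc, map_zero, neg_zero])

variable {φ ψ} in
/-- The image of `N^{p-1} → N^p`, zero if `p = 0`. -/
def barBoundaries (hψφ : ψ ∘ₗ φ = 0) : (p : ℕ) → Submodule R (N (H := H) bF ψ e p)
  | 0 => ⊥
  | p + 1 => LinearMap.range (dbar bH bF e hψφ p)

variable {φ ψ} in
/-- `H̄^p`, the homology of `0 → N^0 → N^1 → ⋯` at `N^p`. -/
abbrev Hbar (hψφ : ψ ∘ₗ φ = 0) (p : ℕ) : Type _ :=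
  LinearMap.ker (dbar bH bF e hψφ p) ⧸
    (barBoundaries bH bF e hψφ p).submoduleOf (LinearMap.ker (dbar bH bF e hψφ p))

variable {φ ψ} in
/-- The class in `H̄^p` of a cycle of `N^p`. -/
abbrev Hbar.mk (hψφ : ψ ∘ₗ φ = 0) (p : ℕ) :
    LinearMap.ker (dbar bH bF e hψφ p) →ₗ[R] Hbar bH bF e hψφ p :=
  Submodule.mkQ _

/-- The column boundaries in `C^{p,q}`.  The columns are augmented by `N^p` in position `-1`, so
for `q = 0` these are the elements of `N^p`. -/
def colBoundaries (p : ℕ) : (q : ℕ) → Submodule R (C R H G F e p q)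
  | 0 => N bF ψ e p
  | q + 1 => LinearMap.range (del bF ψ e p q)

/-- The column homology `H_ψ^{p,q}` at `C^{p,q}` of the augmented bicomplex. -/
abbrev Hpsi (H : Type v) [AddCommGroup H] [Module R H] {G : Type w} {F : Type x}
    [AddCommGroup G] [Module R G] [AddCommGroup F] [Module R F]
    (bF : Module.Basis (Fin m) R F) (ψ : G →ₗ[R] F) (e : ℤ) (p q : ℕ) : Type _ :=
  LinearMap.ker (del (H := H) bF ψ e p q) ⧸
    (colBoundaries (H := H) bF ψ e p q).submoduleOf (LinearMap.ker (del (H := H) bF ψ e p q))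

/-- The class in `H_ψ^{p,q}` of a column cycle of `C^{p,q}`. -/
abbrev Hpsi.mk (p q : ℕ) :
    LinearMap.ker (del (H := H) bF ψ e p q) →ₗ[R] Hpsi H bF ψ e p q :=
  Submodule.mkQ _

/-- The canonical map from `C^{p,q}` to `S_k(H*) ⊗ S_q(Coker ψ)`, where `k` is the degree of the
first factor of `C^{p,q}`; it is of interest when the exterior factor of `C^{p,q}` has degree `0`,
i.e. when `C^{p,q}` is the last non-zero module of its column. -/
def toCoker (p q : ℕ) : C R H G F e p q →ₗ[R]
    symPow R (Module.Dual R H) (p + (-e).toNat) ⊗[R] symPow R (F ⧸ LinearMap.range ψ) q :=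
  TensorProduct.map LinearMap.id
    ((TensorProduct.lid R _).toLinearMap ∘ₗ
      TensorProduct.map (extCounit _) (symMap (LinearMap.range ψ).mkQ q))

/-- The zig-zag relation in the bicomplex between elements `w ∈ C^{p,q}` and `x ∈ C^{i,0}`, where
`i = p + q + 1`: there are `w_j ∈ C^{i-1-j,j}`, `0 ≤ j ≤ q`, such that
`w_q = w`, `d_φ w_{j+1} = ∂_ψ w_j` for `0 ≤ j < q`, and `d_φ w_0 = x`. -/
inductive ZigZag :
    (p q i : ℕ) → C R H G F e p q → C R H G F e i 0 → Prop
  | base (p : ℕ) (w : C R H G F e p 0) : ZigZag p 0 (p + 1) w (d bH φ e p 0 w)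
  | step (p q i : ℕ) (w : C R H G F e p (q + 1)) (w' : C R H G F e (p + 1) q)
      (x : C R H G F e i 0) (hw : d bH φ e p (q + 1) w = del bF ψ e (p + 1) q w')
      (h : ZigZag (p + 1) q i w' x) : ZigZag p (q + 1) i w x

variable {φ ψ} in
/-- The statement that, for `i = p + q + 1`, there is a natural exact sequence
`0 → H̄^i → S_k(H*) ⊗ S_q(Coker ψ) → H_ψ^{p+1,q} → H̄^{i+1} → 0`,
where `k` is the degree of the first factor of `C^{p,q}`.
Naturality means that the maps are the canonical ones: the map in the middle is induced by `d_φ`,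
the outer ones are given by zig-zags in the bicomplex. -/
def HasNaturalExactSequence (hψφ : ψ ∘ₗ φ = 0) (p q i : ℕ) : Prop :=
  ∃ (α : Hbar bH bF e hψφ i →ₗ[R]
      symPow R (Module.Dual R H) (p + (-e).toNat) ⊗[R] symPow R (F ⧸ LinearMap.range ψ) q)
    (β : symPow R (Module.Dual R H) (p + (-e).toNat) ⊗[R] symPow R (F ⧸ LinearMap.range ψ) q →ₗ[R]
      Hpsi H bF ψ e (p + 1) q)
    (γ : Hpsi H bF ψ e (p + 1) q →ₗ[R] Hbar bH bF e hψφ (i + 1)),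
    Function.Injective α ∧ Function.Exact α β ∧ Function.Exact β γ ∧ Function.Surjective γ ∧
    (∀ (w : C R H G F e p q) (x : LinearMap.ker (dbar bH bF e hψφ i)),
      ZigZag bH bF φ ψ e p q i w x.1.1 → α (Hbar.mk bH bF e hψφ i x) = toCoker ψ e p q w) ∧
    (∀ w : C R H G F e p q, ∃ z : LinearMap.ker (del (H := H) bF ψ e (p + 1) q),
      z.1 = d bH φ e p q w ∧ β (toCoker ψ e p q w) = Hpsi.mk bF ψ e (p + 1) q z) ∧
    (∀ (z : LinearMap.ker (del (H := H) bF ψ e (p + 1) q))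
      (x : LinearMap.ker (dbar bH bF e hψφ (i + 1))),
      ZigZag bH bF φ ψ e (p + 1) q (i + 1) z.1 x.1.1 →
        γ (Hpsi.mk bF ψ e (p + 1) q z) = Hbar.mk bH bF e hψφ (i + 1) x)

end Bicomplex

end KoszulBicomplex

end

open KoszulBicomplex

noncomputable section

namespace KoszulBicomplex

/-! Write e = t + l. The module C^{p,q} has exterior degree max(e,0) + p - q, and everything follows
from exactness of rows and columns. The rows are strands of the Koszul complex S(H*) ⊗ ⋀G of φ,
tensored with S_q(F); they are exact in the columns p < h, with `d` injective on column 0. The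
augmented columns are strands of the Koszul complex S(F) ⊗ ⋀G of ψ; they are exact where the
exterior degree is at least 2, in the rows q < h in case (a) and q < r in case (b). In exterior
degree 1 the homology H_ψ may survive. In exterior degree 0 the column ends with cokernel S_k(H*) ⊗
S_q(C).

A cycle of N^i is pulled back through the rows along the antidiagonal p + q = i - 1. If the zig-zag
reaches column 0 while the exterior degree is at least 2, the cycle is a boundary; in exterior
degree 1 its class is that of an element of H_ψ. If the zig-zag meets exterior degree 0, which is a
parity condition on i, the four-term sequence results (`hasNaturalExactSequence`).

Exactness of the Koszul strands comes from an acyclicity lemma (`exact_of_isWeaklyRegular`): a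
complex of flat modules whose cohomology is killed by powers of the members of a regular sequence is
exact in as many initial positions as the sequence has members. The torsion is explicit: for a in
the ideal of maximal minors, φ has a left inverse and ψ a right inverse up to the factor a, and each
variable then gives a homotopy.

What matters for columns is the distance from the left end. Let k = max(e,0) + p. If k > r, the map
out of ⋀^k is injective up to torsion, so a regular sequence longer than the row number suffices. If
k ≤ r, the column is first prolonged to the left by a splice ⋀^{k+m} → ⋀^k and a contraction complex
with inverse polynomials; then grade r is just enough for exterior degree at least 2. In case (a)
the long sequences needed for k > r are taken from I_φ. This is legitimate because I_φ lies in the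
radical of the ideal of factors up to which ψ has a right inverse
(`minorIdeal_le_radical_sectionIdeal`): once an l-minor of φ is inverted, ψ factors through a free
module of rank n - l, and with l ≥ 2 a grade of at least r is then large enough to force
surjectivity. -/

/-! ### Acyclicity from regular sequences -/

section Acyclicity

open RingTheory.Sequence

/-- The acyclicity lemma: a cochain complex `0 → A 0 → A 1 → ⋯` whose terms admit the weakly
regular sequence `rs`, and whose cohomology is torsion with respect to every member of `rs`, is
exact in the positions smaller than the length of `rs`. -/
theorem exact_of_isWeaklyRegular {R : Type*} [CommRing R] (rs : List R) :
    ∀ (A : ℕ → Type u) [∀ j, AddCommGroup (A j)] [∀ j, Module R (A j)]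
      (d : ∀ j, A j →ₗ[R] A (j + 1)), (∀ j x, d (j + 1) (d j x) = 0) →
      (∀ j, IsWeaklyRegular (A j) rs) →
      (∀ a ∈ rs, ∀ x, d 0 x = 0 → ∃ N : ℕ, a ^ N • x = 0) →
      (∀ a ∈ rs, ∀ j x, d (j + 1) x = 0 → ∃ N : ℕ, ∃ y, a ^ N • x = d j y) →
      (0 < rs.length → ∀ x, d 0 x = 0 → x = 0) ∧
      (∀ j, j + 1 < rs.length → ∀ x, d (j + 1) x = 0 → ∃ y, d j y = x) := by
  induction rs with
  | nil =>
    intro A _ _ d _ _ _ _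
    exact ⟨fun h => absurd h (by simp), fun j h => absurd h (by simp)⟩
  | cons a rs ih =>
    intro A _ _ d hdd hreg ht0 ht
    have ha : ∀ j, IsSMulRegular (A j) a := fun j => ((isWeaklyRegular_cons_iff _ _ _).1 (hreg j)).1
    have hN : ∀ (N : ℕ) j (x : A j), a ^ N • x = 0 → x = 0 := fun N j x hx =>
      ((ha j).pow N) (by simpa using hx)
    have hmem : ∀ j (x : A j), (Submodule.Quotient.mk x : QuotSMulTop a (A j)) = 0 →
        ∃ y, a • y = x := by
      intro j x hx
      rw [Submodule.Quotient.mk_eq_zero, Submodule.mem_smul_pointwise_iff_exists] at hx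
      obtain ⟨y, -, hy⟩ := hx
      exact ⟨y, hy⟩
    have hmem' : ∀ j (y : A j), (Submodule.Quotient.mk (a • y) : QuotSMulTop a (A j)) = 0 := by
      intro j y
      rw [Submodule.Quotient.mk_eq_zero]
      exact Submodule.smul_mem_pointwise_smul _ _ _ trivial
    -- A cycle x modulo a has d x = a y, and y is a cycle by regularity of a. Hence b^N y = d z, and
    -- b^N x - a z is a genuine cycle; this transfers torsion to the quotient complex.
    have hsplit : ∀ b ∈ rs, ∀ j (x : A j),
        (Submodule.Quotient.mk (d j x) : QuotSMulTop a (A (j + 1))) = 0 →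
        ∃ N : ℕ, ∃ z, d j (b ^ N • x - a • z) = 0 := by
      intro b hb j x hx
      obtain ⟨y, hy⟩ := hmem _ _ hx
      have hdy : d (j + 1) y = 0 := by
        refine ha _ ?_
        change a • _ = a • _
        rw [← map_smul, hy, hdd, smul_zero]
      obtain ⟨N, z, hz⟩ := ht b (List.mem_cons_of_mem _ hb) j y hdy
      refine ⟨N, z, ?_⟩
      rw [map_sub, map_smul, map_smul, ← hz, ← hy, smul_comm, sub_self]
    obtain ⟨ih0, ih1⟩ := ih (fun j => QuotSMulTop a (A j)) (fun j => QuotSMulTop.map a (d j))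
      (by
        intro j x
        obtain ⟨x, rfl⟩ := Submodule.Quotient.mk_surjective _ x
        change (Submodule.Quotient.mk (d (j + 1) (d j x)) : QuotSMulTop a (A (j + 1 + 1))) = 0
        rw [hdd]; rfl)
      (fun j => ((isWeaklyRegular_cons_iff _ _ _).1 (hreg j)).2)
      (by
        intro b hb x hx
        obtain ⟨x, rfl⟩ := Submodule.Quotient.mk_surjective _ x
        obtain ⟨N, z, hz⟩ := hsplit b hb 0 x hx
        obtain ⟨M, hM⟩ := ht0 b (List.mem_cons_of_mem _ hb) _ hz
        refine ⟨M + N, ?_⟩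
        rw [smul_sub, sub_eq_zero, smul_smul, ← pow_add, smul_comm] at hM
        rw [← Submodule.Quotient.mk_smul, hM]
        exact hmem' _ _)
      (by
        intro b hb j x hx
        obtain ⟨x, rfl⟩ := Submodule.Quotient.mk_surjective _ x
        obtain ⟨N, z, hz⟩ := hsplit b hb (j + 1) x hx
        obtain ⟨M, y, hM⟩ := ht b (List.mem_cons_of_mem _ hb) _ _ hz
        refine ⟨M + N, Submodule.Quotient.mk y, ?_⟩
        rw [smul_sub, sub_eq_iff_eq_add, smul_smul, ← pow_add, smul_comm] at hM
        rw [← Submodule.Quotient.mk_smul, hM, Submodule.Quotient.mk_add, hmem', add_zero]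
        rfl)
    refine ⟨fun _ x hx => ?_, fun j hj x hx => ?_⟩
    · obtain ⟨N, hN'⟩ := ht0 a (by simp) x hx
      exact hN _ _ _ hN'
    · obtain ⟨N, y, hy⟩ := ht a (by simp) j x hx
      have hj' : j < rs.length := by simpa using hj
      clear hx
      -- The exponent is lowered one unit at a time. Since d y is divisible by a, y is a cycle
      -- modulo a, one position below x; exactness of the quotient complex there replaces y by a
      -- multiple of a without changing d y, and a cancels.
      induction N generalizing y with
      | zero => exact ⟨y, by simpa using hy.symm⟩
      | succ N ihN =>
        rw [pow_succ', mul_smul] at hy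
        have hc : (Submodule.Quotient.mk (d j y) : QuotSMulTop a (A (j + 1))) = 0 := by
          rw [← hy]; exact hmem' _ _
        suffices h : ∃ y', d j y = a • d j y' by
          obtain ⟨y', hy'⟩ := h
          exact ihN y' (ha _ (hy.trans hy'))
        cases j with
        | zero =>
          obtain ⟨y', rfl⟩ := hmem _ _ (ih0 hj' (Submodule.Quotient.mk y) hc)
          exact ⟨y', map_smul _ _ _⟩
        | succ j =>
          obtain ⟨u, hu⟩ := ih1 j hj' (Submodule.Quotient.mk y) hc
          obtain ⟨u, rfl⟩ := Submodule.Quotient.mk_surjective _ u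
          have hu' : (Submodule.Quotient.mk (y - d j u) : QuotSMulTop a (A (j + 1))) = 0 := by
            rw [Submodule.Quotient.mk_sub, sub_eq_zero, ← hu]; rfl
          obtain ⟨y', hy'⟩ := hmem _ _ hu'
          refine ⟨y', ?_⟩
          rw [← map_smul, hy', map_sub, hdd, sub_zero]

/-- A weakly regular sequence on the ring is weakly regular on every flat module. -/
theorem isWeaklyRegular_of_flat {R : Type*} [CommRing R] {rs : List R} (h : IsWeaklyRegular R rs)
    (M : Type*) [AddCommGroup M] [Module R M] [Module.Flat R M] : IsWeaklyRegular M rs :=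
  ((TensorProduct.rid R M).isWeaklyRegular_congr rs).1 (h.isWeaklyRegular_lTensor)

/-- The acyclicity lemma for a complex of flat submodules of a fixed module. -/
theorem exact_submodule_of_isWeaklyRegular {R : Type*} [CommRing R] {rs : List R}
    (hrs : IsWeaklyRegular R rs) {U : Type*} [AddCommGroup U] [Module R U]
    (A : ℕ → Submodule R U) [∀ j, Module.Flat R (A j)] (d : ℕ → U →ₗ[R] U)
    (hA : ∀ j, ∀ x ∈ A j, d j x ∈ A (j + 1)) (hdd : ∀ j, ∀ x ∈ A j, d (j + 1) (d j x) = 0)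
    (ht0 : ∀ a ∈ rs, ∀ x ∈ A 0, d 0 x = 0 → ∃ N : ℕ, a ^ N • x = 0)
    (ht : ∀ a ∈ rs, ∀ j, ∀ x ∈ A (j + 1), d (j + 1) x = 0 →
      ∃ N : ℕ, ∃ y ∈ A j, a ^ N • x = d j y) :
    (0 < rs.length → ∀ x ∈ A 0, d 0 x = 0 → x = 0) ∧
      (∀ j, j + 1 < rs.length → ∀ x ∈ A (j + 1), d (j + 1) x = 0 → ∃ y ∈ A j, d j y = x) := by
  obtain ⟨h0, h1⟩ := exact_of_isWeaklyRegular rs (fun j => A j)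
    (fun j => (d j).restrict (hA j)) (fun j x => Subtype.ext (hdd j x.1 x.2))
    (fun j => isWeaklyRegular_of_flat hrs _)
    (fun a ha x hx => by
      obtain ⟨N, hN⟩ := ht0 a ha x.1 x.2 (congrArg Subtype.val hx)
      exact ⟨N, Subtype.ext hN⟩)
    (fun a ha j x hx => by
      obtain ⟨N, y, hy, h⟩ := ht a ha j x.1 x.2 (congrArg Subtype.val hx)
      exact ⟨N, ⟨y, hy⟩, Subtype.ext h⟩)
  refine ⟨fun h x hx hd => congrArg Subtype.val (h0 h ⟨x, hx⟩ (Subtype.ext hd)), ?_⟩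
  intro j hj x hx hd
  obtain ⟨y, hy⟩ := h1 j hj ⟨x, hx⟩ (Subtype.ext hd)
  exact ⟨y.1, y.2, congrArg Subtype.val hy⟩

end Acyclicity

/-! ### Operators on polynomial rings -/

section PolynomialOperators

open MvPolynomial

variable (R : Type*) [CommRing R] {σ : Type*}

/-- Multiplication by the variable `X j`. -/
def mulX (j : σ) : Module.End R (MvPolynomial σ R) := LinearMap.mulLeft R (X j)

/-- Division by the variable `X j`, which kills the monomials not divisible by `X j`. -/
def divX (j : σ) : Module.End R (MvPolynomial σ R) where
  toFun p := p.divMonomial (Finsupp.single j 1)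
  map_add' p q := add_divMonomial p q _
  map_smul' r p := by
    ext s
    simp [coeff_divMonomial]

/-- The substitution `X j = 0`. -/
def evalX (j : σ) : Module.End R (MvPolynomial σ R) := 1 - mulX R j * divX R j

variable {R}

theorem divX_mul_mulX (j : σ) : divX R j * mulX R j = 1 := by
  ext1 p
  exact LinearMap.ext_ring (X_mul_divMonomial j _)

theorem mulX_mul_divX (j : σ) : mulX R j * divX R j = 1 - evalX R j := by
  simp [evalX]

theorem mulX_comm (i j : σ) : mulX R i * mulX R j = mulX R j * mulX R i := by
  ext1 p
  exact LinearMap.ext_ring (mul_left_comm _ _ _)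

theorem divX_comm (i j : σ) : divX R i * divX R j = divX R j * divX R i := by
  refine LinearMap.ext fun p => ?_
  change (p.divMonomial _).divMonomial _ = (p.divMonomial _).divMonomial _
  rw [← divMonomial_add, ← divMonomial_add, add_comm]

theorem mulX_apply (j : σ) (p : MvPolynomial σ R) : mulX R j p = X j * p := rfl

theorem coeff_divX (j : σ) (p : MvPolynomial σ R) (s : σ →₀ ℕ) :
    coeff s (divX R j p) = coeff (Finsupp.single j 1 + s) p := rfl

theorem divX_mulX_comm {i j : σ} (h : i ≠ j) :
    mulX R i * divX R j = divX R j * mulX R i := by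
  classical
  refine LinearMap.ext fun p => ?_
  ext s
  change coeff s (X i * divX R j p) = coeff s (divX R j (X i * p))
  rw [coeff_divX, coeff_X_mul', coeff_X_mul']
  have : i ∈ (Finsupp.single j 1 + s).support ↔ i ∈ s.support := by
    simp [h.symm]
  simp only [this]
  split_ifs with hs
  · rw [coeff_divX, add_tsub_assoc_of_le]
    rw [Finsupp.single_le_iff]
    exact Nat.one_le_iff_ne_zero.2 (Finsupp.mem_support_iff.1 hs)
  · rfl

theorem coeff_evalX (j : σ) (p : MvPolynomial σ R) (s : σ →₀ ℕ) :
    coeff s (evalX R j p) = if s j = 0 then coeff s p else 0 := by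
  classical
  change coeff s (p - X j * divX R j p) = _
  rw [coeff_sub, coeff_X_mul']
  by_cases hs : s j = 0
  · simp [hs]
  · rw [if_neg hs, if_pos
    (Finsupp.mem_support_iff.2 hs), coeff_divX, add_tsub_cancel_of_le, sub_self]
    rw [Finsupp.single_le_iff]
    exact Nat.one_le_iff_ne_zero.2 hs

open Classical in
theorem coeff_prod_evalX (L : List σ) (p : MvPolynomial σ R) (s : σ →₀ ℕ) :
    coeff s ((L.map (evalX R)).prod p) = if ∀ j ∈ L, s j = 0 then coeff s p else 0 := by
  induction L with
  | nil => simp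
  | cons j L ih =>
    simp only [List.map_cons, List.prod_cons, Module.End.mul_apply, coeff_evalX, ih,
      List.forall_mem_cons]
    by_cases h1 : s j = 0 <;> by_cases h2 : ∀ x ∈ L, s x = 0 <;> simp [h1, h2]

theorem mulX_mem {q : ℕ} (j : σ) {p : MvPolynomial σ R} (hp : p ∈ homogeneousSubmodule σ R q) :
    mulX R j p ∈ homogeneousSubmodule σ R (q + 1) := by
  rw [mem_homogeneousSubmodule] at hp ⊢
  rw [mulX_apply, add_comm]
  exact (isHomogeneous_X R j).mul hp

theorem divX_mem {q : ℕ} (j : σ) {p : MvPolynomial σ R}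
    (hp : p ∈ homogeneousSubmodule σ R (q + 1)) : divX R j p ∈ homogeneousSubmodule σ R q := by
  rw [mem_homogeneousSubmodule] at hp ⊢
  intro s hs
  rw [coeff_divX] at hs
  have h := hp hs
  rw [map_add, Finsupp.weight_single, Pi.one_apply, smul_eq_mul, mul_one, add_comm] at h
  exact Nat.succ.inj h

theorem divX_eq_zero (j : σ) {p : MvPolynomial σ R} (hp : p ∈ homogeneousSubmodule σ R 0) :
    divX R j p = 0 := by
  ext s
  rw [coeff_divX, coeff_zero]
  by_contra hs
  have h := hp hs
  rw [map_add, Finsupp.weight_single] at h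
  simp at h

theorem evalX_mem {q : ℕ} (j : σ) {p : MvPolynomial σ R} (hp : p ∈ homogeneousSubmodule σ R q) :
    evalX R j p ∈ homogeneousSubmodule σ R q := by
  cases q with
  | zero =>
    change p - mulX R j (divX R j p) ∈ _
    rw [divX_eq_zero j hp, map_zero, sub_zero]
    exact hp
  | succ q => exact sub_mem hp (mulX_mem j (divX_mem j hp))

/-- Only the constant term survives all the substitutions X j = 0, and a form of positive degree has
none. -/
theorem prod_evalX_eq_zero {L : List σ} (hL : ∀ j, j ∈ L) {q : ℕ} {p : MvPolynomial σ R}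
    (hp : p ∈ homogeneousSubmodule σ R (q + 1)) : (L.map (evalX R)).prod p = 0 := by
  classical
  ext s
  rw [coeff_prod_evalX, coeff_zero]
  split_ifs with h
  · have : s = 0 := Finsupp.ext fun j => h j (hL j)
    subst this
    by_contra h0
    simpa using hp h0
  · rfl

/-- The projection of the polynomial ring onto its homogeneous component of degree `q`. -/
def homogeneousProj (R : Type*) [CommRing R] (σ : Type*) (q : ℕ) :
    MvPolynomial σ R →ₗ[R] homogeneousSubmodule σ R q :=
  (homogeneousComponent q).codRestrict _ (homogeneousComponent_mem q)

theorem homogeneousProj_comp_subtype (q : ℕ) :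
    homogeneousProj R σ q ∘ₗ (homogeneousSubmodule σ R q).subtype = LinearMap.id := by
  refine LinearMap.ext fun p => Subtype.ext ?_
  change homogeneousComponent q p.1 = p.1
  rw [homogeneousComponent_of_mem p.2, if_pos rfl]

/-- A direct summand of the polynomial ring, split off by the homogeneous component; it supplies the
flatness required by the acyclicity lemma. -/
instance (q : ℕ) : Module.Projective R (homogeneousSubmodule σ R q) :=
  Module.Projective.of_split _ _ (homogeneousProj_comp_subtype q)

end PolynomialOperators

/-! ### Operators on exterior algebras -/

section ExteriorOperators

variable {R : Type*} [CommRing R] {G : Type*} [AddCommGroup G] [Module R G]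

variable (R G) in
/-- The module underlying the exterior algebra. -/
def ExtModule : Type _ := ExteriorAlgebra R G

instance : AddCommGroup (ExtModule R G) := inferInstanceAs (AddCommGroup (ExteriorAlgebra R G))

instance : Module R (ExtModule R G) := inferInstanceAs (Module R (ExteriorAlgebra R G))

/-- Left multiplication by a vector on the exterior algebra. -/
def wedgeEnd (v : G) : Module.End R (ExtModule R G) :=
  LinearMap.mulLeft R (ExteriorAlgebra.ι R v)

/-- Contraction by a linear form on the exterior algebra. -/
def contractEnd (f : Module.Dual R G) : Module.End R (ExtModule R G) :=
  CliffordAlgebra.contractLeft f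

theorem contractEnd_wedgeEnd (f : Module.Dual R G) (v : G) :
    contractEnd f * wedgeEnd v + wedgeEnd v * contractEnd f = f v • 1 := by
  refine LinearMap.ext fun (y : ExteriorAlgebra R G) => ?_
  have e : CliffordAlgebra.contractLeft f (ExteriorAlgebra.ι R v * y)
      = f v • y - ExteriorAlgebra.ι R v * CliffordAlgebra.contractLeft f y :=
    CliffordAlgebra.contractLeft_ι_mul f v y
  change CliffordAlgebra.contractLeft f (ExteriorAlgebra.ι R v * y) +
    ExteriorAlgebra.ι R v * CliffordAlgebra.contractLeft f y = f v • y
  rw [e, sub_add_cancel]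

theorem contractEnd_mul_self (f : Module.Dual R G) : contractEnd f * contractEnd f = 0 :=
  LinearMap.ext fun (y : ExteriorAlgebra R G) =>
    CliffordAlgebra.contractLeft_contractLeft (Q := 0) f y

theorem contractEnd_comm (f g : Module.Dual R G) :
    contractEnd f * contractEnd g = -(contractEnd g * contractEnd f) :=
  LinearMap.ext fun (y : ExteriorAlgebra R G) => CliffordAlgebra.contractLeft_comm (Q := 0) f g y

theorem wedgeEnd_mul_self (v : G) : wedgeEnd (R := R) v * wedgeEnd v = 0 :=
  LinearMap.ext fun (y : ExteriorAlgebra R G) => by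
    change ExteriorAlgebra.ι R v * (ExteriorAlgebra.ι R v * y) = 0
    rw [← mul_assoc, ExteriorAlgebra.ι_sq_zero, zero_mul]

theorem wedgeEnd_comm (v v' : G) :
    wedgeEnd (R := R) v * wedgeEnd v' = -(wedgeEnd v' * wedgeEnd v) :=
  LinearMap.ext fun (y : ExteriorAlgebra R G) => by
    change ExteriorAlgebra.ι R v * (ExteriorAlgebra.ι R v' * y) =
      -(ExteriorAlgebra.ι R v' * (ExteriorAlgebra.ι R v * y))
    rw [← mul_assoc, ← mul_assoc, ← neg_mul]
    congr 1
    exact eq_neg_of_add_eq_zero_left (ExteriorAlgebra.ι_add_mul_swap v v')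

theorem wedgeEnd_mem (v : G) {k k' : ℤ} (h : k' = k + 1) {y : ExteriorAlgebra R G}
    (hy : y ∈ extPow R G k) : wedgeEnd v y ∈ extPow R G k' := wedge_mem v h hy

theorem contractEnd_mem (f : Module.Dual R G) {k k' : ℤ} (h : k = k' + 1)
    {y : ExteriorAlgebra R G} (hy : y ∈ extPow R G k) : contractEnd f y ∈ extPow R G k' :=
  contract_mem f h hy

theorem wedgeEnd_mul_contractEnd_mem (f : Module.Dual R G) (v : G) {k : ℤ}
    {y : ExteriorAlgebra R G} (hy : y ∈ extPow R G k) :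
    (wedgeEnd v * contractEnd f : Module.End R (ExtModule R G)) y ∈ extPow R G k :=
  wedge_mem v (k := k - 1) (by ring) (contract_mem f (by ring) hy)

theorem contractEnd_mul_wedgeEnd_mem (f : Module.Dual R G) (v : G) {k : ℤ}
    {y : ExteriorAlgebra R G} (hy : y ∈ extPow R G k) :
    (contractEnd f * wedgeEnd v : Module.End R (ExtModule R G)) y ∈ extPow R G k :=
  contract_mem f (k := k + 1) rfl (wedge_mem v rfl hy)

instance [Module.Free R G] (k : ℤ) : Module.Free R (extPow R G k) := by
  rcases lt_or_ge k 0 with h | h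
  · rw [extPow_of_neg h]; infer_instance
  · obtain ⟨k, rfl⟩ := Int.eq_ofNat_of_zero_le h
    rw [extPow_natCast]; infer_instance

/-- Above the rank, a basis would be indexed by the k-subsets of `Fin n`, and there are none. -/
theorem extPow_eq_bot {n : ℕ} (b : Module.Basis (Fin n) R G) {k : ℤ} (hk : k < 0 ∨ n < k) :
    extPow R G k = ⊥ := by
  rcases lt_or_ge k 0 with h | h
  · exact extPow_of_neg h
  · obtain ⟨k, rfl⟩ := Int.eq_ofNat_of_zero_le h
    rw [extPow_natCast, eq_bot_iff]
    have hlt : n < k := by omega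
    have : IsEmpty (Set.powersetCard (Fin n) k) := by
      constructor
      rintro ⟨s, hs⟩
      have h1 := Finset.card_le_univ s
      rw [Fintype.card_fin] at h1
      have h2 : s.card = k := hs
      omega
    intro y hy
    have := (b.exteriorPower (n := k)).ext_elem (x := ⟨y, hy⟩) (y := 0) (fun i => isEmptyElim i)
    simpa using congrArg Subtype.val this

end ExteriorOperators

/-! ### Homotopies -/

section Homotopy

variable {R : Type*} [CommRing R]

/-- If the operators `σ i` are homotopies between `a` and `Q i` on a complex with differential
`D`, then the product of the `Q i` is homotopic to a power of `a`. -/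
theorem exists_homotopy {Y ι : Type*} [AddCommGroup Y] [Module R Y] {a : R} {D : Module.End R Y}
    (hD : D * D = 0) {S Q : ι → Module.End R Y} (hS : ∀ i, D * S i + S i * D = a • 1 - Q i)
    {P X : Submodule R Y} (hSP : ∀ i, ∀ x ∈ X, S i x ∈ P) (hQ : ∀ i, ∀ x ∈ X, Q i x ∈ X)
    (L : List ι) {x : Y} (hx : x ∈ X) (hDx : D x = 0) :
    (L.map Q).prod x ∈ X ∧ ∃ u ∈ P, a ^ L.length • x = D u + (L.map Q).prod x := by
  induction L with
  | nil => exact ⟨by simpa using hx, 0, zero_mem _, by simp⟩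
  | cons i L ih =>
    obtain ⟨hX, u, hu, h⟩ := ih
    -- From a^s x = D u + y, with y the product of the Q's applied to x, multiply by a and replace a
    -- y by D (S i y) + Q i y, which is valid because y is again a cycle.
    refine ⟨by simpa using hQ i _ hX, a • u + S i ((L.map Q).prod x),
      add_mem (P.smul_mem _ hu) (hSP i _ hX), ?_⟩
    have hy : D ((L.map Q).prod x) = 0 := by
      have h1 := congrArg D h
      rw [map_smul, hDx, smul_zero, map_add] at h1
      have h2 : D (D u) = 0 := LinearMap.congr_fun hD u
      rw [h2, zero_add] at h1
      exact h1.symm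
    have h3 := LinearMap.congr_fun (hS i) ((L.map Q).prod x)
    simp only [LinearMap.add_apply, Module.End.mul_apply, LinearMap.sub_apply,
      LinearMap.smul_apply, Module.End.one_apply, hy, map_zero, add_zero] at h3
    rw [List.length_cons, pow_succ', mul_smul, h, smul_add, map_add, map_smul, h3,
      List.map_cons, List.prod_cons, Module.End.mul_apply]
    abel

/-- The product of the operators `w i * c i` has the product of the `c i` as a right factor. -/
theorem exists_prod_mul_eq {A ι : Type*} [Ring A] {w c : ι → A}
    (h : ∀ i j, i ≠ j → c i * w j = -(w j * c i)) {L : List ι} (hL : L.Nodup) :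
    ∃ W : A, (L.map fun i => w i * c i).prod = W * (L.map c).prod ∧
      ∀ i ∉ L, c i * W = (-1) ^ L.length * (W * c i) := by
  induction L with
  | nil => exact ⟨1, by simp, by simp⟩
  | cons j L ih =>
    rw [List.nodup_cons] at hL
    obtain ⟨W, h1, h2⟩ := ih hL.2
    -- Moving c j to the right of W, which comes from L.length of the w's, costs this sign.
    refine ⟨(-1) ^ L.length * (w j * W), ?_, fun i hi => ?_⟩
    · have hW := h2 j hL.1
      rw [List.map_cons, List.prod_cons, List.map_cons, List.prod_cons, h1, mul_assoc,
        ← mul_assoc (c j), hW]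
      rcases neg_one_pow_eq_or A L.length with e | e <;> rw [e] <;> noncomm_ring
    · rw [List.mem_cons, not_or] at hi
      have hW := h2 i hi.2
      have hw := h i j hi.1
      have e1 : c i * (w j * W) = -(w j * (c i * W)) := by
        rw [← mul_assoc, hw, neg_mul, mul_assoc]
      rw [List.length_cons, pow_succ]
      rcases neg_one_pow_eq_or A L.length with e | e <;> rw [e] at hW ⊢ <;>
        simp only [one_mul, mul_one, neg_mul, mul_neg, mul_assoc, neg_neg] at * <;>
        simp [e1, hW]

/-- If the `c i` annihilate `x`, then the product of the `c i` recovers a multiple of `x` from the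
product of the `w i` with `x`. -/
theorem prod_mul_prod_reverse_apply {Y ι : Type*} [AddCommGroup Y] [Module R Y]
    {w c : ι → Module.End R Y} {a : R} (h : ∀ i j, i ≠ j → c i * w j = -(w j * c i))
    (h' : ∀ i, c i * w i + w i * c i = a • 1) {L : List ι} (hL : L.Nodup) :
    ∀ x : Y, (∀ i ∈ L, c i x = 0) →
      (L.map c).prod ((L.reverse.map w).prod x) = a ^ L.length • x := by
  induction L with
  | nil => simp
  | cons j L ih =>
    intro x hx
    rw [List.nodup_cons] at hL
    rw [List.forall_mem_cons] at hx
    have hy : ∀ i ∈ L, c i (w j x) = 0 := fun i hi => by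
      have hne : i ≠ j := fun e => hL.1 (e ▸ hi)
      have := LinearMap.congr_fun (h i j hne) x
      simp only [Module.End.mul_apply, LinearMap.neg_apply, hx.2 i hi, map_zero, neg_zero] at this
      exact this
    have hj := LinearMap.congr_fun (h' j) x
    simp only [LinearMap.add_apply, Module.End.mul_apply, hx.1, map_zero, add_zero,
      LinearMap.smul_apply, Module.End.one_apply] at hj
    rw [List.reverse_cons, List.map_append, List.prod_append, List.map_cons, List.prod_cons]
    simp only [List.map_cons, List.map_nil, List.prod_cons, List.prod_nil, mul_one,
      Module.End.mul_apply]
    rw [ih hL.2 _ hy, map_smul, hj, List.length_cons, pow_succ, mul_smul]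

end Homotopy

/-! ### Operators on the tensor product of a polynomial ring and an exterior algebra -/

section KoszulOperators

open MvPolynomial

variable {R : Type*} [CommRing R] {σ : Type*} {G : Type*} [AddCommGroup G] [Module R G]

variable (R σ G) in
/-- The tensor product of a polynomial ring and an exterior algebra. -/
def PolyExt : Type _ := MvPolynomial σ R ⊗[R] ExteriorAlgebra R G

instance : AddCommGroup (PolyExt R σ G) := inferInstanceAs (AddCommGroup (_ ⊗[R] _))

instance : Module R (PolyExt R σ G) := inferInstanceAs (Module R (_ ⊗[R] _))

/-- The tensor product of two endomorphisms. -/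
def tensorEnd (f : Module.End R (MvPolynomial σ R)) (g : Module.End R (ExtModule R G)) :
    Module.End R (PolyExt R σ G) := TensorProduct.map f g

theorem tensorEnd_mul (f f' : Module.End R (MvPolynomial σ R))
    (g g' : Module.End R (ExtModule R G)) :
    tensorEnd f g * tensorEnd f' g' = tensorEnd (f * f') (g * g') :=
  (TensorProduct.map_mul f f' g g').symm

theorem tensorEnd_one_one :
    tensorEnd (1 : Module.End R (MvPolynomial σ R)) (1 : Module.End R (ExtModule R G)) = 1 :=
  TensorProduct.map_one

theorem tensorEnd_prod {ι : Type*} (f : ι → Module.End R (MvPolynomial σ R))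
    (g : ι → Module.End R (ExtModule R G)) (L : List ι) :
    (L.map fun i => tensorEnd (f i) (g i)).prod = tensorEnd (L.map f).prod (L.map g).prod := by
  induction L with
  | nil => exact tensorEnd_one_one.symm
  | cons i L ih => simp only [List.map_cons, List.prod_cons, ih, tensorEnd_mul]

variable (f f' : Module.End R (MvPolynomial σ R)) (g g' : Module.End R (ExtModule R G))

theorem tensorEnd_add_left : tensorEnd (f + f') g = tensorEnd f g + tensorEnd f' g :=
  TensorProduct.map_add_left _ _ _

theorem tensorEnd_add_right : tensorEnd f (g + g') = tensorEnd f g + tensorEnd f g' :=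
  TensorProduct.map_add_right _ _ _

theorem tensorEnd_zero_left : tensorEnd (0 : Module.End R (MvPolynomial σ R)) g = 0 :=
  TensorProduct.map_zero_left _

theorem tensorEnd_zero_right : tensorEnd f (0 : Module.End R (ExtModule R G)) = 0 :=
  TensorProduct.map_zero_right _

theorem tensorEnd_neg_right : tensorEnd f (-g) = -tensorEnd f g := by
  rw [eq_neg_iff_add_eq_zero, ← tensorEnd_add_right, neg_add_cancel, tensorEnd_zero_right]

theorem tensorEnd_sub_left : tensorEnd (f - f') g = tensorEnd f g - tensorEnd f' g := by
  rw [eq_sub_iff_add_eq, ← tensorEnd_add_left, sub_add_cancel]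

theorem tensorEnd_smul_right (a : R) : tensorEnd f (a • g) = a • tensorEnd f g :=
  TensorProduct.map_smul_right _ _ _

/-- The differential `∑ f j ⊗ g j` of a Koszul complex. -/
def koszulEnd {ι : Type*} [Fintype ι] (f : ι → Module.End R (MvPolynomial σ R))
    (g : ι → Module.End R (ExtModule R G)) :
    Module.End R (PolyExt R σ G) := ∑ j, tensorEnd (f j) (g j)

variable {ι : Type*} [Fintype ι] {α : ι → Module.End R (MvPolynomial σ R)}
  {A : ι → Module.End R (ExtModule R G)}

/-- The terms (i,j) and (j,i) cancel, the polynomial factors commuting and the exterior ones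
anticommuting. The diagonal terms vanish by a separate hypothesis, as 2 may be a zero divisor. -/
theorem koszulEnd_mul_self (hα : ∀ i j, α i * α j = α j * α i)
    (hA : ∀ i j, A i * A j = -(A j * A i))
    (hA' : ∀ i, A i * A i = 0) : koszulEnd α A * koszulEnd α A = 0 := by
  classical
  simp only [koszulEnd, Finset.sum_mul_sum, tensorEnd_mul]
  rw [← Finset.sum_product']
  refine Finset.sum_involution (fun p _ => p.swap) ?_ ?_ (by simp) (by simp)
  · rintro ⟨i, j⟩ -
    simp only [Prod.swap]
    rw [hα j i, hA j i, tensorEnd_neg_right, add_neg_cancel]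
  · rintro ⟨i, j⟩ - h0 e
    simp only [Prod.swap, Prod.mk.injEq] at e
    rw [e.1, hA', tensorEnd_zero_right] at h0
    exact h0 rfl

/-- Only the summand j contributes: for k ≠ j, β commutes with α k while B anticommutes with A k. As
β inverts α j on one side only, the defect ε survives in the remainder. -/
theorem koszulEnd_bracket {j : ι} {β ε : Module.End R (MvPolynomial σ R)}
    {B : Module.End R (ExtModule R G)} {a : R}
    (hα : ∀ k, k ≠ j → α k * β = β * α k) (hA : ∀ k, k ≠ j → A k * B + B * A k = 0)
    (hAj : A j * B + B * A j = a • 1) (hβ : β * α j = 1) (hε : α j * β = 1 - ε) :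
    koszulEnd α A * tensorEnd β B + tensorEnd β B * koszulEnd α A =
      a • 1 - tensorEnd ε (A j * B) := by
  classical
  simp only [koszulEnd, Finset.sum_mul, Finset.mul_sum, ← Finset.sum_add_distrib, tensorEnd_mul]
  rw [Finset.sum_eq_single j]
  · rw [hβ, hε, tensorEnd_sub_left, sub_add_eq_add_sub, ← tensorEnd_add_right, hAj,
      tensorEnd_smul_right, tensorEnd_one_one]
  · intro k _ hk
    rw [hα k hk, ← tensorEnd_add_right, hA k hk, tensorEnd_zero_right]
  · simp

/-- The version with the sides exchanged, for differentials built from `divX`, where `mulX` is the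
one-sided inverse. -/
theorem koszulEnd_bracket' {j : ι} {β ε : Module.End R (MvPolynomial σ R)}
    {B : Module.End R (ExtModule R G)} {a : R}
    (hα : ∀ k, k ≠ j → α k * β = β * α k) (hA : ∀ k, k ≠ j → A k * B + B * A k = 0)
    (hAj : A j * B + B * A j = a • 1) (hβ : α j * β = 1) (hε : β * α j = 1 - ε) :
    koszulEnd α A * tensorEnd β B + tensorEnd β B * koszulEnd α A =
      a • 1 - tensorEnd ε (B * A j) := by
  classical
  simp only [koszulEnd, Finset.sum_mul, Finset.mul_sum, ← Finset.sum_add_distrib, tensorEnd_mul]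
  rw [Finset.sum_eq_single j]
  · rw [hβ, hε, tensorEnd_sub_left, ← add_sub_assoc, ← tensorEnd_add_right, hAj,
      tensorEnd_smul_right, tensorEnd_one_one]
  · intro k _ hk
    rw [hα k hk, ← tensorEnd_add_right, hA k hk, tensorEnd_zero_right]
  · simp

end KoszulOperators

/-! ### The homogeneous pieces -/

section Pieces

open MvPolynomial

variable (R : Type*) [CommRing R] (σ : Type*) (G : Type*) [AddCommGroup G] [Module R G]

/-- The inclusion of the tensor product of homogeneous components. -/
def pieceIncl (q : ℕ) (k : ℤ) :
    homogeneousSubmodule σ R q ⊗[R] extPow R G k →ₗ[R] PolyExt R σ G :=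
  TensorProduct.map (homogeneousSubmodule σ R q).subtype (extPow R G k).subtype

/-- The submodule `S_q ⊗ ⋀ᵏ G` of the tensor product of a polynomial ring and an exterior
algebra. -/
def piece (q : ℕ) (k : ℤ) : Submodule R (PolyExt R σ G) :=
  LinearMap.range (pieceIncl R σ G q k)

variable {R σ G}

/-- On the exterior factor this is flatness of the homogeneous polynomials; on the polynomial factor
the inclusion is split, hence stays injective after tensoring. -/
theorem pieceIncl_injective (q : ℕ) (k : ℤ) : Function.Injective (pieceIncl R σ G q k) := by
  have e : ⇑(pieceIncl R σ G q k) = (homogeneousSubmodule σ R q).subtype.rTensor _ ∘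
      (extPow R G k).subtype.lTensor _ := by
    rw [← LinearMap.coe_comp, LinearMap.rTensor_comp_lTensor]; rfl
  rw [e]
  refine Function.Injective.comp ?_
    (Module.Flat.lTensor_preserves_injective_linearMap _ (extPow R G k).injective_subtype)
  refine Function.LeftInverse.injective
    (g := (homogeneousProj R σ q).rTensor (ExteriorAlgebra R G)) fun x => ?_
  rw [← LinearMap.comp_apply, ← LinearMap.rTensor_comp, homogeneousProj_comp_subtype,
    LinearMap.rTensor_id, LinearMap.id_apply]

instance [Module.Free R G] (q : ℕ) (k : ℤ) : Module.Flat R (piece R σ G q k) :=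
  Module.Flat.of_linearEquiv (LinearEquiv.ofInjective _ (pieceIncl_injective q k)).symm

theorem tensorEnd_mem_piece {f : Module.End R (MvPolynomial σ R)}
    {g : Module.End R (ExtModule R G)} {q q' : ℕ} {k k' : ℤ}
    (hf : ∀ p ∈ homogeneousSubmodule σ R q, f p ∈ homogeneousSubmodule σ R q')
    (hg : ∀ y ∈ extPow R G k, g y ∈ extPow R G k') {x} (hx : x ∈ piece R σ G q k) :
    tensorEnd f g x ∈ piece R σ G q' k' := by
  obtain ⟨x, rfl⟩ := hx
  induction x using TensorProduct.induction_on with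
  | zero => simp
  | tmul p y => exact ⟨⟨f p, hf _ p.2⟩ ⊗ₜ ⟨g y.1, hg _ y.2⟩, rfl⟩
  | add x y hx hy => rw [map_add, map_add]; exact add_mem hx hy

theorem tensorEnd_eq_of_left {f f' : Module.End R (MvPolynomial σ R)}
    {g : Module.End R (ExtModule R G)} {q : ℕ} {k : ℤ}
    (hf : ∀ p ∈ homogeneousSubmodule σ R q, f p = f' p) {x} (hx : x ∈ piece R σ G q k) :
    tensorEnd f g x = tensorEnd f' g x := by
  obtain ⟨x, rfl⟩ := hx
  induction x using TensorProduct.induction_on with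
  | zero => simp
  | tmul p y =>
    change f p ⊗ₜ[R] g y.1 = f' p ⊗ₜ[R] g y.1
    rw [hf _ p.2]
  | add x y hx hy => rw [map_add, map_add, map_add, hx, hy]

theorem tensorEnd_eq_zero_of_left {f : Module.End R (MvPolynomial σ R)}
    {g : Module.End R (ExtModule R G)} {q : ℕ} {k : ℤ}
    (hf : ∀ p ∈ homogeneousSubmodule σ R q, f p = 0) {x} (hx : x ∈ piece R σ G q k) :
    tensorEnd f g x = 0 := by
  rw [tensorEnd_eq_of_left (f' := 0) (by simpa using hf) hx, tensorEnd_zero_left,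
    LinearMap.zero_apply]

theorem koszulEnd_mem_piece {ι : Type*} [Fintype ι] {f : ι → Module.End R (MvPolynomial σ R)}
    {g : ι → Module.End R (ExtModule R G)} {q q' : ℕ} {k k' : ℤ}
    (hf : ∀ j, ∀ p ∈ homogeneousSubmodule σ R q, f j p ∈ homogeneousSubmodule σ R q')
    (hg : ∀ j, ∀ y ∈ extPow R G k, g j y ∈ extPow R G k') {x} (hx : x ∈ piece R σ G q k) :
    koszulEnd f g x ∈ piece R σ G q' k' := by
  rw [koszulEnd, LinearMap.sum_apply]
  exact sum_mem fun j _ => tensorEnd_mem_piece (hf j) (hg j) hx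

theorem piece_eq_bot {q : ℕ} {k : ℤ} (h : extPow R G k = ⊥) : piece R σ G q k = ⊥ := by
  rw [eq_bot_iff]
  rintro _ ⟨x, rfl⟩
  rw [Submodule.mem_bot]
  induction x using TensorProduct.induction_on with
  | zero => simp
  | tmul p y =>
    have : y = 0 := Subtype.ext (by simpa [h] using y.2)
    rw [this, TensorProduct.tmul_zero, map_zero]
  | add x y hx hy => rw [map_add, hx, hy, add_zero]

theorem prod_contractEnd_mem {ι : Type*} (c : ι → Module.Dual R G) (L : List ι) {k k' : ℤ}
    (h : k = k' + L.length) {y : ExteriorAlgebra R G} (hy : y ∈ extPow R G k) :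
    (L.map fun i => contractEnd (c i)).prod y ∈ extPow R G k' := by
  induction L generalizing k' with
  | nil =>
    obtain rfl : k = k' := by simpa using h
    exact hy
  | cons i L ih =>
    rw [List.map_cons, List.prod_cons]
    exact contractEnd_mem _ rfl (ih (by rw [h, List.length_cons]; push_cast; ring))

theorem prod_wedgeEnd_mem {ι : Type*} (v : ι → G) (L : List ι) {k k' : ℤ}
    (h : k' = k + L.length) {y : ExteriorAlgebra R G} (hy : y ∈ extPow R G k) :
    (L.map fun i => wedgeEnd (R := R) (v i)).prod y ∈ extPow R G k' := by
  induction L generalizing k' with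
  | nil =>
    obtain rfl : k' = k := by simpa using h
    exact hy
  | cons i L ih =>
    rw [List.map_cons, List.prod_cons]
    exact wedgeEnd_mem _ (k := k + L.length) (by rw [h, List.length_cons]; push_cast; ring) (ih rfl)

end Pieces

/-! ### Exactness of Koszul complexes in a range of degrees -/

section Exactness

open MvPolynomial RingTheory.Sequence

variable {R : Type*} [CommRing R] {G : Type*} [AddCommGroup G] [Module R G] {m : ℕ}

/-- The Koszul differential `∑ X j ⊗ (v j ∧ -)`. -/
def wedgeDiff (v : Fin m → G) : Module.End R (PolyExt R (Fin m) G) :=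
  koszulEnd (mulX R) fun j => wedgeEnd (v j)

/-- The Koszul differential `∑ X j ⊗ (- ↼ f j)`. -/
def contractDiff (f : Fin m → Module.Dual R G) : Module.End R (PolyExt R (Fin m) G) :=
  koszulEnd (mulX R) fun j => contractEnd (f j)

/-- The Koszul differential with coefficients in the inverse polynomial ring. -/
def inverseDiff (f : Fin m → Module.Dual R G) : Module.End R (PolyExt R (Fin m) G) :=
  koszulEnd (divX R) fun j => contractEnd (f j)

/-- Contraction by the product of the linear forms `f j`. -/
def spliceEnd (f : Fin m → Module.Dual R G) : Module.End R (PolyExt R (Fin m) G) :=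
  tensorEnd 1 ((List.finRange m).map fun j => contractEnd (f j)).prod

theorem wedgeDiff_mul_self (v : Fin m → G) : wedgeDiff (R := R) v * wedgeDiff v = 0 :=
  koszulEnd_mul_self mulX_comm (fun _ _ => wedgeEnd_comm _ _) fun _ => wedgeEnd_mul_self _

theorem contractDiff_mul_self (f : Fin m → Module.Dual R G) :
    contractDiff f * contractDiff f = 0 :=
  koszulEnd_mul_self mulX_comm (fun _ _ => contractEnd_comm _ _) fun _ => contractEnd_mul_self _

theorem inverseDiff_mul_self (f : Fin m → Module.Dual R G) :
    inverseDiff f * inverseDiff f = 0 :=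
  koszulEnd_mul_self divX_comm (fun _ _ => contractEnd_comm _ _) fun _ => contractEnd_mul_self _

theorem wedgeDiff_mem (v : Fin m → G) {q : ℕ} {k k' : ℤ} (h : k' = k + 1) {x}
    (hx : x ∈ piece R (Fin m) G q k) : wedgeDiff v x ∈ piece R (Fin m) G (q + 1) k' :=
  koszulEnd_mem_piece (fun j _ => mulX_mem j) (fun _ _ => wedgeEnd_mem _ h) hx

theorem contractDiff_mem (f : Fin m → Module.Dual R G) {q : ℕ} {k k' : ℤ} (h : k = k' + 1) {x}
    (hx : x ∈ piece R (Fin m) G q k) : contractDiff f x ∈ piece R (Fin m) G (q + 1) k' :=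
  koszulEnd_mem_piece (fun j _ => mulX_mem j) (fun _ _ => contractEnd_mem _ h) hx

theorem inverseDiff_mem (f : Fin m → Module.Dual R G) {q : ℕ} {k k' : ℤ} (h : k = k' + 1) {x}
    (hx : x ∈ piece R (Fin m) G (q + 1) k) : inverseDiff f x ∈ piece R (Fin m) G q k' :=
  koszulEnd_mem_piece (fun j _ => divX_mem j) (fun _ _ => contractEnd_mem _ h) hx

theorem inverseDiff_eq_zero (f : Fin m → Module.Dual R G) {k : ℤ} {x}
    (hx : x ∈ piece R (Fin m) G 0 k) : inverseDiff f x = 0 := by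
  rw [inverseDiff, koszulEnd, LinearMap.sum_apply]
  exact Finset.sum_eq_zero fun j _ => tensorEnd_eq_zero_of_left (fun _ => divX_eq_zero j) hx

theorem spliceEnd_mem (f : Fin m → Module.Dual R G) {q : ℕ} {k k' : ℤ} (h : k = k' + m) {x}
    (hx : x ∈ piece R (Fin m) G q k) : spliceEnd f x ∈ piece R (Fin m) G q k' :=
  tensorEnd_mem_piece (fun _ => id)
    (fun _ => prod_contractEnd_mem f _ (by rw [h, List.length_finRange])) hx

theorem contractEnd_mul_prod (f : Fin m → Module.Dual R G) {j : Fin m} {L : List (Fin m)}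
    (hj : j ∈ L) : contractEnd (f j) * (L.map fun i => contractEnd (f i)).prod = 0 := by
  induction L with
  | nil => simp at hj
  | cons i L ih =>
    rw [List.map_cons, List.prod_cons, ← mul_assoc]
    by_cases h : j = i
    · rw [h, contractEnd_mul_self, zero_mul]
    · rw [contractEnd_comm, neg_mul, mul_assoc, ih (by simpa [h] using hj), mul_zero, neg_zero]

theorem prod_mul_contractEnd (f : Fin m → Module.Dual R G) {j : Fin m} {L : List (Fin m)}
    (hj : j ∈ L) : (L.map fun i => contractEnd (f i)).prod * contractEnd (f j) = 0 := by
  induction L with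
  | nil => simp at hj
  | cons i L ih =>
    rw [List.map_cons, List.prod_cons]
    by_cases h : j ∈ L
    · rw [mul_assoc, ih h, mul_zero]
    · have hji : j = i := by simpa [h] using hj
      subst hji
      clear ih hj h
      rw [mul_assoc]
      induction L with
      | nil => simp [contractEnd_mul_self]
      | cons i L ih =>
        rw [List.map_cons, List.prod_cons, mul_assoc, ← mul_assoc, contractEnd_comm, neg_mul,
          mul_assoc, ih, mul_zero, neg_zero]

theorem contractDiff_mul_spliceEnd (f : Fin m → Module.Dual R G) :
    contractDiff f * spliceEnd f = 0 := by
  rw [contractDiff, koszulEnd, spliceEnd, Finset.sum_mul]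
  refine Finset.sum_eq_zero fun j _ => ?_
  rw [tensorEnd_mul, contractEnd_mul_prod f (List.mem_finRange j), tensorEnd_zero_right]

theorem spliceEnd_mul_inverseDiff (f : Fin m → Module.Dual R G) :
    spliceEnd f * inverseDiff f = 0 := by
  rw [inverseDiff, koszulEnd, spliceEnd, Finset.mul_sum]
  refine Finset.sum_eq_zero fun j _ => ?_
  rw [tensorEnd_mul, prod_mul_contractEnd f (List.mem_finRange j), tensorEnd_zero_right]

/-- Vectors `v j` and linear forms `f i` which are dual to each other up to the factor `a`. -/
def IsDualUpTo (a : R) (f : Fin m → Module.Dual R G) (v : Fin m → G) : Prop :=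
  ∀ i j, f i (v j) = if i = j then a else 0

section Torsion

variable {a : R} {f : Fin m → Module.Dual R G} {v : Fin m → G}

theorem IsDualUpTo.anticomm (h : IsDualUpTo a f v) {i j : Fin m} (hij : i ≠ j) :
    contractEnd (f i) * wedgeEnd (v j) + wedgeEnd (v j) * contractEnd (f i) = 0 := by
  rw [contractEnd_wedgeEnd, h, if_neg hij, zero_smul]

theorem IsDualUpTo.mul_eq_neg (h : IsDualUpTo a f v) (i j : Fin m) (hij : i ≠ j) :
    contractEnd (f i) * wedgeEnd (v j) = -(wedgeEnd (v j) * contractEnd (f i)) :=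
  eq_neg_of_add_eq_zero_left (h.anticomm hij)

theorem IsDualUpTo.bracket_self (h : IsDualUpTo a f v) (j : Fin m) :
    contractEnd (f j) * wedgeEnd (v j) + wedgeEnd (v j) * contractEnd (f j) = a • 1 := by
  rw [contractEnd_wedgeEnd, h, if_pos rfl]

/-- The homotopy for j divides by X j and contracts by f j. The total remainder sets all variables
to zero, so it dies in positive polynomial degree. -/
theorem IsDualUpTo.wedgeDiff_homotopy (h : IsDualUpTo a f v) {q : ℕ} {k : ℤ}
    {x} (hx : x ∈ piece R (Fin m) G (q + 1) k)
    (hDx : wedgeDiff v x = 0) :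
    ∃ u ∈ piece R (Fin m) G q (k - 1), a ^ m • x = wedgeDiff v u := by
  obtain ⟨-, u, hu, e⟩ := exists_homotopy (wedgeDiff_mul_self v)
    (S := fun j => tensorEnd (divX R j) (contractEnd (f j)))
    (Q := fun j => tensorEnd (evalX R j) (wedgeEnd (v j) * contractEnd (f j))) (a := a)
    (P := piece R (Fin m) G q (k - 1)) (X := piece R (Fin m) G (q + 1) k)
    (fun j => koszulEnd_bracket (fun i hi => divX_mulX_comm hi)
      (fun i hi => (add_comm _ _).trans (h.anticomm (Ne.symm hi)))
      ((add_comm _ _).trans (h.bracket_self j)) (divX_mul_mulX j) (mulX_mul_divX j))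
    (fun j x => tensorEnd_mem_piece (fun _ => divX_mem j) fun _ => contractEnd_mem _ (by ring))
    (fun j x => tensorEnd_mem_piece (fun _ => evalX_mem j) fun _ =>
      wedgeEnd_mul_contractEnd_mem _ _)
    (List.finRange m) hx hDx
  refine ⟨u, hu, ?_⟩
  rw [tensorEnd_prod, tensorEnd_eq_zero_of_left
    (fun _ => prod_evalX_eq_zero List.mem_finRange) hx, add_zero, List.length_finRange] at e
  exact e

/-- In polynomial degree 0 the homotopies vanish, and the remainder factors through contraction by
all m forms, which lands in ⋀^{k-m} G = 0. -/
theorem IsDualUpTo.wedgeDiff_torsion (h : IsDualUpTo a f v) {k : ℤ} (hk : k < m)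
    {x} (hx : x ∈ piece R (Fin m) G 0 k)
    (hDx : wedgeDiff v x = 0) : a ^ m • x = 0 := by
  obtain ⟨-, u, hu, e⟩ := exists_homotopy (wedgeDiff_mul_self v)
    (S := fun j => tensorEnd (divX R j) (contractEnd (f j)))
    (Q := fun j => tensorEnd (evalX R j) (wedgeEnd (v j) * contractEnd (f j))) (a := a)
    (P := ⊥) (X := piece R (Fin m) G 0 k)
    (fun j => koszulEnd_bracket (fun i hi => divX_mulX_comm hi)
      (fun i hi => (add_comm _ _).trans (h.anticomm (Ne.symm hi)))
      ((add_comm _ _).trans (h.bracket_self j)) (divX_mul_mulX j) (mulX_mul_divX j))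
    (fun j x hx => by
      rw [Submodule.mem_bot]
      exact tensorEnd_eq_zero_of_left (fun _ => divX_eq_zero j) hx)
    (fun j x => tensorEnd_mem_piece (fun _ => evalX_mem j) fun _ =>
      wedgeEnd_mul_contractEnd_mem _ _)
    (List.finRange m) hx hDx
  obtain ⟨W, hW, -⟩ := exists_prod_mul_eq h.mul_eq_neg (List.nodup_finRange m)
  rw [Submodule.mem_bot] at hu
  rw [hu, map_zero, zero_add, tensorEnd_prod, hW, ← mul_one (List.map (evalX R) _).prod,
    ← tensorEnd_mul, Module.End.mul_apply, List.length_finRange] at e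
  have h0 := tensorEnd_mem_piece (fun _ => id) (fun _ => prod_contractEnd_mem f (List.finRange m)
    (k := k) (k' := k - m) (by rw [List.length_finRange]; ring)) hx (f := 1)
  rw [piece_eq_bot (extPow_of_neg (by omega)), Submodule.mem_bot] at h0
  rw [e, h0, map_zero]

theorem IsDualUpTo.contractDiff_homotopy (h : IsDualUpTo a f v) {q : ℕ} {k : ℤ} {x}
    (hx : x ∈ piece R (Fin m) G (q + 1) k) (hDx : contractDiff f x = 0) :
    ∃ u ∈ piece R (Fin m) G q (k + 1), a ^ m • x = contractDiff f u := by
  obtain ⟨-, u, hu, e⟩ := exists_homotopy (contractDiff_mul_self f)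
    (S := fun j => tensorEnd (divX R j) (wedgeEnd (v j)))
    (Q := fun j => tensorEnd (evalX R j) (contractEnd (f j) * wedgeEnd (v j))) (a := a)
    (P := piece R (Fin m) G q (k + 1)) (X := piece R (Fin m) G (q + 1) k)
    (fun j => koszulEnd_bracket (fun i hi => divX_mulX_comm hi)
      (fun i hi => h.anticomm hi) (h.bracket_self j) (divX_mul_mulX j) (mulX_mul_divX j))
    (fun j x => tensorEnd_mem_piece (fun _ => divX_mem j) fun _ => wedgeEnd_mem _ (by ring))
    (fun j x => tensorEnd_mem_piece (fun _ => evalX_mem j) fun _ =>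
      contractEnd_mul_wedgeEnd_mem _ _)
    (List.finRange m) hx hDx
  refine ⟨u, hu, ?_⟩
  rw [tensorEnd_prod, tensorEnd_eq_zero_of_left
    (fun _ => prod_evalX_eq_zero List.mem_finRange) hx, add_zero, List.length_finRange] at e
  exact e

/-- The differential divides by variables, so the homotopies multiply by them and raise the
polynomial degree. The remainder is kept, because it disappears for different reasons in positive
degree and in degree 0. -/
theorem IsDualUpTo.inverseDiff_homotopy_aux (h : IsDualUpTo a f v) {q : ℕ} {k : ℤ} {x}
    (hx : x ∈ piece R (Fin m) G q k) (hDx : inverseDiff f x = 0) :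
    ∃ u ∈ piece R (Fin m) G (q + 1) (k + 1), a ^ m • x = inverseDiff f u +
      tensorEnd ((List.finRange m).map (evalX R)).prod
        ((List.finRange m).map fun j => wedgeEnd (v j) * contractEnd (f j)).prod x := by
  obtain ⟨-, u, hu, e⟩ := exists_homotopy (inverseDiff_mul_self f)
    (S := fun j => tensorEnd (mulX R j) (wedgeEnd (v j)))
    (Q := fun j => tensorEnd (evalX R j) (wedgeEnd (v j) * contractEnd (f j))) (a := a)
    (P := piece R (Fin m) G (q + 1) (k + 1)) (X := piece R (Fin m) G q k)
    (fun j => koszulEnd_bracket' (fun i hi => (divX_mulX_comm (Ne.symm hi)).symm)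
      (fun i hi => h.anticomm hi) (h.bracket_self j) (divX_mul_mulX j) (mulX_mul_divX j))
    (fun j x => tensorEnd_mem_piece (fun _ => mulX_mem j) fun _ => wedgeEnd_mem _ rfl)
    (fun j x => tensorEnd_mem_piece (fun _ => evalX_mem j) fun _ =>
      wedgeEnd_mul_contractEnd_mem _ _)
    (List.finRange m) hx hDx
  rw [tensorEnd_prod, List.length_finRange] at e
  exact ⟨u, hu, e⟩

theorem IsDualUpTo.inverseDiff_homotopy (h : IsDualUpTo a f v) {q : ℕ} {k : ℤ} {x}
    (hx : x ∈ piece R (Fin m) G (q + 1) k) (hDx : inverseDiff f x = 0) :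
    ∃ u ∈ piece R (Fin m) G (q + 1 + 1) (k + 1), a ^ m • x = inverseDiff f u := by
  obtain ⟨u, hu, e⟩ := h.inverseDiff_homotopy_aux hx hDx
  rw [tensorEnd_eq_zero_of_left (fun _ => prod_evalX_eq_zero List.mem_finRange) hx, add_zero] at e
  exact ⟨u, hu, e⟩

/-- The remainder has contraction by all the f j as a right factor, so it vanishes on the kernel of
`spliceEnd f`. -/
theorem IsDualUpTo.spliceEnd_homotopy (h : IsDualUpTo a f v) {k : ℤ} {x}
    (hx : x ∈ piece R (Fin m) G 0 k) (hDx : spliceEnd f x = 0) :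
    ∃ u ∈ piece R (Fin m) G 1 (k + 1), a ^ m • x = inverseDiff f u := by
  obtain ⟨u, hu, e⟩ := h.inverseDiff_homotopy_aux hx (inverseDiff_eq_zero f hx)
  refine ⟨u, hu, ?_⟩
  obtain ⟨W, hW, -⟩ := exists_prod_mul_eq h.mul_eq_neg (List.nodup_finRange m)
  rw [hW, ← mul_one (List.map (evalX R) _).prod, ← tensorEnd_mul, Module.End.mul_apply] at e
  have h0 : tensorEnd 1 ((List.finRange m).map fun j => contractEnd (f j)).prod x = 0 := hDx
  rw [h0, map_zero, add_zero] at e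
  exact e

/-- On polynomial degree 0, `divX j` picks the coefficient of X j out of the Koszul sum. -/
theorem contractEnd_eq_zero_of_contractDiff {k : ℤ} {x} (hx : x ∈ piece R (Fin m) G 0 k)
    (hDx : contractDiff f x = 0) (j : Fin m) :
    tensorEnd 1 (contractEnd (f j)) x = 0 := by
  have e := congrArg (tensorEnd (divX R j) 1) hDx
  rw [map_zero, contractDiff, ← Module.End.mul_apply, koszulEnd, Finset.mul_sum,
    LinearMap.sum_apply, Finset.sum_eq_single j] at e
  · rwa [tensorEnd_mul, divX_mul_mulX, one_mul] at e
  · intro i _ hi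
    rw [tensorEnd_mul, ← divX_mulX_comm hi]
    refine tensorEnd_eq_zero_of_left (fun p hp => ?_) hx
    rw [Module.End.mul_apply, divX_eq_zero j hp, map_zero]
  · simp

/-- Each f j annihilates x, so wedging with all the v j and contracting with all the f j returns a^m
x. The splice is therefore exact up to torsion. -/
theorem IsDualUpTo.exists_spliceEnd_eq (h : IsDualUpTo a f v) {k k' : ℤ} (hk : k' = k + m) {x}
    (hx : x ∈ piece R (Fin m) G 0 k) (hDx : contractDiff f x = 0) :
    ∃ u ∈ piece R (Fin m) G 0 k', a ^ m • x = spliceEnd f u := by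
  have e := prod_mul_prod_reverse_apply
    (w := fun j => tensorEnd (R := R) (σ := Fin m) 1 (wedgeEnd (v j)))
    (c := fun j => tensorEnd (σ := Fin m) 1 (contractEnd (f j))) (a := a)
    (fun i j hij => by rw [tensorEnd_mul, tensorEnd_mul, h.mul_eq_neg i j hij, tensorEnd_neg_right])
    (fun i => by
      rw [tensorEnd_mul, tensorEnd_mul, ← tensorEnd_add_right, h.bracket_self,
        tensorEnd_smul_right, one_mul, tensorEnd_one_one])
    (List.nodup_finRange m) x (fun j _ => contractEnd_eq_zero_of_contractDiff hx hDx j)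
  rw [tensorEnd_prod, tensorEnd_prod, List.length_finRange] at e
  have h1 : ∀ L : List (Fin m), (L.map fun _ =>
      (1 : Module.End R (MvPolynomial (Fin m) R))).prod = 1 :=
    fun L => by simp
  rw [h1, h1] at e
  exact ⟨_, tensorEnd_mem_piece (fun _ => id)
    (fun _ => prod_wedgeEnd_mem v _ (by rw [hk, List.length_reverse, List.length_finRange])) hx,
    e.symm⟩

end Torsion

end Exactness

/-! ### Exactness of Koszul strands from regular sequences -/

section ExactnessTheorems

open MvPolynomial RingTheory.Sequence

variable {R : Type*} [CommRing R] {G : Type*} [AddCommGroup G] [Module R G] {m : ℕ}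

/-- The conditions on k make the left end S_s ⊗ ⋀^k injective up to torsion: for s = 0 contraction
by m forms leaves nothing, and for s > 0 a preimage would lie over ⋀^{k-1} G = 0. -/
theorem wedgeDiff_exact [Module.Free R G] {rs : List R} (hrs : IsWeaklyRegular R rs) {v : Fin m → G}
    (hv : ∀ a ∈ rs, ∃ (N : ℕ) (f : Fin m → Module.Dual R G), IsDualUpTo (a ^ N) f v)
    (s : ℕ) (k : ℤ) (h0 : s = 0 → k < m) (h1 : s ≠ 0 → k ≤ 0) :
    (0 < rs.length → ∀ x ∈ piece R (Fin m) G s k, wedgeDiff v x = 0 → x = 0) ∧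
      ∀ j : ℕ, j + 1 < rs.length → ∀ x ∈ piece R (Fin m) G (s + (j + 1)) (k + (j + 1 : ℕ)),
        wedgeDiff v x = 0 → ∃ u ∈ piece R (Fin m) G (s + j) (k + j), wedgeDiff v u = x := by
  have key := exact_submodule_of_isWeaklyRegular hrs
    (fun j : ℕ => piece R (Fin m) G (s + j) (k + j)) (fun _ => wedgeDiff v)
    (fun j x hx => wedgeDiff_mem v (by push_cast; ring) hx)
    (fun j x _ => LinearMap.congr_fun (wedgeDiff_mul_self v) x)
    (fun a ha x hx hDx => by
      obtain ⟨N, f, h⟩ := hv a ha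
      refine ⟨N * m, ?_⟩
      rw [pow_mul]
      rcases s with _ | s
      · exact h.wedgeDiff_torsion (by have := h0 rfl; push_cast; omega) hx hDx
      · obtain ⟨u, hu, e⟩ := h.wedgeDiff_homotopy (q := s) hx hDx
        have := h1 (Nat.succ_ne_zero s)
        rw [piece_eq_bot (extPow_of_neg (by push_cast; omega)), Submodule.mem_bot] at hu
        rw [e, hu, map_zero])
    (fun a ha j x hx hDx => by
      obtain ⟨N, f, h⟩ := hv a ha
      obtain ⟨u, hu, e⟩ := h.wedgeDiff_homotopy (q := s + j) hx hDx
      refine ⟨N * m, u, ?_, by rw [pow_mul]; exact e⟩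
      convert hu using 2
      push_cast; ring)
  refine ⟨fun hl x hx => key.1 hl x (by simpa using hx), key.2⟩

/-- Up to torsion, the kernel of the first map is the image of the splice from ⋀^{k+m} G, which is
zero since k + m exceeds the rank. -/
theorem contractDiff_exact_of_lt [Module.Free R G] {n : ℕ} (b : Module.Basis (Fin n) R G)
    {rs : List R} (hrs : IsWeaklyRegular R rs) {f : Fin m → Module.Dual R G}
    (hf : ∀ a ∈ rs, ∃ (N : ℕ) (v : Fin m → G), IsDualUpTo (a ^ N) f v) {k : ℤ}
    (hk : (n : ℤ) < k + m) (q : ℕ) (hq : q + 1 < rs.length) (x)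
    (hx : x ∈ piece R (Fin m) G (q + 1) (k - (q + 1 : ℕ))) (hDx : contractDiff f x = 0) :
    ∃ u ∈ piece R (Fin m) G q (k - q), contractDiff f u = x := by
  refine (exact_submodule_of_isWeaklyRegular hrs
    (fun j : ℕ => piece R (Fin m) G j (k - j)) (fun _ => contractDiff f)
    (fun j x hx => contractDiff_mem f (by push_cast; ring) hx)
    (fun j x _ => LinearMap.congr_fun (contractDiff_mul_self f) x)
    (fun a ha x hx hDx => ?_) (fun a ha j x hx hDx => ?_)).2 q hq x hx hDx
  · obtain ⟨N, v, h⟩ := hf a ha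
    obtain ⟨u, hu, e⟩ := h.exists_spliceEnd_eq rfl hx hDx
    rw [piece_eq_bot (extPow_eq_bot b (Or.inr (by push_cast; omega))), Submodule.mem_bot] at hu
    exact ⟨N * m, by rw [pow_mul, e, hu, map_zero]⟩
  · obtain ⟨N, v, h⟩ := hf a ha
    obtain ⟨u, hu, e⟩ := h.contractDiff_homotopy hx hDx
    refine ⟨N * m, u, ?_, by rw [pow_mul]; exact e⟩
    convert hu using 2
    push_cast; ring

/-- Now ⋀^{k+m} G need not vanish, so the complex is prolonged to the left: S_s ⊗ ⋀^n → ⋯ → S_0 ⊗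
⋀^{k+m} → S_0 ⊗ ⋀^k → S_1 ⊗ ⋀^{k-1} → ⋯. The s + 1 added positions account for the bound on
`rs.length`. -/
theorem contractDiff_exact_of_le [Module.Free R G] {n : ℕ} (b : Module.Basis (Fin n) R G)
    {rs : List R} (hrs : IsWeaklyRegular R rs) {f : Fin m → Module.Dual R G}
    (hf : ∀ a ∈ rs, ∃ (N : ℕ) (v : Fin m → G), IsDualUpTo (a ^ N) f v) {k : ℤ} {s : ℕ}
    (hk : (n : ℤ) = k + m + s) (q : ℕ) (hq : s + 1 + q + 1 < rs.length) (x)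
    (hx : x ∈ piece R (Fin m) G (q + 1) (k - (q + 1 : ℕ))) (hDx : contractDiff f x = 0) :
    ∃ u ∈ piece R (Fin m) G q (k - q), contractDiff f u = x := by
  -- Positions 0, …, s carry the inverse polynomial part, `D s` is the splice, and the contraction
  -- complex starts at s + 1.
  let A : ℕ → Submodule R (PolyExt R (Fin m) G) := fun j =>
    if j ≤ s then piece R (Fin m) G (s - j) (n - j)
    else piece R (Fin m) G (j - (s + 1)) (k - (j - (s + 1) : ℕ))
  let D : ℕ → Module.End R (PolyExt R (Fin m) G) := fun j =>
    if j < s then inverseDiff f else if j = s then spliceEnd f else contractDiff f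
  have hAl : ∀ i j, i + j = s → A i = piece R (Fin m) G j (n - i) := fun i j h => by
    simp only [A]
    rw [if_pos (by omega), show s - i = j by omega]
  have hAr : ∀ i j, i = s + 1 + j → A i = piece R (Fin m) G j (k - j) := fun i j h => by
    simp only [A]
    rw [if_neg (by omega), show i - (s + 1) = j by omega]
  have hDl : ∀ i, i < s → D i = inverseDiff f := fun i h => if_pos h
  have hDs : D s = spliceEnd f := by simp [D]
  have hDr : ∀ i, s < i → D i = contractDiff f := fun i h => by
    simp only [D]
    rw [if_neg (by omega), if_neg (by omega)]
  have hflat : ∀ j, Module.Flat R (A j) := fun j => by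
    by_cases h : j ≤ s
    · rw [hAl j (s - j) (by omega)]; infer_instance
    · rw [hAr j (j - (s + 1)) (by omega)]; infer_instance
  have key := (exact_submodule_of_isWeaklyRegular hrs A D ?_ ?_ ?_ ?_).2 (s + 1 + q) hq x
    (by rwa [hAr _ (q + 1) (by omega)]) (by rwa [hDr _ (by omega)])
  · rwa [hAr _ q rfl, hDr _ (by omega)] at key
  · intro j x hx
    rcases lt_trichotomy j s with h | h | h
    · obtain ⟨i, rfl⟩ : ∃ i, s = j + 1 + i := ⟨s - j - 1, by omega⟩
      rw [hAl j (i + 1) (by omega)] at hx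
      rw [hDl j h, hAl (j + 1) i rfl]
      exact inverseDiff_mem f (by push_cast; ring) hx
    · subst h
      rw [hAl j 0 (by omega)] at hx
      rw [hDs, hAr (j + 1) 0 rfl]
      exact spliceEnd_mem f (by push_cast; omega) hx
    · obtain ⟨i, rfl⟩ : ∃ i, j = s + 1 + i := ⟨j - s - 1, by omega⟩
      rw [hAr _ i rfl] at hx
      rw [hDr _ h, hAr _ (i + 1) (by omega)]
      exact contractDiff_mem f (by push_cast; ring) hx
  · intro j x hx
    rcases lt_trichotomy (j + 1) s with h | h | h
    · rw [hDl j (by omega), hDl _ h]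
      exact LinearMap.congr_fun (inverseDiff_mul_self f) x
    · subst h
      rw [hDl j (by omega), hDs]
      exact LinearMap.congr_fun (spliceEnd_mul_inverseDiff f) x
    · rw [hDr _ h]
      rcases (by omega : j = s ∨ s < j) with h' | h'
      · subst h'
        rw [hDs]
        exact LinearMap.congr_fun (contractDiff_mul_spliceEnd f) x
      · rw [hDr _ h']
        exact LinearMap.congr_fun (contractDiff_mul_self f) x
  · intro a ha x hx hDx
    obtain ⟨N, v, h⟩ := hf a ha
    refine ⟨N * m, ?_⟩
    rw [pow_mul]
    rw [hAl 0 s (by omega)] at hx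
    -- A preimage at the left end would involve ⋀^{n+1} G = 0.
    have hbot : piece R (Fin m) G (s + 1) (n - (0 : ℕ) + 1) = ⊥ :=
      piece_eq_bot (extPow_eq_bot b (Or.inr (by push_cast; omega)))
    rcases s with _ | s
    · rw [hDs] at hDx
      obtain ⟨u, hu, e⟩ := h.spliceEnd_homotopy hx hDx
      rw [hbot, Submodule.mem_bot] at hu
      rw [e, hu, map_zero]
    · rw [hDl 0 (by omega)] at hDx
      obtain ⟨u, hu, e⟩ := h.inverseDiff_homotopy hx hDx
      rw [hbot, Submodule.mem_bot] at hu
      rw [e, hu, map_zero]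
  · intro a ha j x hx hDx
    obtain ⟨N, v, h⟩ := hf a ha
    refine ⟨N * m, ?_⟩
    rw [pow_mul]
    rcases lt_trichotomy (j + 1) s with h' | h' | h'
    · obtain ⟨i, rfl⟩ : ∃ i, s = j + 1 + 1 + i := ⟨s - j - 2, by omega⟩
      rw [hAl _ (i + 1) (by omega)] at hx
      rw [hDl _ h'] at hDx
      obtain ⟨u, hu, e⟩ := h.inverseDiff_homotopy hx hDx
      rw [hDl _ (by omega), hAl _ (i + 1 + 1) (by omega)]
      refine ⟨u, ?_, e⟩
      convert hu using 2
      push_cast; ring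
    · subst h'
      rw [hAl _ 0 (by omega)] at hx
      rw [hDs] at hDx
      obtain ⟨u, hu, e⟩ := h.spliceEnd_homotopy hx hDx
      rw [hDl _ (by omega), hAl _ 1 (by omega)]
      refine ⟨u, ?_, e⟩
      convert hu using 2
      push_cast; ring
    · rw [hDr _ h'] at hDx
      rcases (by omega : j = s ∨ s < j) with h2 | h2
      · subst h2
        rw [hAr _ 0 (by omega)] at hx
        obtain ⟨u, hu, e⟩ := h.exists_spliceEnd_eq rfl hx hDx
        rw [hDs, hAl _ 0 (by omega)]
        refine ⟨u, ?_, e⟩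
        convert hu using 2
        push_cast; omega
      · obtain ⟨i, rfl⟩ : ∃ i, j = s + 1 + i := ⟨j - s - 1, by omega⟩
        rw [hAr _ (i + 1) (by omega)] at hx
        obtain ⟨u, hu, e⟩ := h.contractDiff_homotopy hx hDx
        rw [hDr _ h2, hAr _ i rfl]
        refine ⟨u, ?_, e⟩
        convert hu using 2
        push_cast; ring

end ExactnessTheorems

/-! ### Exactness of rows and columns of the bicomplex -/

section Transfer

open MvPolynomial RingTheory.Sequence

variable {R : Type*} [CommRing R] {M : Type*} [AddCommGroup M] [Module R M]
  {G : Type*} [AddCommGroup G] [Module R G] {m : ℕ} (b : Module.Basis (Fin m) R M)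

theorem symPow_map_equivMvPolynomial (q : ℕ) :
    (symPow R M q).map (SymmetricAlgebra.equivMvPolynomial b).toLinearEquiv.toLinearMap =
      homogeneousSubmodule (Fin m) R q := by
  have h1 : (LinearMap.range (SymmetricAlgebra.ι R M)).map
      (SymmetricAlgebra.equivMvPolynomial b).toAlgHom.toLinearMap =
      homogeneousSubmodule (Fin m) R 1 := by
    rw [homogeneousSubmodule_one_eq_span_X, ← LinearMap.range_comp, LinearMap.range_eq_map,
      ← b.span_eq, Submodule.map_span, ← Set.range_comp]
    congr 1
    ext x
    simp
  have h2 : (symPow R M q).map (SymmetricAlgebra.equivMvPolynomial b).toAlgHom.toLinearMap =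
      homogeneousSubmodule (Fin m) R q := by
    rw [symPow, Submodule.map_pow, h1, homogeneousSubmodule_one_pow]
  exact h2

/-- A basis of `M` identifies `S_q(M)` with the homogeneous polynomials of degree `q`. -/
def symPowEquiv (q : ℕ) : symPow R M q ≃ₗ[R] homogeneousSubmodule (Fin m) R q :=
  (SymmetricAlgebra.equivMvPolynomial b).toLinearEquiv.submoduleMap (symPow R M q) ≪≫ₗ
    LinearEquiv.ofEq _ _ (symPow_map_equivMvPolynomial b q)

theorem coe_symPowEquiv (q : ℕ) (y : symPow R M q) :
    (symPowEquiv b q y : MvPolynomial (Fin m) R) = SymmetricAlgebra.equivMvPolynomial b y := rfl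

theorem flat_symPow (b : Module.Basis (Fin m) R M) (q : ℕ) : Module.Flat R (symPow R M q) :=
  Module.Flat.of_linearEquiv (symPowEquiv b q)

variable (G) in
/-- The embedding of `S_q(M) ⊗ ⋀ᵏ G` given by a basis of `M`. -/
def symExtIncl (q : ℕ) (k : ℤ) : symPow R M q ⊗[R] extPow R G k →ₗ[R] PolyExt R (Fin m) G :=
  pieceIncl R (Fin m) G q k ∘ₗ (TensorProduct.congr (symPowEquiv b q) (.refl R _)).toLinearMap

theorem symExtIncl_injective (q : ℕ) (k : ℤ) : Function.Injective (symExtIncl G b q k) :=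
  (pieceIncl_injective q k).comp (LinearEquiv.injective _)

theorem range_symExtIncl (q : ℕ) (k : ℤ) :
    LinearMap.range (symExtIncl G b q k) = piece R (Fin m) G q k := by
  rw [symExtIncl, LinearMap.range_comp, LinearEquiv.range, Submodule.map_top, piece]

theorem symExtIncl_mem (q : ℕ) (k : ℤ) (x) : symExtIncl G b q k x ∈ piece R (Fin m) G q k := by
  rw [← range_symExtIncl b]; exact ⟨x, rfl⟩

theorem exists_symExtIncl_eq {q : ℕ} {k : ℤ} {x} (hx : x ∈ piece R (Fin m) G q k) :
    ∃ y, symExtIncl G b q k y = x := by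
  rwa [← range_symExtIncl b] at hx

theorem symExtIncl_map {q q' : ℕ} {k k' : ℤ} (hq : q' = q + 1) (j : Fin m)
    (g : extPow R G k →ₗ[R] extPow R G k') (g' : Module.End R (ExtModule R G))
    (hg : ∀ y : extPow R G k, (g y : ExteriorAlgebra R G) = g' y.1)
    (x : symPow R M q ⊗[R] extPow R G k) :
    symExtIncl G b q' k' (TensorProduct.map (symMul (b j) hq) g x) =
      tensorEnd (mulX R j) g' (symExtIncl G b q k x) := by
  induction x using TensorProduct.induction_on with
  | zero => simp
  | add x y hx hy => rw [map_add, map_add, map_add, map_add, hx, hy]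
  | tmul a y =>
    have e1 : (symPowEquiv b q' (symMul (b j) hq a) : MvPolynomial (Fin m) R) =
        mulX R j (symPowEquiv b q a) := by
      rw [coe_symPowEquiv, coe_symPowEquiv, mulX_apply]
      change SymmetricAlgebra.equivMvPolynomial b (SymmetricAlgebra.ι R M (b j) * a) = _
      rw [map_mul, SymmetricAlgebra.equivMvPolynomial_ι_apply]
    change (symPowEquiv b q' (symMul (b j) hq a) : MvPolynomial (Fin m) R) ⊗ₜ[R]
      (g y : ExteriorAlgebra R G) = mulX R j (symPowEquiv b q a) ⊗ₜ[R] g' y.1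
    rw [e1, hg]
    rfl

variable (M) in
/-- The Koszul map `∑ b j ⊗ (v j ∧ -)` on `S_q(M) ⊗ ⋀ᵏ G`. -/
def symWedge (v : Fin m → G) {q q' : ℕ} {k k' : ℤ} (hq : q' = q + 1) (hk : k' = k + 1) :
    symPow R M q ⊗[R] extPow R G k →ₗ[R] symPow R M q' ⊗[R] extPow R G k' :=
  ∑ j, TensorProduct.map (symMul (b j) hq) (wedge (v j) hk)

variable (M) in
/-- The Koszul map `∑ b j ⊗ (- ↼ f j)` on `S_q(M) ⊗ ⋀ᵏ G`. -/
def symContract (f : Fin m → Module.Dual R G) {q q' : ℕ} {k k' : ℤ} (hq : q' = q + 1)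
    (hk : k = k' + 1) :
    symPow R M q ⊗[R] extPow R G k →ₗ[R] symPow R M q' ⊗[R] extPow R G k' :=
  ∑ j, TensorProduct.map (symMul (b j) hq) (contract (f j) hk)

theorem symExtIncl_symWedge (v : Fin m → G) {q q' : ℕ} {k k' : ℤ} (hq : q' = q + 1)
    (hk : k' = k + 1) (x) :
    symExtIncl G b q' k' (symWedge M b v hq hk x) = wedgeDiff v (symExtIncl G b q k x) := by
  rw [symWedge, wedgeDiff, koszulEnd, LinearMap.sum_apply, LinearMap.sum_apply, map_sum]
  exact Finset.sum_congr rfl fun j _ => symExtIncl_map b hq j _ _ (fun _ => rfl) x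

theorem symExtIncl_symContract (f : Fin m → Module.Dual R G) {q q' : ℕ} {k k' : ℤ}
    (hq : q' = q + 1) (hk : k = k' + 1) (x) :
    symExtIncl G b q' k' (symContract M b f hq hk x) = contractDiff f (symExtIncl G b q k x) := by
  rw [symContract, contractDiff, koszulEnd, LinearMap.sum_apply, LinearMap.sum_apply, map_sum]
  exact Finset.sum_congr rfl fun j _ => symExtIncl_map b hq j _ _ (fun _ => rfl) x

theorem symWedge_symWedge (v : Fin m → G) {q q' q'' : ℕ} {k k' k'' : ℤ} (hq : q' = q + 1)
    (hk : k' = k + 1) (hq' : q'' = q' + 1) (hk' : k'' = k' + 1) (x) :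
    symWedge M b v hq' hk' (symWedge M b v hq hk x) = 0 := by
  apply symExtIncl_injective b
  rw [symExtIncl_symWedge, symExtIncl_symWedge, map_zero]
  exact LinearMap.congr_fun (wedgeDiff_mul_self v) _

theorem symContract_symContract (f : Fin m → Module.Dual R G) {q q' q'' : ℕ} {k k' k'' : ℤ}
    (hq : q' = q + 1) (hk : k = k' + 1) (hq' : q'' = q' + 1) (hk' : k' = k'' + 1) (x) :
    symContract M b f hq' hk' (symContract M b f hq hk x) = 0 := by
  apply symExtIncl_injective b
  rw [symExtIncl_symContract, symExtIncl_symContract, map_zero]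
  exact LinearMap.congr_fun (contractDiff_mul_self f) _

theorem symWedge_injective [Module.Free R G] {rs : List R} (hrs : IsWeaklyRegular R rs)
    {v : Fin m → G}
    (hv : ∀ a ∈ rs, ∃ (N : ℕ) (f : Fin m → Module.Dual R G), IsDualUpTo (a ^ N) f v)
    (hl : 0 < rs.length) {q q' : ℕ} {k k' : ℤ} (hq : q' = q + 1) (hk : k' = k + 1)
    (h0 : q = 0 → k < m) (h1 : q ≠ 0 → k ≤ 0) :
    Function.Injective (symWedge M b v hq hk) := by
  rw [injective_iff_map_eq_zero]
  intro x hx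
  apply symExtIncl_injective b
  rw [map_zero]
  refine (wedgeDiff_exact hrs hv q k h0 h1).1 hl _ (symExtIncl_mem b _ _ x) ?_
  rw [← symExtIncl_symWedge b v hq hk, hx, map_zero]

/-- The degrees are variables tied by equations, so that the index expressions occurring in `C` can
be matched without casts. -/
theorem symWedge_exact [Module.Free R G] {rs : List R} (hrs : IsWeaklyRegular R rs)
    {v : Fin m → G}
    (hv : ∀ a ∈ rs, ∃ (N : ℕ) (f : Fin m → Module.Dual R G), IsDualUpTo (a ^ N) f v)
    {s j : ℕ} {k₀ : ℤ} (h0 : s = 0 → k₀ < m) (h1 : s ≠ 0 → k₀ ≤ 0) (hj : j + 1 < rs.length)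
    {q q' q'' : ℕ} {k k' k'' : ℤ} (hq : q' = q + 1)
    (hk : k' = k + 1) (hq' : q'' = q' + 1) (hk' : k'' = k' + 1)
    (hqs : q = s + j) (hks : k = k₀ + j) :
    Function.Exact (symWedge M b v hq hk) (symWedge M b v hq' hk') := by
  intro x
  refine ⟨fun hx => ?_, ?_⟩
  · subst hqs hks hq
    obtain rfl : k' = k₀ + (j + 1 : ℕ) := by rw [hk]; push_cast; ring
    obtain ⟨u, hu, e⟩ := (wedgeDiff_exact hrs hv s k₀ h0 h1).2 j hj _ (symExtIncl_mem b _ _ x)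
      (by rw [← symExtIncl_symWedge b v hq' hk', hx, map_zero])
    obtain ⟨y, rfl⟩ := exists_symExtIncl_eq b hu
    refine ⟨y, symExtIncl_injective b _ _ ?_⟩
    rw [← e]
    exact symExtIncl_symWedge b v _ hk y
  · rintro ⟨y, rfl⟩
    exact symWedge_symWedge b v _ _ _ _ y

theorem symContract_exact {f : Fin m → Module.Dual R G} {q q' q'' : ℕ} {k k' k'' : ℤ}
    (hq : q' = q + 1) (hk : k = k' + 1) (hq' : q'' = q' + 1) (hk' : k' = k'' + 1)
    (h : ∀ x ∈ piece R (Fin m) G q' k', contractDiff f x = 0 →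
      ∃ u ∈ piece R (Fin m) G q k, contractDiff f u = x) :
    Function.Exact (symContract M b f hq hk) (symContract M b f hq' hk') := by
  intro x
  refine ⟨fun hx => ?_, ?_⟩
  · obtain ⟨u, hu, e⟩ := h _ (symExtIncl_mem b _ _ x)
      (by rw [← symExtIncl_symContract b f hq' hk', hx, map_zero])
    obtain ⟨y, rfl⟩ := exists_symExtIncl_eq b hu
    refine ⟨y, symExtIncl_injective b _ _ ?_⟩
    rw [← e]
    exact symExtIncl_symContract b f _ hk y
  · rintro ⟨y, rfl⟩
    exact symContract_symContract b f _ _ _ _ y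

end Transfer

/-! ### Tensoring sums of maps with flat modules -/

section TensorSum

variable {R : Type*} [CommRing R] {ι : Type*} [Fintype ι]
  {A A' A'' B B' B'' D D' D'' : Type*} [AddCommGroup A] [Module R A] [AddCommGroup A'] [Module R A']
  [AddCommGroup A''] [Module R A''] [AddCommGroup B] [Module R B] [AddCommGroup B'] [Module R B']
  [AddCommGroup B''] [Module R B''] [AddCommGroup D] [Module R D] [AddCommGroup D'] [Module R D']
  [AddCommGroup D''] [Module R D'']

/-- Regrouping turns a row map into the Koszul map on S(H*) ⊗ ⋀G tensored with the identity of
S_q(F). -/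
theorem sum_map_assoc (α : ι → A →ₗ[R] A') (β : ι → B →ₗ[R] B') (x : (A ⊗[R] B) ⊗[R] D) :
    (∑ j, TensorProduct.map (α j) (TensorProduct.map (β j) (LinearMap.id : D →ₗ[R] D))
        : A ⊗[R] (B ⊗[R] D) →ₗ[R] A' ⊗[R] (B' ⊗[R] D))
      (TensorProduct.assoc R A B D x) =
    TensorProduct.assoc R A' B' D ((∑ j, TensorProduct.map (α j) (β j)).rTensor D x) := by
  induction x using TensorProduct.induction_on with
  | zero => simp only [map_zero]
  | add x y hx hy => simp only [map_add, hx, hy]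
  | tmul x z =>
    induction x using TensorProduct.induction_on with
    | zero => simp only [TensorProduct.zero_tmul, map_zero]
    | add x y hx hy => simp only [TensorProduct.add_tmul, map_add, hx, hy]
    | tmul a y =>
      simp [LinearMap.sum_apply, TensorProduct.sum_tmul]

theorem sum_map_id_left (β : ι → B →ₗ[R] B') (γ : ι → D →ₗ[R] D') :
    (∑ j, TensorProduct.map (LinearMap.id : A →ₗ[R] A) (TensorProduct.map (β j) (γ j))
        : A ⊗[R] (B ⊗[R] D) →ₗ[R] A ⊗[R] (B' ⊗[R] D')) =
      (∑ j, TensorProduct.map (β j) (γ j)).lTensor A := by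
  refine TensorProduct.ext' fun a y => ?_
  simp [LinearMap.sum_apply, TensorProduct.tmul_sum]

/-- The columns carry the symmetric factor on the right, the Koszul maps `symContract` on the left.
-/
theorem sum_map_comm (β : ι → B →ₗ[R] B') (γ : ι → D →ₗ[R] D') (x : D ⊗[R] B) :
    (∑ j, TensorProduct.map (β j) (γ j)) (TensorProduct.comm R D B x) =
      TensorProduct.comm R D' B' ((∑ j, TensorProduct.map (γ j) (β j)) x) := by
  simp [LinearMap.sum_apply, TensorProduct.map_comm]

theorem exact_of_exact_sum_map_assoc [Module.Flat R D] {α : ι → A →ₗ[R] A'} {β : ι → B →ₗ[R] B'}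
    {α' : ι → A' →ₗ[R] A''} {β' : ι → B' →ₗ[R] B''}
    (h : Function.Exact (∑ j, TensorProduct.map (α j) (β j) : A ⊗[R] B →ₗ[R] A' ⊗[R] B')
      (∑ j, TensorProduct.map (α' j) (β' j) : A' ⊗[R] B' →ₗ[R] A'' ⊗[R] B'')) :
    Function.Exact
      (∑ j, TensorProduct.map (α j) (TensorProduct.map (β j) (LinearMap.id : D →ₗ[R] D))
          : A ⊗[R] (B ⊗[R] D) →ₗ[R] A' ⊗[R] (B' ⊗[R] D))
      (∑ j, TensorProduct.map (α' j) (TensorProduct.map (β' j) (LinearMap.id : D →ₗ[R] D))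
          : A' ⊗[R] (B' ⊗[R] D) →ₗ[R] A'' ⊗[R] (B'' ⊗[R] D)) := by
  intro x
  obtain ⟨x, rfl⟩ := (TensorProduct.assoc R A' B' D).surjective x
  rw [sum_map_assoc, LinearEquiv.map_eq_zero_iff, Module.Flat.rTensor_exact D h x]
  constructor
  · rintro ⟨y, rfl⟩
    exact ⟨_, sum_map_assoc α β y⟩
  · rintro ⟨y, hy⟩
    obtain ⟨y, rfl⟩ := (TensorProduct.assoc R A B D).surjective y
    rw [sum_map_assoc] at hy
    exact ⟨y, (TensorProduct.assoc R A' B' D).injective hy⟩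

theorem injective_of_injective_sum_map_assoc [Module.Flat R D] {α : ι → A →ₗ[R] A'}
    {β : ι → B →ₗ[R] B'}
    (h : Function.Injective
      (∑ j, TensorProduct.map (α j) (β j) : A ⊗[R] B →ₗ[R] A' ⊗[R] B')) :
    Function.Injective
      (∑ j, TensorProduct.map (α j) (TensorProduct.map (β j) (LinearMap.id : D →ₗ[R] D))
          : A ⊗[R] (B ⊗[R] D) →ₗ[R] A' ⊗[R] (B' ⊗[R] D)) := by
  intro x y hxy
  obtain ⟨x, rfl⟩ := (TensorProduct.assoc R A B D).surjective x
  obtain ⟨y, rfl⟩ := (TensorProduct.assoc R A B D).surjective y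
  rw [sum_map_assoc, sum_map_assoc] at hxy
  rw [Module.Flat.rTensor_preserves_injective_linearMap _ h
    ((TensorProduct.assoc R A' B' D).injective hxy)]

theorem sum_map_assoc_apply_apply {α : ι → A →ₗ[R] A'} {β : ι → B →ₗ[R] B'}
    {α' : ι → A' →ₗ[R] A''} {β' : ι → B' →ₗ[R] B''}
    (h : ∀ x, (∑ j, TensorProduct.map (α' j) (β' j))
      ((∑ j, TensorProduct.map (α j) (β j)) x) = 0) (x : A ⊗[R] (B ⊗[R] D)) :
    (∑ j, TensorProduct.map (α' j) (TensorProduct.map (β' j) (LinearMap.id : D →ₗ[R] D))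
        : A' ⊗[R] (B' ⊗[R] D) →ₗ[R] A'' ⊗[R] (B'' ⊗[R] D))
      ((∑ j, TensorProduct.map (α j) (TensorProduct.map (β j) (LinearMap.id : D →ₗ[R] D))
          : A ⊗[R] (B ⊗[R] D) →ₗ[R] A' ⊗[R] (B' ⊗[R] D)) x) =
      0 := by
  obtain ⟨x, rfl⟩ := (TensorProduct.assoc R A B D).surjective x
  rw [sum_map_assoc, sum_map_assoc, ← LinearMap.comp_apply (LinearMap.rTensor _ _),
    ← LinearMap.rTensor_comp]
  have h0 : (∑ j, TensorProduct.map (α' j) (β' j)) ∘ₗ (∑ j, TensorProduct.map (α j) (β j)) = 0 :=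
    LinearMap.ext h
  rw [h0, LinearMap.rTensor_zero, LinearMap.zero_apply, map_zero]

theorem exact_of_exact_sum_map_comm [Module.Flat R A] {β : ι → B →ₗ[R] B'} {γ : ι → D →ₗ[R] D'}
    {β' : ι → B' →ₗ[R] B''} {γ' : ι → D' →ₗ[R] D''}
    (h : Function.Exact (∑ j, TensorProduct.map (γ j) (β j) : D ⊗[R] B →ₗ[R] D' ⊗[R] B')
      (∑ j, TensorProduct.map (γ' j) (β' j) : D' ⊗[R] B' →ₗ[R] D'' ⊗[R] B'')) :
    Function.Exact
      (∑ j, TensorProduct.map (LinearMap.id : A →ₗ[R] A) (TensorProduct.map (β j) (γ j))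
          : A ⊗[R] (B ⊗[R] D) →ₗ[R] A ⊗[R] (B' ⊗[R] D'))
      (∑ j, TensorProduct.map (LinearMap.id : A →ₗ[R] A) (TensorProduct.map (β' j) (γ' j))
          : A ⊗[R] (B' ⊗[R] D') →ₗ[R] A ⊗[R] (B'' ⊗[R] D'')) := by
  rw [sum_map_id_left, sum_map_id_left]
  refine Module.Flat.lTensor_exact A fun x => ?_
  obtain ⟨x, rfl⟩ := (TensorProduct.comm R D' B').surjective x
  rw [sum_map_comm, LinearEquiv.map_eq_zero_iff, h x]
  constructor
  · rintro ⟨y, rfl⟩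
    exact ⟨_, sum_map_comm β γ y⟩
  · rintro ⟨y, hy⟩
    obtain ⟨y, rfl⟩ := (TensorProduct.comm R D B).surjective y
    rw [sum_map_comm] at hy
    exact ⟨y, (TensorProduct.comm R D' B').injective hy⟩

theorem sum_map_comm_apply_apply {β : ι → B →ₗ[R] B'} {γ : ι → D →ₗ[R] D'}
    {β' : ι → B' →ₗ[R] B''} {γ' : ι → D' →ₗ[R] D''}
    (h : ∀ x, (∑ j, TensorProduct.map (γ' j) (β' j))
      ((∑ j, TensorProduct.map (γ j) (β j)) x) = 0) (x : A ⊗[R] (B ⊗[R] D)) :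
    (∑ j, TensorProduct.map (LinearMap.id : A →ₗ[R] A) (TensorProduct.map (β' j) (γ' j))
        : A ⊗[R] (B' ⊗[R] D') →ₗ[R] A ⊗[R] (B'' ⊗[R] D''))
      ((∑ j, TensorProduct.map (LinearMap.id : A →ₗ[R] A) (TensorProduct.map (β j) (γ j))
          : A ⊗[R] (B ⊗[R] D) →ₗ[R] A ⊗[R] (B' ⊗[R] D')) x) =
      0 := by
  rw [sum_map_id_left, sum_map_id_left, ← LinearMap.comp_apply (LinearMap.lTensor _ _),
    ← LinearMap.lTensor_comp]
  have h0 : (∑ j, TensorProduct.map (β' j) (γ' j)) ∘ₗ (∑ j, TensorProduct.map (β j) (γ j)) = 0 := by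
    refine LinearMap.ext fun y => ?_
    obtain ⟨y, rfl⟩ := (TensorProduct.comm R D B).surjective y
    rw [LinearMap.comp_apply, sum_map_comm, sum_map_comm, h, map_zero, LinearMap.zero_apply]
  rw [h0, LinearMap.lTensor_zero, LinearMap.zero_apply]

end TensorSum

/-! ### Rows and columns of the bicomplex as Koszul strands -/

section Rows

open RingTheory.Sequence

variable {R : Type*} [CommRing R] {H G F : Type*} [AddCommGroup H] [Module R H]
  [AddCommGroup G] [Module R G] [AddCommGroup F] [Module R F] {l m : ℕ}
  (bH : Module.Basis (Fin l) R H) (bF : Module.Basis (Fin m) R F)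
  (φ : H →ₗ[R] G) (ψ : G →ₗ[R] F) (e : ℤ)

variable {bH φ e} in
theorem d_injective [Module.Free R G] {rs : List R} (hrs : IsWeaklyRegular R rs)
    (hv : ∀ a ∈ rs, ∃ (N : ℕ) (f : Fin l → Module.Dual R G),
      IsDualUpTo (a ^ N) f fun j => φ (bH j))
    (hl : 0 < rs.length) (hel : e < l) (bF : Module.Basis (Fin m) R F) (q : ℕ) :
    Function.Injective (d (F := F) bH φ e 0 q) := by
  have := flat_symPow bF q
  -- For e ≥ 0 the row starts in symmetric degree 0 and exterior degree e - q < l; for e < 0 it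
  -- starts in symmetric degree -e and exterior degree -q ≤ 0.
  have h1 := symWedge_injective bH.dualBasis hrs hv hl (q := 0 + (-e).toNat)
    (q' := 0 + 1 + (-e).toNat) (k := (e.toNat : ℤ) + (0 : ℕ) - q)
    (k' := (e.toNat : ℤ) + (0 + 1 : ℕ) - q) (by omega) (by push_cast; ring)
    (by push_cast; omega) (by push_cast; omega)
  simp only [symWedge, Module.Basis.coe_dualBasis] at h1
  exact injective_of_injective_sum_map_assoc (D := symPow R F q) h1

variable {bH φ e} in
theorem d_exact [Module.Free R G] {rs : List R} (hrs : IsWeaklyRegular R rs)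
    (hv : ∀ a ∈ rs, ∃ (N : ℕ) (f : Fin l → Module.Dual R G),
      IsDualUpTo (a ^ N) f fun j => φ (bH j)) {p : ℕ}
    (hl : p + 1 < rs.length) (hel : e < l) (bF : Module.Basis (Fin m) R F) (q : ℕ) :
    Function.Exact (d (F := F) bH φ e p q) (d bH φ e (p + 1) q) := by
  have := flat_symPow bF q
  have h1 := symWedge_exact bH.dualBasis hrs hv (s := (-e).toNat) (j := p)
    (k₀ := (e.toNat : ℤ) - q) (by omega) (by omega) hl
    (q := p + (-e).toNat) (q' := p + 1 + (-e).toNat) (q'' := p + 1 + 1 + (-e).toNat)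
    (k := (e.toNat : ℤ) + p - q) (k' := (e.toNat : ℤ) + (p + 1 : ℕ) - q)
    (k'' := (e.toNat : ℤ) + (p + 1 + 1 : ℕ) - q)
    (by omega) (by push_cast; ring) (by omega) (by push_cast; ring) (by omega) (by ring)
  simp only [symWedge, Module.Basis.coe_dualBasis] at h1
  exact exact_of_exact_sum_map_assoc (D := symPow R F q) h1

theorem d_d (p q : ℕ) (x : C R H G F e p q) :
    d bH φ e (p + 1) q (d bH φ e p q x) = 0 := by
  have h1 := symWedge_symWedge bH.dualBasis (fun j => φ (bH j))
    (q := p + (-e).toNat) (q' := p + 1 + (-e).toNat) (q'' := p + 1 + 1 + (-e).toNat)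
    (k := (e.toNat : ℤ) + p - q) (k' := (e.toNat : ℤ) + (p + 1 : ℕ) - q)
    (k'' := (e.toNat : ℤ) + (p + 1 + 1 : ℕ) - q)
    (by omega) (by push_cast; ring) (by omega) (by push_cast; ring)
  simp only [symWedge, Module.Basis.coe_dualBasis] at h1
  exact sum_map_assoc_apply_apply (D := symPow R F q) h1 x

theorem del_del (p q : ℕ) (x : C R H G F e p q) :
    del bF ψ e p (q + 1) (del bF ψ e p q x) = 0 :=
  sum_map_comm_apply_apply (symContract_symContract bF (fun j => bF.coord j ∘ₗ ψ)
    (k := (e.toNat : ℤ) + p - q) (k' := (e.toNat : ℤ) + p - (q + 1 : ℕ))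
    (k'' := (e.toNat : ℤ) + p - (q + 1 + 1 : ℕ)) rfl (by push_cast; ring) rfl
    (by push_cast; ring)) x

theorem del_exact (bH : Module.Basis (Fin l) R H) {p q : ℕ}
    (h : ∀ x ∈ piece R (Fin m) G (q + 1) ((e.toNat : ℤ) + p - (q + 1 : ℕ)),
      contractDiff (fun j => bF.coord j ∘ₗ ψ) x = 0 →
      ∃ u ∈ piece R (Fin m) G q ((e.toNat : ℤ) + p - q),
        contractDiff (fun j => bF.coord j ∘ₗ ψ) u = x) :
    Function.Exact (del (H := H) bF ψ e p q) (del bF ψ e p (q + 1)) := by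
  have := flat_symPow bH.dualBasis (p + (-e).toNat)
  exact exact_of_exact_sum_map_comm (symContract_exact bF (f := fun j => bF.coord j ∘ₗ ψ) (q := q)
    (q' := q + 1) (q'' := q + 1 + 1)
    (k := (e.toNat : ℤ) + p - q) (k' := (e.toNat : ℤ) + p - (q + 1 : ℕ))
    (k'' := (e.toNat : ℤ) + p - (q + 1 + 1 : ℕ)) rfl (by push_cast; ring) rfl
    (by push_cast; ring) h)

theorem C.eq_zero {e : ℤ} {p q : ℕ} (h : (e.toNat : ℤ) + p < q) (x : C R H G F e p q) : x = 0 := by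
  induction x using C.induction with
  | h0 => rfl
  | ha x y hx hy => rw [hx, hy, add_zero]
  | ht a y z =>
    have hy : y = 0 := by
      have h0 : (y : ExteriorAlgebra R G) ∈ (⊥ : Submodule R (ExteriorAlgebra R G)) :=
        (extPow_of_neg (R := R) (M := G) (by omega : (e.toNat : ℤ) + p - q < 0)).le y.2
      exact Subtype.ext h0
    rw [hy]
    change a ⊗ₜ[R] ((0 : extPow R G _) ⊗ₜ[R] z) = 0
    rw [TensorProduct.zero_tmul, TensorProduct.tmul_zero]

end Rows

/-! ### The cokernel of the last map of a column -/

section Cokernel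

open MvPolynomial

variable {R : Type*} [CommRing R] {M M' : Type*} [AddCommGroup M] [Module R M]
  [AddCommGroup M'] [Module R M']

theorem symMap_coe (f : M →ₗ[R] M') (q : ℕ) (y : symPow R M q) :
    (symMap f q y : SymmetricAlgebra R M') =
      SymmetricAlgebra.lift (SymmetricAlgebra.ι R M' ∘ₗ f) y :=
  rfl

theorem symMul_coe (x : M) {q q' : ℕ} (h : q' = q + 1) (y : symPow R M q) :
    (symMul x h y : SymmetricAlgebra R M) = SymmetricAlgebra.ι R M x * y := rfl

theorem symMap_surjective {f : M →ₗ[R] M'} (hf : Function.Surjective f) (q : ℕ) :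
    Function.Surjective (symMap f q) := by
  have h : (symPow R M q).map (SymmetricAlgebra.lift (SymmetricAlgebra.ι R M' ∘ₗ f)).toLinearMap =
      symPow R M' q := by
    rw [symPow, Submodule.map_pow]
    congr 1
    rw [← LinearMap.range_comp]
    have : (SymmetricAlgebra.lift (SymmetricAlgebra.ι R M' ∘ₗ f)).toLinearMap ∘ₗ
        SymmetricAlgebra.ι R M = SymmetricAlgebra.ι R M' ∘ₗ f := by
      ext; simp
    rw [this, LinearMap.range_comp, LinearMap.range_eq_top.2 hf, Submodule.map_top]
  rintro ⟨y, hy⟩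
  rw [← h] at hy
  obtain ⟨z, hz, rfl⟩ := hy
  exact ⟨⟨z, hz⟩, rfl⟩

/-- By the universal property of S(M/U), the projection S(M) → S(M)/(U) factors through S(M) →
S(M/U), so the kernel of the latter lies in (U). -/
theorem mem_span_of_lift_mkQ_eq_zero (U : Submodule R M) {y : SymmetricAlgebra R M}
    (hy : SymmetricAlgebra.lift (SymmetricAlgebra.ι R (M ⧸ U) ∘ₗ U.mkQ) y = 0) :
    y ∈ Ideal.span (SymmetricAlgebra.ι R M '' U) := by
  set I := Ideal.span (SymmetricAlgebra.ι R M '' (U : Set M)) with hI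
  let g : M ⧸ U →ₗ[R] SymmetricAlgebra R M ⧸ I :=
    U.liftQ ((Ideal.Quotient.mkₐ R I).toLinearMap ∘ₗ SymmetricAlgebra.ι R M) (by
      intro u hu
      rw [LinearMap.mem_ker]
      exact Ideal.Quotient.eq_zero_iff_mem.2 (Ideal.subset_span ⟨u, hu, rfl⟩))
  have h : (SymmetricAlgebra.lift g).comp
      (SymmetricAlgebra.lift (SymmetricAlgebra.ι R (M ⧸ U) ∘ₗ U.mkQ)) = Ideal.Quotient.mkₐ R I := by
    apply SymmetricAlgebra.algHom_ext
    ext x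
    simp [g]
  have h2 := congrArg (SymmetricAlgebra.lift g) hy
  rw [map_zero, ← AlgHom.comp_apply, h] at h2
  exact Ideal.Quotient.eq_zero_iff_mem.1 h2

theorem homogeneousComponent_mul_of_isHomogeneous_one {σ : Type*} {L : MvPolynomial σ R}
    (hL : L.IsHomogeneous 1) (q : ℕ) (a : MvPolynomial σ R) :
    homogeneousComponent (q + 1) (L * a) = L * homogeneousComponent q a := by
  classical
  have h : ∀ i, homogeneousComponent (q + 1) (L * homogeneousComponent i a) =
      if q = i then L * homogeneousComponent i a else 0 := fun i => by
    have h1 : L * homogeneousComponent i a ∈ homogeneousSubmodule σ R (i + 1) := by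
      rw [mem_homogeneousSubmodule, add_comm]
      exact hL.mul (homogeneousComponent_isHomogeneous i a)
    rw [homogeneousComponent_of_mem h1]
    simp
  conv_lhs => rw [← sum_homogeneousComponent a, Finset.mul_sum, map_sum]
  simp only [h, Finset.sum_ite_eq, Finset.mem_range]
  split_ifs with hq
  · rfl
  · rw [homogeneousComponent_eq_zero _ _ (by omega), mul_zero]

theorem exists_symMul_eq_of_mem_span {m : ℕ} (b : Module.Basis (Fin m) R M) (U : Submodule R M)
    {q : ℕ} (y : symPow R M (q + 1))
    (hy : (y : SymmetricAlgebra R M) ∈ Ideal.span (SymmetricAlgebra.ι R M '' U)) :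
    y ∈ Submodule.span R {y | ∃ u ∈ U, ∃ z : symPow R M q, y = symMul u rfl z} := by
  let E := SymmetricAlgebra.equivMvPolynomial b
  -- The extra factor a absorbs the ring coefficients in the span induction; passing to components
  -- of degree q + 1 then leaves coefficients of degree q.
  have key : ∀ y ∈ Ideal.span (SymmetricAlgebra.ι R M '' (U : Set M)), ∀ a,
      (symPowEquiv b (q + 1)).symm (homogeneousProj R (Fin m) (q + 1) (E (y * a))) ∈
        Submodule.span R {y | ∃ u ∈ U, ∃ z : symPow R M q, y = symMul u rfl z} := by
    intro y hy
    induction hy using Submodule.span_induction with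
    | mem y h =>
      obtain ⟨u, hu, rfl⟩ := h
      intro a
      refine Submodule.subset_span ⟨u, hu, (symPowEquiv b q).symm (homogeneousProj R _ q (E a)), ?_⟩
      rw [LinearEquiv.symm_apply_eq]
      apply Subtype.ext
      have hE : E ((symPowEquiv b q).symm (homogeneousProj R _ q (E a)) : SymmetricAlgebra R M) =
          homogeneousComponent q (E a) := by
        rw [← coe_symPowEquiv, LinearEquiv.apply_symm_apply]
        rfl
      rw [coe_symPowEquiv, symMul_coe]
      have hL : (E (SymmetricAlgebra.ι R M u)).IsHomogeneous 1 := by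
        have h1 := (symPowEquiv b 1 ⟨SymmetricAlgebra.ι R M u, by
          rw [symPow, pow_one]; exact ⟨u, rfl⟩⟩).2
        exact h1
      change homogeneousComponent (q + 1) (E (_ * a)) = E (_ * _)
      rw [map_mul E, map_mul E, homogeneousComponent_mul_of_isHomogeneous_one hL, hE]
    | zero => intro a; simp
    | add y z _ _ h1 h2 =>
      intro a
      rw [add_mul, map_add, map_add, map_add]
      exact add_mem (h1 a) (h2 a)
    | smul c y _ h =>
      intro a
      rw [smul_eq_mul, mul_comm c, mul_assoc]
      exact h _
  have h1 := key _ hy 1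
  rw [mul_one] at h1
  convert h1
  rw [LinearEquiv.eq_symm_apply]
  apply Subtype.ext
  change _ = homogeneousComponent (q + 1) (E y)
  rw [coe_symPowEquiv]
  exact (homogeneousComponent_of_mem (n := q + 1) (symPowEquiv b (q + 1) y).2 |>.trans
    (if_pos rfl)).symm

end Cokernel

theorem exact_map_id_sum_map {R ι A B B' D D' P : Type*} [Fintype ι] [CommRing R]
    [AddCommGroup A] [Module R A] [AddCommGroup B] [Module R B] [AddCommGroup B'] [Module R B']
    [AddCommGroup D] [Module R D] [AddCommGroup D'] [Module R D'] [AddCommGroup P] [Module R P]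
    {β : ι → B →ₗ[R] B'} {γ : ι → D →ₗ[R] D'} {g : B' ⊗[R] D' →ₗ[R] P}
    (h : Function.Exact (∑ j, TensorProduct.map (β j) (γ j) : B ⊗[R] D →ₗ[R] B' ⊗[R] D') g)
    (hg : Function.Surjective g) :
    Function.Exact (∑ j, TensorProduct.map (LinearMap.id : A →ₗ[R] A)
      (TensorProduct.map (β j) (γ j)) : A ⊗[R] (B ⊗[R] D) →ₗ[R] A ⊗[R] (B' ⊗[R] D'))
      (TensorProduct.map (LinearMap.id : A →ₗ[R] A) g) := by
  rw [sum_map_id_left]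
  exact lTensor_exact A h hg

/-! ### The symmetric powers of the cokernel of ψ -/

section ToCoker

variable {R : Type*} [CommRing R] {H G F : Type*} [AddCommGroup H] [Module R H]
  [AddCommGroup G] [Module R G] [AddCommGroup F] [Module R F] {l m : ℕ}
  (bF : Module.Basis (Fin m) R F) (ψ : G →ₗ[R] F)

/-- The unit of the exterior algebra in degree `0`. -/
def extOne (R : Type*) [CommRing R] (G : Type*) [AddCommGroup G] [Module R G] {k : ℤ}
    (hk : k = 0) : extPow R G k :=
  ⟨1, by
         subst hk
         rw [show (0 : ℤ) = (0 : ℕ) from rfl, extPow_natCast]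
         exact SetLike.GradedOne.one_mem⟩

theorem extCounit_extOne {k : ℤ} (hk : k = 0) : extCounit k (extOne R G hk) = 1 :=
  map_one ExteriorAlgebra.algebraMapInv

theorem eq_extCounit_smul_extOne {k : ℤ} (hk : k = 0) (y : extPow R G k) :
    y = extCounit k y • extOne R G hk := by
  subst hk
  apply Subtype.ext
  have hy : (y : ExteriorAlgebra R G) ∈ ⋀[R]^0 G := (extPow_natCast (R := R) (M := G) 0).le y.2
  rw [ExteriorAlgebra.exteriorPower, pow_zero, Submodule.mem_one] at hy
  obtain ⟨r, hr⟩ := hy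
  change (y : ExteriorAlgebra R G) = ExteriorAlgebra.algebraMapInv (y : ExteriorAlgebra R G) • 1
  rw [← hr, ExteriorAlgebra.algebraMap_leftInverse, Algebra.algebraMap_eq_smul_one]

/-- The map `⋀ᵏ G ⊗ S_q(F) → S_q(Coker ψ)`. -/
def cokerMap (k : ℤ) (q : ℕ) :
    extPow R G k ⊗[R] symPow R F q →ₗ[R] symPow R (F ⧸ LinearMap.range ψ) q :=
  (TensorProduct.lid R _).toLinearMap ∘ₗ
    TensorProduct.map (extCounit k) (symMap (LinearMap.range ψ).mkQ q)

theorem cokerMap_tmul (k : ℤ) (q : ℕ) (y : extPow R G k) (z : symPow R F q) :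
    cokerMap ψ k q (y ⊗ₜ z) = extCounit k y • symMap (LinearMap.range ψ).mkQ q z := rfl

theorem cokerMap_surjective {k : ℤ} (hk : k = 0) (q : ℕ) :
    Function.Surjective (cokerMap ψ k q) := fun y => by
  obtain ⟨z, rfl⟩ := symMap_surjective (Submodule.mkQ_surjective _) q y
  exact ⟨extOne R G hk ⊗ₜ z, by rw [cokerMap_tmul, extCounit_extOne, one_smul]⟩

/-- Contracting a single vector g yields the coordinates of ψ g, and these reassemble to ψ g. -/
theorem sum_contract_symMul {k' k : ℤ} (hk' : k' = 0) (hk : k = k' + 1) {q q' : ℕ} (hq : q' = q + 1)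
    (g : G) (hg : ExteriorAlgebra.ι R g ∈ extPow R G k) (z : symPow R F q) :
    (∑ j, TensorProduct.map (contract (bF.coord j ∘ₗ ψ) hk) (symMul (bF j) hq) :
      extPow R G k ⊗[R] symPow R F q →ₗ[R] extPow R G k' ⊗[R] symPow R F q')
      ((⟨ExteriorAlgebra.ι R g, hg⟩ : extPow R G k) ⊗ₜ z) =
    extOne R G hk' ⊗ₜ symMul (ψ g) hq z := by
  have h1 : symMul (ψ g) hq z = ∑ j, bF.coord j (ψ g) • symMul (bF j) hq z := by
    apply Subtype.ext
    simp only [Submodule.coe_sum, Submodule.coe_smul, symMul_coe]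
    simp only [← smul_mul_assoc, ← Finset.sum_mul, ← map_smul, ← map_sum]
    congr 2
    exact (bF.sum_repr (ψ g)).symm
  rw [LinearMap.sum_apply, h1, TensorProduct.tmul_sum]
  refine Finset.sum_congr rfl fun j _ => ?_
  rw [TensorProduct.map_tmul, TensorProduct.tmul_smul, TensorProduct.smul_tmul']
  congr 1
  apply Subtype.ext
  change CliffordAlgebra.contractLeft (bF.coord j ∘ₗ ψ) (ExteriorAlgebra.ι R g) =
    bF.coord j (ψ g) • (1 : ExteriorAlgebra R G)
  rw [← Algebra.algebraMap_eq_smul_one]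
  exact CliffordAlgebra.contractLeft_ι (Q := 0) _ g

/-- The kernel of S(F) → S(Coker ψ) is the ideal generated by the image of ψ, and multiplication by
ψ g is exactly what the last column map does to g. -/
theorem cokerMap_exact {k' k : ℤ} (hk' : k' = 0) (hk : k = k' + 1) {q q' : ℕ} (hq : q' = q + 1) :
    Function.Exact
      (∑ j, TensorProduct.map (contract (bF.coord j ∘ₗ ψ) hk) (symMul (bF j) hq) :
        extPow R G k ⊗[R] symPow R F q →ₗ[R] extPow R G k' ⊗[R] symPow R F q')
      (cokerMap ψ k' q') := by
  subst hq
  have hι : ∀ g, ExteriorAlgebra.ι R g ∈ extPow R G k := fun g => by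
    rw [hk, hk', show (0 : ℤ) + 1 = (1 : ℕ) from rfl, extPow_natCast,
      ExteriorAlgebra.exteriorPower, pow_one]
    exact ⟨g, rfl⟩
  rw [LinearMap.exact_iff]
  apply le_antisymm
  · intro x hx
    obtain ⟨z, rfl⟩ : ∃ z, x = extOne R G hk' ⊗ₜ z := by
      clear hx
      induction x using TensorProduct.induction_on with
      | zero => exact ⟨0, by rw [TensorProduct.tmul_zero]⟩
      | tmul y z =>
        refine ⟨extCounit k' y • z, ?_⟩
        conv_lhs => rw [eq_extCounit_smul_extOne hk' y]
        rw [TensorProduct.smul_tmul]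
      | add x y hx hy =>
        obtain ⟨z, rfl⟩ := hx
        obtain ⟨z', rfl⟩ := hy
        exact ⟨z + z', by rw [TensorProduct.tmul_add]⟩
    rw [LinearMap.mem_ker, cokerMap_tmul, extCounit_extOne, one_smul] at hx
    have h1 := exists_symMul_eq_of_mem_span bF (LinearMap.range ψ) z
      (mem_span_of_lift_mkQ_eq_zero _ (congrArg Subtype.val hx))
    clear hx
    induction h1 using Submodule.span_induction with
    | mem z h =>
      obtain ⟨_, ⟨g, rfl⟩, z, rfl⟩ := h
      exact ⟨_, sum_contract_symMul bF ψ hk' hk rfl g (hι g) z⟩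
    | zero => rw [TensorProduct.tmul_zero]; exact zero_mem _
    | add z z' _ _ h1 h2 => rw [TensorProduct.tmul_add]; exact add_mem h1 h2
    | smul a z _ h => rw [TensorProduct.tmul_smul]; exact Submodule.smul_mem _ _ h
  · rintro _ ⟨x, rfl⟩
    induction x using TensorProduct.induction_on with
    | zero => rw [map_zero]; exact zero_mem _
    | add x y hx hy => rw [map_add]; exact add_mem hx hy
    | tmul y z =>
      obtain ⟨g, hg⟩ : ∃ g, ExteriorAlgebra.ι R g = (y : ExteriorAlgebra R G) := by
        subst hk hk'
        have h1 : (y : ExteriorAlgebra R G) ∈ ⋀[R]^1 G :=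
          (extPow_natCast (R := R) (M := G) 1).le y.2
        rw [ExteriorAlgebra.exteriorPower, pow_one] at h1
        exact h1
      obtain rfl : y = ⟨ExteriorAlgebra.ι R g, hι g⟩ := Subtype.ext hg.symm
      rw [sum_contract_symMul bF ψ hk' hk rfl g (hι g) z, LinearMap.mem_ker, cokerMap_tmul]
      have h2 : symMap (LinearMap.range ψ).mkQ (q + 1) (symMul (ψ g) rfl z) = 0 := by
        apply Subtype.ext
        rw [symMap_coe, symMul_coe, map_mul, SymmetricAlgebra.lift_ι_apply, LinearMap.comp_apply,
          Submodule.mkQ_apply, (Submodule.Quotient.mk_eq_zero _).2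
            (LinearMap.mem_range_self ψ g), map_zero, zero_mul]
        rfl
      rw [h2, smul_zero]

theorem toCoker_surjective {e : ℤ} {p q : ℕ} (h : (e.toNat : ℤ) + p - q = 0) :
    Function.Surjective (toCoker (H := H) ψ e p q) :=
  LinearMap.lTensor_surjective _ (cokerMap_surjective ψ h q)

theorem toCoker_exact {e : ℤ} {p q : ℕ} (h : (e.toNat : ℤ) + p - (q + 1 : ℕ) = 0) :
    Function.Exact (del (H := H) bF ψ e p q) (toCoker ψ e p (q + 1)) := by
  have hs := cokerMap_surjective ψ h (q + 1)
  have he := cokerMap_exact bF ψ h (k := (e.toNat : ℤ) + p - q) (q := q) (by push_cast; ring) rfl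
  exact exact_map_id_sum_map (A := symPow R (Module.Dual R H) (p + (-e).toNat)) he hs

end ToCoker

/-! ### Chasing zig-zags -/

/-- Zig-zags depend on choices, so maps are obtained from relations: a total relation compatible
with sums and multiples is a linear map as soon as 0 is related only to 0. -/
theorem exists_linearMap_of_rel {R A B : Type*} [CommRing R] [AddCommGroup A] [Module R A]
    [AddCommGroup B] [Module R B] (r : A → B → Prop)
    (hadd : ∀ a b a' b', r a b → r a' b' → r (a + a') (b + b'))
    (hsmul : ∀ (c : R) a b, r a b → r (c • a) (c • b)) (htot : ∀ a, ∃ b, r a b)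
    (huniq : ∀ b, r 0 b → b = 0) : ∃ f : A →ₗ[R] B, ∀ a b, r a b → f a = b := by
  choose f hf using htot
  have key : ∀ a b, r a b → f a = b := fun a b h => by
    have h1 := hadd _ _ _ _ (hf a) (hsmul (-1) _ _ h)
    rw [neg_one_smul, neg_one_smul, add_neg_cancel] at h1
    exact add_neg_eq_zero.1 (huniq _ h1)
  exact ⟨{ toFun := f
           map_add' := fun a b => key _ _ (hadd _ _ _ _ (hf a) (hf b))
           map_smul' := fun c a => key _ _ (hsmul c _ _ (hf a)) }, key⟩

section Chase

variable {R : Type*} [CommRing R] {H G F : Type*} [AddCommGroup H] [Module R H]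
  [AddCommGroup G] [Module R G] [AddCommGroup F] [Module R F] {l m : ℕ}
  {bH : Module.Basis (Fin l) R H} {bF : Module.Basis (Fin m) R F}
  {φ : H →ₗ[R] G} {ψ : G →ₗ[R] F} {e : ℤ}

theorem zigZag_zero_iff {p : ℕ} {w : C R H G F e p 0} {x : C R H G F e (p + 1) 0} :
    ZigZag bH bF φ ψ e p 0 (p + 1) w x ↔ d bH φ e p 0 w = x := by
  constructor
  · intro h
    cases h
    rfl
  · rintro rfl
    exact .base p w

theorem zigZag_succ_iff {p q i : ℕ} {w : C R H G F e p (q + 1)} {x : C R H G F e i 0} :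
    ZigZag bH bF φ ψ e p (q + 1) i w x ↔
      ∃ w', d bH φ e p (q + 1) w = del bF ψ e (p + 1) q w' ∧
        ZigZag bH bF φ ψ e (p + 1) q i w' x := by
  constructor
  · intro h
    cases h with
    | step _ _ _ _ w' _ hw h => exact ⟨w', hw, h⟩
  · rintro ⟨w', hw, h⟩
    exact .step p q i w w' x hw h

theorem ZigZag.add {p q i : ℕ} (hi : i = p + q + 1) {w w' : C R H G F e p q}
    {x x' : C R H G F e i 0} (h : ZigZag bH bF φ ψ e p q i w x)
    (h' : ZigZag bH bF φ ψ e p q i w' x') :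
    ZigZag bH bF φ ψ e p q i (w + w') (x + x') := by
  induction q generalizing p with
  | zero =>
    subst hi
    rw [add_zero, zigZag_zero_iff] at *
    rw [map_add, h, h']
  | succ q ih =>
    rw [zigZag_succ_iff] at *
    obtain ⟨v, hv, h⟩ := h
    obtain ⟨v', hv', h'⟩ := h'
    exact ⟨v + v', by rw [map_add, map_add, hv, hv'], ih (by omega) h h'⟩

theorem ZigZag.smul {p q i : ℕ} (hi : i = p + q + 1) (c : R) {w : C R H G F e p q}
    {x : C R H G F e i 0} (h : ZigZag bH bF φ ψ e p q i w x) :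
    ZigZag bH bF φ ψ e p q i (c • w) (c • x) := by
  induction q generalizing p with
  | zero =>
    subst hi
    rw [add_zero, zigZag_zero_iff] at *
    rw [map_smul, h]
  | succ q ih =>
    rw [zigZag_succ_iff] at *
    obtain ⟨v, hv, h⟩ := h
    exact ⟨c • v, by rw [map_smul, map_smul, hv], ih (by omega) h⟩

/-- A zig-zag sees its initial element only through `d`. -/
theorem ZigZag.congr {p q i : ℕ} (hi : i = p + q + 1) {w w' : C R H G F e p q}
    (hw : d bH φ e p q w = d bH φ e p q w') {x : C R H G F e i 0}
    (h : ZigZag bH bF φ ψ e p q i w x) : ZigZag bH bF φ ψ e p q i w' x := by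
  cases q with
  | zero =>
    subst hi
    rw [add_zero, zigZag_zero_iff] at *
    rw [← hw, h]
  | succ q =>
    rw [zigZag_succ_iff] at *
    rwa [← hw]

theorem ZigZag.of_d_eq_zero {p q i : ℕ} (hi : i = p + q + 1) {w : C R H G F e p q}
    (hw : d bH φ e p q w = 0) : ZigZag bH bF φ ψ e p q i w 0 := by
  induction q generalizing p with
  | zero =>
    subst hi
    rwa [add_zero, zigZag_zero_iff]
  | succ q ih =>
    rw [zigZag_succ_iff]
    exact ⟨0, by rw [hw, map_zero], ih (by omega) (map_zero _)⟩

theorem ZigZag.d_eq_zero {p q i : ℕ} {w : C R H G F e p q} {x : C R H G F e i 0}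
    (h : ZigZag bH bF φ ψ e p q i w x) : d bH φ e i 0 x = 0 := by
  induction h with
  | base p w => exact d_d bH φ e p 0 w
  | step _ _ _ _ _ _ _ _ ih => exact ih

theorem ZigZag.del_d_eq_zero {p q i : ℕ} (hi : i = p + q + 1) {w : C R H G F e p q}
    {x : C R H G F e i 0} (h : ZigZag bH bF φ ψ e p q i w x) (hx : del bF ψ e i 0 x = 0) :
    del bF ψ e (p + 1) q (d bH φ e p q w) = 0 := by
  cases q with
  | zero =>
    subst hi
    rw [zigZag_zero_iff.1 h]
    exact hx
  | succ q =>
    rw [zigZag_succ_iff] at h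
    obtain ⟨w', hw', -⟩ := h
    rw [hw', del_del]

variable (bF ψ e) in
theorem colBoundaries_le_ker (p q : ℕ) :
    colBoundaries (H := H) bF ψ e p q ≤ LinearMap.ker (del bF ψ e p q) := by
  cases q with
  | zero => exact le_rfl
  | succ q =>
    rintro _ ⟨x, rfl⟩
    exact del_del bF ψ e p q x

variable (F bH φ e) in
/-- The rows of the bicomplex are exact in the columns `0, …, i`. -/
structure RowsExact (i : ℕ) : Prop where
  injective : ∀ q, Function.Injective (d (F := F) bH φ e 0 q)
  exact : ∀ p < i, ∀ q, Function.Exact (d (F := F) bH φ e p q) (d bH φ e (p + 1) q)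

variable (H bF ψ e) in
/-- The augmented columns of the bicomplex are exact in the rows `0, …, Q`, as far as the exterior
degree is at least two. -/
def ColumnsExact (Q : ℕ) : Prop :=
  ∀ p q, q ≤ Q → q + 2 ≤ e.toNat + p → ∀ x : C R H G F e p q,
    del bF ψ e p q x = 0 → x ∈ colBoundaries bF ψ e p q

/-- By row exactness w comes from C^{p-1,q}, which has negative exterior degree and is zero; in
column 0 the map is injective anyway. -/
theorem RowsExact.eq_zero {i : ℕ} (hrow : RowsExact F bH φ e i) {p q : ℕ} (hp : p ≤ i)
    (hq : e.toNat + p ≤ q) {w : C R H G F e p q} (hw : d bH φ e p q w = 0) : w = 0 := by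
  cases p with
  | zero => exact hrow.injective q (hw.trans (map_zero _).symm)
  | succ p =>
    obtain ⟨c, rfl⟩ := (hrow.exact p (by omega) q w).1 hw
    rw [C.eq_zero (by omega) c, map_zero]

/-- A cycle of `N^i` is linked to an element of `C^{p,q}`. -/
theorem RowsExact.exists_zigZag (hψφ : ψ ∘ₗ φ = 0) {i : ℕ} (hrow : RowsExact F bH φ e i)
    {x : C R H G F e i 0} (hx : del bF ψ e i 0 x = 0) (hdx : d bH φ e i 0 x = 0) {p q : ℕ}
    (hi : i = p + q + 1) : ∃ w, ZigZag bH bF φ ψ e p q i w x := by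
  induction q generalizing p with
  | zero =>
    subst hi
    obtain ⟨w, rfl⟩ := (hrow.exact p (by omega) 0 x).1 hdx
    exact ⟨w, .base p w⟩
  | succ q ih =>
    obtain ⟨w', hw'⟩ := ih (p := p + 1) (by omega)
    have h := hw'.del_d_eq_zero (by omega) hx
    rw [del_d bH bF φ ψ e hψφ, neg_eq_zero] at h
    obtain ⟨w, hw⟩ := (hrow.exact p (by omega) (q + 1) _).1 h
    exact ⟨w, .step p q i w w' x hw hw'⟩

/-- An element `w ∈ C^{p,q}` such that `d w` is a column cycle is linked to a cycle of `N^i`. -/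
theorem ColumnsExact.exists_zigZag (hψφ : ψ ∘ₗ φ = 0) {Q : ℕ} (hcol : ColumnsExact H bF ψ e Q)
    {p q i : ℕ} (hi : i = p + q + 1) (hQ : q ≤ Q) (hq : q + 1 ≤ e.toNat + p)
    {w : C R H G F e p q} (hw : del bF ψ e (p + 1) q (d bH φ e p q w) = 0) :
    ∃ x, del bF ψ e i 0 x = 0 ∧ ZigZag bH bF φ ψ e p q i w x := by
  induction q generalizing p with
  | zero =>
    subst hi
    exact ⟨_, hw, .base p w⟩
  | succ q ih =>
    -- The column cycle `d w` has exterior degree at least 2 here, so it is a column boundary and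
    -- the zig-zag continues.
    obtain ⟨w', hw'⟩ := hcol (p + 1) (q + 1) hQ (by omega) _ hw
    obtain ⟨x, hx, h⟩ := ih (p := p + 1) (w := w') (by omega) (by omega) (by omega) (by
      rw [del_d bH bF φ ψ e hψφ, hw', d_d, neg_zero])
    exact ⟨x, hx, .step p q i w w' x hw'.symm h⟩

/-- A cycle of `N^i` that is linked to a column boundary is a boundary. -/
theorem ColumnsExact.exists_d_eq (hψφ : ψ ∘ₗ φ = 0) {Q : ℕ} (hcol : ColumnsExact H bF ψ e Q)
    {p q i : ℕ} (hi : i = p + q) (hQ : q ≤ Q + 1) (hq : q ≤ e.toNat + p) {w : C R H G F e p q}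
    (hw : w ∈ colBoundaries bF ψ e p q) {x : C R H G F e (i + 1) 0}
    (h : ZigZag bH bF φ ψ e p q (i + 1) w x) :
    ∃ u, del bF ψ e i 0 u = 0 ∧ d bH φ e i 0 u = x := by
  induction q generalizing p with
  | zero =>
    subst hi
    rw [zigZag_zero_iff] at h
    exact ⟨w, hw, h⟩
  | succ q ih =>
    rw [zigZag_succ_iff] at h
    obtain ⟨w', hw', h⟩ := h
    obtain ⟨v, rfl⟩ := hw
    -- Since d ∂v = -∂ d v, adding d v to w' makes it a column cycle, hence a column boundary; `d`
    -- does not notice the change.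
    refine ih (p := p + 1) (w := w' + d bH φ e p q v) (by omega) (by omega) (by omega) ?_
      (h.congr (by omega) (by rw [map_add, d_d, add_zero]))
    refine hcol _ _ (by omega) (by omega) _ ?_
    rw [map_add, del_d bH bF φ ψ e hψφ, hw', add_neg_cancel]

/-- An element of `C^{p,q}` linked to a boundary of `N^i` is a column boundary, up to the kernel
of `d`. -/
theorem RowsExact.exists_colBoundary (hψφ : ψ ∘ₗ φ = 0) {i : ℕ} (hrow : RowsExact F bH φ e i)
    {p q : ℕ} (hi : i = p + q) {w : C R H G F e p q} {v : C R H G F e i 0}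
    (hv : del bF ψ e i 0 v = 0) (h : ZigZag bH bF φ ψ e p q (i + 1) w (d bH φ e i 0 v)) :
    ∃ b ∈ colBoundaries bF ψ e p q, d bH φ e p q (w - b) = 0 := by
  induction q generalizing p with
  | zero =>
    subst hi
    rw [zigZag_zero_iff] at h
    exact ⟨v, hv, by rw [map_sub, h, sub_self]⟩
  | succ q ih =>
    rw [zigZag_succ_iff] at h
    obtain ⟨w', hw', h⟩ := h
    obtain ⟨b, hb, hd⟩ := ih (p := p + 1) (by omega) h
    obtain ⟨c, hc⟩ := (hrow.exact p (by omega) q _).1 hd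
    -- With w' - b = d c one gets d w = ∂w' = ∂ d c = -d ∂c, so w + ∂c is killed by `d`.
    refine ⟨-del bF ψ e p q c, neg_mem ⟨c, rfl⟩, ?_⟩
    have hb' : del bF ψ e (p + 1) q b = 0 := colBoundaries_le_ker bF ψ e _ _ hb
    have h1 := congrArg (del bF ψ e (p + 1) q) hc
    rw [del_d bH bF φ ψ e hψφ, map_sub, hb', sub_zero, ← hw'] at h1
    rw [sub_neg_eq_add, map_add, ← h1, neg_add_cancel]

/-! ### Vanishing and linking maps for the homology of N -/

section Homology

variable (bH bF e) in
/-- A cycle of `N^i`, given by its underlying element. -/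
def barCycle (hψφ : ψ ∘ₗ φ = 0) {i : ℕ} (x : C R H G F e i 0) (hx : del bF ψ e i 0 x = 0)
    (hdx : d bH φ e i 0 x = 0) : LinearMap.ker (dbar bH bF e hψφ i) :=
  ⟨⟨x, hx⟩, Subtype.ext hdx⟩

theorem del_barCycle {hψφ : ψ ∘ₗ φ = 0} {i : ℕ} (x : LinearMap.ker (dbar bH bF e hψφ i)) :
    del bF ψ e i 0 x.1.1 = 0 := x.1.2

theorem d_barCycle {hψφ : ψ ∘ₗ φ = 0} {i : ℕ} (x : LinearMap.ker (dbar bH bF e hψφ i)) :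
    d bH φ e i 0 x.1.1 = 0 := congrArg Subtype.val x.2

theorem Hbar.mk_eq_zero_iff {hψφ : ψ ∘ₗ φ = 0} {i : ℕ}
    {x : LinearMap.ker (dbar bH bF e hψφ (i + 1))} :
    Hbar.mk bH bF e hψφ (i + 1) x = 0 ↔
      ∃ v, del bF ψ e i 0 v = 0 ∧ d bH φ e i 0 v = x.1.1 := by
  rw [Submodule.mkQ_apply, Submodule.Quotient.mk_eq_zero]
  constructor
  · rintro ⟨v, hv⟩
    exact ⟨v.1, v.2, congrArg Subtype.val hv⟩
  · rintro ⟨v, hv, h⟩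
    exact ⟨⟨v, hv⟩, Subtype.ext h⟩

theorem Hpsi.mk_eq_zero_iff {p q : ℕ} {z : LinearMap.ker (del (H := H) bF ψ e p q)} :
    Hpsi.mk bF ψ e p q z = 0 ↔ z.1 ∈ colBoundaries bF ψ e p q := by
  rw [Submodule.mkQ_apply, Submodule.Quotient.mk_eq_zero]
  rfl

theorem Hpsi.mk_eq_mk_iff {p q : ℕ} {z z' : LinearMap.ker (del (H := H) bF ψ e p q)} :
    Hpsi.mk bF ψ e p q z = Hpsi.mk bF ψ e p q z' ↔ z.1 - z'.1 ∈ colBoundaries bF ψ e p q := by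
  rw [← sub_eq_zero, ← map_sub, Hpsi.mk_eq_zero_iff]
  rfl

/-- The map `H_ψ^{p,q} → H̄^{i}`, `i = p + q + 1`, given by zig-zags. -/
theorem exists_linkMap (hψφ : ψ ∘ₗ φ = 0) {Q : ℕ} (hcol : ColumnsExact H bF ψ e Q)
    {p q i : ℕ} (hi : i = p + q) (hQ : q ≤ Q) (hq : q + 1 ≤ e.toNat + p) :
    ∃ γ : Hpsi H bF ψ e p q →ₗ[R] Hbar bH bF e hψφ (i + 1),
      ∀ (z : LinearMap.ker (del (H := H) bF ψ e p q))
        (x : LinearMap.ker (dbar bH bF e hψφ (i + 1))),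
        ZigZag bH bF φ ψ e p q (i + 1) z.1 x.1.1 →
          γ (Hpsi.mk bF ψ e p q z) = Hbar.mk bH bF e hψφ (i + 1) x := by
  obtain ⟨γ, hγ⟩ := exists_linearMap_of_rel (R := R)
    (fun (ζ : Hpsi H bF ψ e p q) (ξ : Hbar bH bF e hψφ (i + 1)) =>
      ∃ z x, Hpsi.mk bF ψ e p q z = ζ ∧ Hbar.mk bH bF e hψφ (i + 1) x = ξ ∧
        ZigZag bH bF φ ψ e p q (i + 1) z.1 x.1.1)
    (by
      rintro _ _ _ _ ⟨z, x, rfl, rfl, h⟩ ⟨z', x', rfl, rfl, h'⟩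
      exact ⟨z + z', x + x', map_add _ _ _, map_add _ _ _, h.add (by omega) h'⟩)
    (by
      rintro c _ _ ⟨z, x, rfl, rfl, h⟩
      exact ⟨c • z, c • x, map_smul _ _ _, map_smul _ _ _, h.smul (by omega) c⟩)
    (by
      intro ζ
      obtain ⟨z, rfl⟩ := Submodule.mkQ_surjective _ ζ
      obtain ⟨x, hx, h⟩ := hcol.exists_zigZag (bH := bH) (φ := φ) hψφ (i := i + 1) (w := z.1)
        (by omega) hQ hq (by rw [del_d bH bF φ ψ e hψφ, z.2, map_zero, neg_zero])
      exact ⟨_, z, barCycle bH bF e hψφ x hx h.d_eq_zero, rfl, rfl, h⟩)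
    (by
      rintro _ ⟨z, x, hz, rfl, h⟩
      rw [Hpsi.mk_eq_zero_iff] at hz
      rw [Hbar.mk_eq_zero_iff]
      exact hcol.exists_d_eq hψφ hi (by omega) (by omega) hz h)
  exact ⟨γ, fun z x h => hγ _ _ ⟨z, x, rfl, rfl, h⟩⟩

/-- C^{p,q+1} is the last module of its column, of exterior degree 0, and C^{p+1,q+1} has exterior
degree 1. Each claim is a zig-zag lifted by row or column exactness. The row index is q + 1 because
the cokernel presentation uses the column map arriving from row q. -/
theorem hasNaturalExactSequence (hψφ : ψ ∘ₗ φ = 0) {p q i : ℕ} (hq : q + 1 = e.toNat + p)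
    (hi : i = p + (q + 1)) (hrow : RowsExact F bH φ e (i + 2))
    (hcol : ColumnsExact H bF ψ e (q + 1)) :
    HasNaturalExactSequence bH bF e hψφ p (q + 1) (i + 1) := by
  have hrow1 : RowsExact F bH φ e (i + 1) := ⟨hrow.1, fun p hp => hrow.2 p (by omega)⟩
  have hrow0 : RowsExact F bH φ e i := ⟨hrow.1, fun p hp => hrow.2 p (by omega)⟩
  have hsurj := toCoker_surjective (H := H) (e := e) (p := p) (q := q + 1) ψ (by omega)
  have hex := toCoker_exact (H := H) bF ψ (e := e) (p := p) (q := q) (by omega)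
  have hz : ∀ w : C R H G F e p (q + 1),
      del bF ψ e (p + 1) (q + 1) (d bH φ e p (q + 1) w) = 0 := fun w => by
    rw [del_d bH bF φ ψ e hψφ, C.eq_zero (by omega) (del bF ψ e p (q + 1) w), map_zero, neg_zero]
  obtain ⟨γ, hγ⟩ := exists_linkMap (bH := bH) (φ := φ) (p := p + 1) (q := q + 1) (i := i + 1)
    hψφ hcol (by omega) le_rfl (by omega)
  obtain ⟨α, hα⟩ := exists_linearMap_of_rel (R := R)
    (fun (ξ : Hbar bH bF e hψφ (i + 1))
        (η : symPow R (Module.Dual R H) (p + (-e).toNat) ⊗[R]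
          symPow R (F ⧸ LinearMap.range ψ) (q + 1)) =>
      ∃ x w, Hbar.mk bH bF e hψφ (i + 1) x = ξ ∧ toCoker ψ e p (q + 1) w = η ∧
        ZigZag bH bF φ ψ e p (q + 1) (i + 1) w x.1.1)
    (by
      rintro _ _ _ _ ⟨z, x, rfl, rfl, h⟩ ⟨z', x', rfl, rfl, h'⟩
      exact ⟨z + z', x + x', map_add _ _ _, map_add _ _ _, h.add (by omega) h'⟩)
    (by
      rintro c _ _ ⟨z, x, rfl, rfl, h⟩
      exact ⟨c • z, c • x, map_smul _ _ _, map_smul _ _ _, h.smul (by omega) c⟩)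
    (by
      intro ξ
      obtain ⟨x, rfl⟩ := Submodule.mkQ_surjective _ ξ
      obtain ⟨w, h⟩ := hrow1.exists_zigZag hψφ (del_barCycle x) (d_barCycle x) (p := p)
        (q := q + 1) (by omega)
      exact ⟨_, x, w, rfl, rfl, h⟩)
    (by
      rintro _ ⟨x, w, hx, rfl, h⟩
      obtain ⟨v, hv, hvx⟩ := Hbar.mk_eq_zero_iff.1 hx
      rw [← hvx] at h
      obtain ⟨b, hb, hwb⟩ := hrow0.exists_colBoundary hψφ hi hv h
      -- In exterior degree 0 the row map is injective, so w is itself the column boundary b.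
      have h0 := hrow.eq_zero (by omega) (by omega) hwb
      rw [sub_eq_zero.1 h0]
      exact (hex b).2 hb)
  obtain ⟨β, hβ⟩ := exists_linearMap_of_rel (R := R)
    (fun (η : symPow R (Module.Dual R H) (p + (-e).toNat) ⊗[R]
          symPow R (F ⧸ LinearMap.range ψ) (q + 1)) (ζ : Hpsi H bF ψ e (p + 1) (q + 1)) =>
      ∃ w, toCoker ψ e p (q + 1) w = η ∧
        Hpsi.mk bF ψ e (p + 1) (q + 1) ⟨d bH φ e p (q + 1) w, hz w⟩ = ζ)
    (by
      rintro _ _ _ _ ⟨w, rfl, rfl⟩ ⟨w', rfl, rfl⟩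
      refine ⟨w + w', map_add _ _ _, ?_⟩
      rw [← map_add]
      congr 1
      exact Subtype.ext (map_add _ _ _))
    (by
      rintro c _ _ ⟨w, rfl, rfl⟩
      refine ⟨c • w, map_smul _ _ _, ?_⟩
      rw [← map_smul]
      congr 1
      exact Subtype.ext (map_smul _ _ _))
    (by
      intro η
      obtain ⟨w, rfl⟩ := hsurj η
      exact ⟨_, w, rfl, rfl⟩)
    (by
      rintro _ ⟨w, hw, rfl⟩
      obtain ⟨v, rfl⟩ := (hex w).1 hw
      rw [Hpsi.mk_eq_zero_iff]
      refine ⟨-d bH φ e p q v, ?_⟩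
      rw [map_neg, del_d bH bF φ ψ e hψφ, neg_neg])
  have hα' : ∀ w x, ZigZag bH bF φ ψ e p (q + 1) (i + 1) w x.1.1 →
      α (Hbar.mk bH bF e hψφ (i + 1) x) = toCoker ψ e p (q + 1) w :=
    fun w x h => hα _ _ ⟨x, w, rfl, rfl, h⟩
  have hβ' : ∀ w, β (toCoker ψ e p (q + 1) w) =
      Hpsi.mk bF ψ e (p + 1) (q + 1) ⟨d bH φ e p (q + 1) w, hz w⟩ :=
    fun w => hβ _ _ ⟨w, rfl, rfl⟩
  refine ⟨α, β, γ, ?_, ?_, ?_, ?_, hα', fun w => ⟨_, rfl, hβ' w⟩, hγ⟩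
  · rw [injective_iff_map_eq_zero]
    intro ξ hξ
    obtain ⟨x, rfl⟩ := Submodule.mkQ_surjective _ ξ
    obtain ⟨w, h⟩ := hrow1.exists_zigZag hψφ (del_barCycle x) (d_barCycle x) (p := p)
      (q := q + 1) (by omega)
    have hw : w ∈ colBoundaries bF ψ e p (q + 1) := (hex w).1 ((hα' w x h).symm.trans hξ)
    exact Hbar.mk_eq_zero_iff.2 (hcol.exists_d_eq hψφ hi (by omega) (by omega) hw h)
  · intro η
    constructor
    · intro hη
      obtain ⟨w, rfl⟩ := hsurj η
      rw [hβ', Hpsi.mk_eq_zero_iff] at hη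
      obtain ⟨w', hw'⟩ := hη
      obtain ⟨x, hx, h⟩ := hcol.exists_zigZag (bH := bH) (φ := φ) hψφ (p := p + 1) (i := i + 1)
        (w := w') (by omega) (by omega) (by omega)
        (by rw [del_d bH bF φ ψ e hψφ, hw', d_d, neg_zero])
      exact ⟨_, hα' w (barCycle bH bF e hψφ x hx h.d_eq_zero) (.step _ _ _ _ _ _ hw'.symm h)⟩
    · rintro ⟨ξ, rfl⟩
      obtain ⟨x, rfl⟩ := Submodule.mkQ_surjective _ ξ
      obtain ⟨w, h⟩ := hrow1.exists_zigZag hψφ (del_barCycle x) (d_barCycle x) (p := p)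
        (q := q + 1) (by omega)
      have h1 := hα' w x h
      rw [h1, hβ', Hpsi.mk_eq_zero_iff]
      rw [zigZag_succ_iff] at h
      obtain ⟨w', hw', -⟩ := h
      exact ⟨w', hw'.symm⟩
  · intro ζ
    constructor
    · intro hζ
      obtain ⟨z, rfl⟩ := Submodule.mkQ_surjective _ ζ
      obtain ⟨x, hx, h⟩ := hcol.exists_zigZag (bH := bH) (φ := φ) hψφ (i := i + 1 + 1) (w := z.1)
        (by omega) le_rfl (by omega) (by rw [del_d bH bF φ ψ e hψφ, z.2, map_zero, neg_zero])
      have h1 := hγ z (barCycle bH bF e hψφ x hx h.d_eq_zero) h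
      obtain ⟨v, hv, rfl⟩ := Hbar.mk_eq_zero_iff.1 (h1.symm.trans hζ)
      obtain ⟨b, hb, hzb⟩ := hrow1.exists_colBoundary hψφ (by omega) hv h
      -- Thus z differs from d c by a column boundary, and [z] is the value of β at the image of c.
      obtain ⟨c, hc⟩ := (hrow.exact p (by omega) (q + 1) _).1 hzb
      refine ⟨toCoker ψ e p (q + 1) c, ?_⟩
      rw [hβ']
      refine Hpsi.mk_eq_mk_iff.2 ?_
      change d bH φ e p (q + 1) c - z.1 ∈ _
      rw [hc, sub_sub_cancel_left]
      exact neg_mem hb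
    · rintro ⟨η, rfl⟩
      obtain ⟨w, rfl⟩ := hsurj η
      rw [hβ']
      exact (hγ _ 0 (.of_d_eq_zero (by omega) (d_d bH φ e p (q + 1) w))).trans (map_zero _)
  · intro ξ
    obtain ⟨x, rfl⟩ := Submodule.mkQ_surjective _ ξ
    obtain ⟨w, h⟩ := hrow.exists_zigZag hψφ (del_barCycle x) (d_barCycle x) (p := p + 1)
      (q := q + 1) (by omega)
    have h1 := h.del_d_eq_zero (by omega) (del_barCycle x)
    rw [del_d bH bF φ ψ e hψφ, neg_eq_zero] at h1
    obtain ⟨c, hc⟩ := (hrow.exact p (by omega) (q + 1 + 1) _).1 h1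
    -- As C^{p,q+2} = 0, w is a column cycle and defines a class in H_ψ.
    rw [C.eq_zero (by omega) c, map_zero] at hc
    exact ⟨_, hγ ⟨w, hc.symm⟩ x h⟩

theorem subsingleton_hbar {hψφ : ψ ∘ₗ φ = 0} {i : ℕ}
    (h : ∀ x : LinearMap.ker (dbar bH bF e hψφ i), Hbar.mk bH bF e hψφ i x = 0) :
    Subsingleton (Hbar bH bF e hψφ i) := by
  refine subsingleton_of_forall_eq 0 fun ξ => ?_
  obtain ⟨x, rfl⟩ := Submodule.mkQ_surjective _ ξ
  exact h x

theorem subsingleton_hbar_zero (hψφ : ψ ∘ₗ φ = 0) (hrow : RowsExact F bH φ e 0) :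
    Subsingleton (Hbar bH bF e hψφ 0) := by
  refine subsingleton_hbar fun x => ?_
  have h : x = 0 := by
    apply Subtype.ext
    apply Subtype.ext
    exact hrow.injective 0 ((d_barCycle x).trans (map_zero _).symm)
  rw [h, map_zero]

/-- The zig-zag is followed to column 0, where injectivity of `d` forces ∂w = 0. Then w is a column
boundary: by the augmentation if i = 0, and otherwise because its exterior degree is at least 2. -/
theorem subsingleton_hbar_succ (hψφ : ψ ∘ₗ φ = 0) {i : ℕ} (hrow : RowsExact F bH φ e (i + 1))
    (hcol : ColumnsExact H bF ψ e i) (hi : i = 0 ∨ i + 2 ≤ e.toNat) :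
    Subsingleton (Hbar bH bF e hψφ (i + 1)) := by
  refine subsingleton_hbar fun x => ?_
  obtain ⟨w, h⟩ := hrow.exists_zigZag hψφ (del_barCycle x) (d_barCycle x) (p := 0) (q := i)
    (by omega)
  have h1 := h.del_d_eq_zero (by omega) (del_barCycle x)
  rw [del_d bH bF φ ψ e hψφ, neg_eq_zero] at h1
  have h2 := hrow.injective (i + 1) (h1.trans (map_zero _).symm)
  refine Hbar.mk_eq_zero_iff.2 (hcol.exists_d_eq hψφ (by omega) (by omega) (by omega) ?_ h)
  rcases hi with rfl | hi
  · exact h2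
  · exact hcol 0 i le_rfl (by omega) w h2

/-- C^{1,1} has exterior degree 0, so `d` is injective there and the preimage w of the cycle already
lies in N^1. -/
theorem subsingleton_hbar_two (hψφ : ψ ∘ₗ φ = 0) (he : e.toNat = 0)
    (hrow : RowsExact F bH φ e 2) : Subsingleton (Hbar bH bF e hψφ 2) := by
  refine subsingleton_hbar fun x => ?_
  obtain ⟨w, h⟩ := hrow.exists_zigZag hψφ (del_barCycle x) (d_barCycle x) (p := 1) (q := 0) rfl
  have h1 := h.del_d_eq_zero (by omega) (del_barCycle x)
  rw [del_d bH bF φ ψ e hψφ, neg_eq_zero] at h1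
  exact Hbar.mk_eq_zero_iff.2
    ⟨w, hrow.eq_zero (by omega) (by omega) h1, zigZag_zero_iff.1 h⟩

/-- The zig-zags end in column 0, where `d` is injective; this removes the ambiguity of w and makes
it a column cycle. -/
theorem exists_linkEquiv (hψφ : ψ ∘ₗ φ = 0) {q : ℕ} (hrow : RowsExact F bH φ e (q + 1))
    (hcol : ColumnsExact H bF ψ e q) (hq : q + 1 ≤ e.toNat) :
    ∃ ε : Hpsi H bF ψ e 0 q ≃ₗ[R] Hbar bH bF e hψφ (q + 1),
      ∀ (z : LinearMap.ker (del (H := H) bF ψ e 0 q))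
        (x : LinearMap.ker (dbar bH bF e hψφ (q + 1))),
        ZigZag bH bF φ ψ e 0 q (q + 1) z.1 x.1.1 →
          ε (Hpsi.mk bF ψ e 0 q z) = Hbar.mk bH bF e hψφ (q + 1) x := by
  have hrow0 : RowsExact F bH φ e q := ⟨hrow.1, fun p hp => hrow.2 p (by omega)⟩
  obtain ⟨γ, hγ⟩ := exists_linkMap (bH := bH) (φ := φ) (p := 0) (q := q) (i := q) hψφ hcol
    (by omega) le_rfl (by omega)
  have hinj : Function.Injective γ := by
    rw [injective_iff_map_eq_zero]
    intro ζ hζ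
    obtain ⟨z, rfl⟩ := Submodule.mkQ_surjective _ ζ
    obtain ⟨x, hx, h⟩ := hcol.exists_zigZag (bH := bH) (φ := φ) hψφ (i := q + 1) (w := z.1)
      (by omega) le_rfl (by omega) (by rw [del_d bH bF φ ψ e hψφ, z.2, map_zero, neg_zero])
    have h1 := hγ z (barCycle bH bF e hψφ x hx h.d_eq_zero) h
    obtain ⟨v, hv, rfl⟩ := Hbar.mk_eq_zero_iff.1 (h1.symm.trans hζ)
    obtain ⟨b, hb, hzb⟩ := hrow0.exists_colBoundary hψφ (by omega) hv h
    have h2 := sub_eq_zero.1 (hrow.injective q (hzb.trans (map_zero _).symm))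
    refine Hpsi.mk_eq_zero_iff.2 ?_
    rwa [h2]
  have hsurj : Function.Surjective γ := by
    intro ξ
    obtain ⟨x, rfl⟩ := Submodule.mkQ_surjective _ ξ
    obtain ⟨w, h⟩ := hrow.exists_zigZag hψφ (del_barCycle x) (d_barCycle x) (p := 0)
      (q := q) (by omega)
    have h1 := h.del_d_eq_zero (by omega) (del_barCycle x)
    rw [del_d bH bF φ ψ e hψφ, neg_eq_zero] at h1
    exact ⟨_, hγ ⟨w, hrow.injective (q + 1) (h1.trans (map_zero _).symm)⟩ x h⟩
  exact ⟨LinearEquiv.ofBijective γ ⟨hinj, hsurj⟩, hγ⟩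

end Homology

end Chase

/-! ### Sections up to a factor, and determinantal ideals -/

section Sections

open Matrix

variable {R : Type*} [CommRing R] {m n : ℕ}

/-- The elements `a` such that the matrix `B` has a right inverse up to the factor `a`. -/
def sectionIdeal {ι κ : Type*} [DecidableEq ι] [Fintype κ] (B : Matrix ι κ R) : Ideal R where
  carrier := {a | ∃ V : Matrix κ ι R, B * V = a • 1}
  add_mem' := by
    rintro a b ⟨V, hV⟩ ⟨W, hW⟩
    exact ⟨V + W, by rw [Matrix.mul_add, hV, hW, add_smul]⟩
  zero_mem' := ⟨0, by rw [Matrix.mul_zero, zero_smul]⟩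
  smul_mem' := by
    rintro c a ⟨V, hV⟩
    exact ⟨c • V, by rw [Matrix.mul_smul, hV, smul_smul, smul_eq_mul]⟩

/-- Cramer's rule: the adjugate of the selected columns, placed in the rows selected by g. -/
theorem det_submatrix_mem_sectionIdeal (B : Matrix (Fin m) (Fin n) R) (g : Fin m → Fin n) :
    (B.submatrix id g).det ∈ sectionIdeal B := by
  refine ⟨(1 : Matrix (Fin n) (Fin n) R).submatrix id g * (B.submatrix id g).adjugate, ?_⟩
  rw [← Matrix.mul_assoc]
  convert Matrix.mul_adjugate (B.submatrix id g) using 2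
  ext i j
  simp [Matrix.mul_apply, Matrix.one_apply]

theorem det_submatrix_eq_mul (B : Matrix (Fin m) (Fin n) R) (f : Fin m → Fin m)
    (g : Fin m → Fin n) :
    (B.submatrix f g).det =
      ((1 : Matrix (Fin m) (Fin m) R).submatrix f id).det * (B.submatrix id g).det := by
  rw [← Matrix.det_mul]
  congr 1
  ext i j
  simp [Matrix.mul_apply, Matrix.one_apply]

theorem minorIdeal_le_iff {ι κ : Type*} {k : ℕ} {A : Matrix ι κ R} {I : Ideal R} :
    minorIdeal k A ≤ I ↔ ∀ f g, (A.submatrix f g : Matrix (Fin k) (Fin k) R).det ∈ I := by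
  rw [minorIdeal, Ideal.span_le]
  constructor
  · exact fun h f g => h ⟨f, g, rfl⟩
  · rintro h _ ⟨f, g, rfl⟩
    exact h f g

theorem minorIdeal_le_sectionIdeal (B : Matrix (Fin m) (Fin n) R) :
    minorIdeal m B ≤ sectionIdeal B := by
  rw [minorIdeal_le_iff]
  intro f g
  rw [det_submatrix_eq_mul]
  exact Ideal.mul_mem_left _ _ (det_submatrix_mem_sectionIdeal B g)

theorem minorIdeal_transpose_le {l : ℕ} (A : Matrix (Fin n) (Fin l) R) :
    minorIdeal l A ≤ minorIdeal l Aᵀ := by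
  rw [minorIdeal_le_iff]
  intro f g
  rw [← Matrix.det_transpose, Matrix.transpose_submatrix]
  exact Ideal.subset_span ⟨g, f, rfl⟩

variable {H G F : Type*} [AddCommGroup H] [Module R H]
  [AddCommGroup G] [Module R G] [AddCommGroup F] [Module R F] {l : ℕ}
  (bH : Module.Basis (Fin l) R H) (bG : Module.Basis (Fin n) R G) (bF : Module.Basis (Fin m) R F)

theorem exists_isDualUpTo_of_mem_sectionIdeal {ψ : G →ₗ[R] F} {a : R}
    (ha : a ∈ sectionIdeal (LinearMap.toMatrix bG bF ψ)) :
    ∃ v, IsDualUpTo a (fun j => bF.coord j ∘ₗ ψ) v := by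
  obtain ⟨V, hV⟩ := ha
  refine ⟨fun j => ∑ k, V k j • bG k, fun i j => ?_⟩
  have h := congrFun (congrFun hV i) j
  rw [Matrix.smul_apply, Matrix.one_apply, smul_eq_mul, mul_ite, mul_one, mul_zero,
    Matrix.mul_apply] at h
  rw [← h]
  simp [LinearMap.toMatrix_apply, mul_comm]

theorem exists_isDualUpTo_of_mem_sectionIdeal_transpose {φ : H →ₗ[R] G} {a : R}
    (ha : a ∈ sectionIdeal (LinearMap.toMatrix bH bG φ)ᵀ) :
    ∃ f, IsDualUpTo a f fun j => φ (bH j) := by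
  obtain ⟨V, hV⟩ := ha
  refine ⟨fun i => ∑ k, V k i • bG.coord k, fun i j => ?_⟩
  have h := congrFun (congrFun hV j) i
  rw [Matrix.smul_apply, Matrix.one_apply, smul_eq_mul, mul_ite, mul_one, mul_zero,
    Matrix.mul_apply] at h
  simp only [eq_comm (a := i)]
  rw [← h]
  simp [LinearMap.toMatrix_apply, mul_comm]

end Sections

/-! ### Minors of φ annihilate the obstruction to splitting ψ, up to powers -/

section Surjectivity

open Matrix RingTheory.Sequence

/-- Exactness at S_1 ⊗ ⋀^0 writes each X j as ∑ f i (g) X i for some vector g; these vectors form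
the dual family. -/
theorem exists_isDualUpTo_one {R G : Type*} [CommRing R] [AddCommGroup G] [Module R G] {m : ℕ}
    {f : Fin m → Module.Dual R G}
    (h : ∀ x ∈ piece R (Fin m) G 1 0, contractDiff f x = 0 →
      ∃ u ∈ piece R (Fin m) G 0 1, contractDiff f u = x) :
    ∃ v, IsDualUpTo (1 : R) f v := by
  have key : ∀ x : MvPolynomial (Fin m) R, ∀ g : ExteriorAlgebra R G,
      contractDiff f (x ⊗ₜ[R] g : MvPolynomial (Fin m) R ⊗[R] ExteriorAlgebra R G) =
        (∑ j, (MvPolynomial.X j * x) ⊗ₜ[R] CliffordAlgebra.contractLeft (f j) g :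
          MvPolynomial (Fin m) R ⊗[R] ExteriorAlgebra R G) := by
    intro x g
    exact LinearMap.sum_apply Finset.univ (fun j => tensorEnd (mulX R j) (contractEnd (f j))) _
  have hu : ∀ u ∈ piece R (Fin m) G 0 1, ∃ g,
      u = ((1 : MvPolynomial (Fin m) R) ⊗ₜ[R] ExteriorAlgebra.ι R g :
        MvPolynomial (Fin m) R ⊗[R] ExteriorAlgebra R G) := by
    rintro _ ⟨u, rfl⟩
    induction u using TensorProduct.induction_on with
    | zero => exact ⟨0, by rw [map_zero, map_zero, TensorProduct.tmul_zero]; rfl⟩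
    | add u u' h h' =>
      obtain ⟨g, hg⟩ := h
      obtain ⟨g', hg'⟩ := h'
      exact ⟨g + g', by rw [map_add, hg, hg', map_add, TensorProduct.tmul_add]; rfl⟩
    | tmul y g =>
      have hg : (g : ExteriorAlgebra R G) ∈ ⋀[R]^1 G := (extPow_natCast (R := R) (M := G) 1).le g.2
      rw [ExteriorAlgebra.exteriorPower, pow_one] at hg
      obtain ⟨g', hg'⟩ := hg
      have hy : (y : MvPolynomial (Fin m) R) =
          MvPolynomial.C ((y : MvPolynomial (Fin m) R).coeff 0) :=
        MvPolynomial.totalDegree_eq_zero_iff_eq_C.1 (Nat.le_zero.1 y.2.totalDegree_le)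
      refine ⟨(y : MvPolynomial (Fin m) R).coeff 0 • g', ?_⟩
      change (y : MvPolynomial (Fin m) R) ⊗ₜ[R] (g : ExteriorAlgebra R G) = _
      rw [map_smul, TensorProduct.tmul_smul, TensorProduct.smul_tmul', hg',
          MvPolynomial.smul_eq_C_mul,
        mul_one, ← hy]
  have hX : ∀ j, ∃ g, ∀ i, f i g = if i = j then 1 else 0 := by
    intro j
    let x : PolyExt R (Fin m) G := (MvPolynomial.X j ⊗ₜ[R] 1 :
      MvPolynomial (Fin m) R ⊗[R] ExteriorAlgebra R G)
    obtain ⟨u, hu', hux⟩ := h x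
      ⟨⟨MvPolynomial.X j, MvPolynomial.isHomogeneous_X R j⟩ ⊗ₜ extOne R G rfl, rfl⟩ (by
        refine (key _ _).trans (Finset.sum_eq_zero fun i _ => ?_)
        rw [CliffordAlgebra.contractLeft_one, TensorProduct.tmul_zero]
        rfl)
    obtain ⟨g, rfl⟩ := hu u hu'
    refine ⟨g, fun i => ?_⟩
    have h1 := congrArg ((TensorProduct.lid R R).toLinearMap ∘ₗ
      TensorProduct.map (MvPolynomial.lcoeff R (Finsupp.single i 1))
        ExteriorAlgebra.algebraMapInv.toLinearMap) ((key _ _).symm.trans hux)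
    have h2 : ∀ k, ExteriorAlgebra.algebraMapInv
        (CliffordAlgebra.contractLeft (Q := 0) (f k) (ExteriorAlgebra.ι R g)) = f k g := fun k => by
      have := CliffordAlgebra.contractLeft_ι (Q := 0) (f k) g
      rw [this]
      exact ExteriorAlgebra.algebraMap_leftInverse _ _
    simpa [x, h2, MvPolynomial.coeff_X, Finsupp.single_left_inj, eq_comm] using h1
  choose v hv using hX
  exact ⟨v, fun i j => hv j i⟩

variable {S : Type*} [CommRing S] {l m n r : ℕ}

/-- An invertible l-minor splits A, and since B A = 0, B factors through its restriction B' to the n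
- l remaining coordinates. B' has so few columns that a regular sequence of length r in its section
ideal forces surjectivity. -/
theorem one_mem_sectionIdeal_of_isUnit {A : Matrix (Fin n) (Fin l) S} {B : Matrix (Fin m) (Fin n) S}
    (hBA : B * A = 0) (hl : 2 ≤ l) (hr : n = m + r) {rs : List S} (hrs : IsWeaklyRegular S rs)
    (hr1 : 1 ≤ r) (hlen : r ≤ rs.length) (hB : ∀ a ∈ rs, a ∈ sectionIdeal B) {f : Fin l → Fin n}
    (hf : IsUnit (A.submatrix f id).det) : 1 ∈ sectionIdeal B := by
  classical
  rcases subsingleton_or_nontrivial S with hS | hS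
  · exact ⟨0, Subsingleton.elim _ _⟩
  let ι := {i // i ∉ Set.range f}
  let E : Matrix (Fin l) (Fin n) S := (1 : Matrix (Fin n) (Fin n) S).submatrix f id
  let J : Matrix (Fin n) ι S := (1 : Matrix (Fin n) (Fin n) S).submatrix id Subtype.val
  -- P is the projection along the image of A onto the coordinates outside the range of f.
  let P : Matrix (Fin n) (Fin n) S := 1 - A * ((A.submatrix f id)⁻¹ * E)
  let P' : Matrix ι (Fin n) S := P.submatrix Subtype.val id
  have hBP : B * P = B := by
    simp only [P]
    rw [Matrix.mul_sub, ← Matrix.mul_assoc, hBA, Matrix.zero_mul, sub_zero, Matrix.mul_one]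
  have hEP : P.submatrix f id = 0 := by
    have h1 : ∀ X : Matrix (Fin l) (Fin n) S, (A * X).submatrix f id = A.submatrix f id * X :=
      fun X => rfl
    simp only [P]
    rw [Matrix.submatrix_sub]
    change E - (A * ((A.submatrix f id)⁻¹ * E)).submatrix f id = 0
    rw [h1, ← Matrix.mul_assoc, Matrix.mul_nonsing_inv _ hf, Matrix.one_mul, sub_self]
  have hJP : J * P' = P := by
    ext i k
    rw [Matrix.mul_apply]
    by_cases hi : i ∈ Set.range f
    · obtain ⟨j, rfl⟩ := hi
      rw [show P (f j) k = 0 from congrFun (congrFun hEP j) k]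
      refine Finset.sum_eq_zero fun x _ => ?_
      have : f j ≠ x.1 := fun h => x.2 ⟨j, h⟩
      simp [J, this]
    · rw [Finset.sum_eq_single ⟨i, hi⟩]
      · change (1 : Matrix (Fin n) (Fin n) S) i i * P i k = P i k
        rw [Matrix.one_apply_eq, one_mul]
      · intro x _ hx
        have : i ≠ x.1 := fun h => hx (Subtype.ext h.symm)
        simp [J, this]
      · simp
  let B' : Matrix (Fin m) ι S := B * J
  have hB' : ∀ a ∈ rs, a ∈ sectionIdeal B' := by
    intro a ha
    obtain ⟨V, hV⟩ := hB a ha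
    refine ⟨P' * V, ?_⟩
    rw [← hV, ← Matrix.mul_assoc, Matrix.mul_assoc B, hJP, hBP]
  have hinj : Function.Injective f := by
    intro i j hij
    by_contra hne
    refine not_isUnit_zero (M₀ := S) ?_
    rwa [Matrix.det_zero_of_row_eq hne (by ext k; simp [hij])] at hf
  have hcard : Fintype.card ι + l = n := by
    have h1 := Fintype.card_subtype_compl (fun i => i ∈ Set.range f)
    have h2 : Fintype.card {i // i ∈ Set.range f} = l := by
      exact (Set.card_range_of_injective hinj).trans (Fintype.card_fin l)
    have h3 := Fintype.card_le_of_injective f hinj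
    rw [h2] at h1
    simp only [Fintype.card_fin] at h1 h3
    change Fintype.card {i // ¬ i ∈ Set.range f} + l = n
    omega
  -- A right inverse of B' up to a regular factor is an injective map from S^m to S^ι.
  have hm : m ≤ Fintype.card ι := by
    obtain ⟨a, ha, hreg⟩ : ∃ a ∈ rs, IsSMulRegular S a := by
      cases rs with
      | nil => simp at hlen; omega
      | cons a rs => exact ⟨a, by simp, ((isWeaklyRegular_cons_iff S a rs).1 hrs).1⟩
    obtain ⟨V, hV⟩ := hB' a ha
    have h1 : Function.Injective V.mulVecLin := by
      rw [injective_iff_map_eq_zero]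
      intro x hx
      have h2 : B' *ᵥ (V *ᵥ x) = 0 := by
        rw [show V *ᵥ x = 0 from hx, Matrix.mulVec_zero]
      rw [Matrix.mulVec_mulVec, hV, Matrix.smul_mulVec, Matrix.one_mulVec] at h2
      ext i
      exact hreg.right_eq_zero_of_smul (congrFun h2 i)
    simpa using card_le_of_injective S V.mulVecLin h1
  let b : Module.Basis (Fin (Fintype.card ι)) S (ι → S) :=
    (Pi.basisFun S ι).reindex (Fintype.equivFin ι)
  let g : Fin m → Module.Dual S (ι → S) := fun i => LinearMap.proj i ∘ₗ B'.mulVecLin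
  have hg : ∀ a ∈ rs, ∃ (N : ℕ) (v : Fin m → ι → S), IsDualUpTo (a ^ N) g v := by
    intro a ha
    obtain ⟨V, hV⟩ := hB' a ha
    refine ⟨1, fun j => V.col j, fun i j => ?_⟩
    rw [pow_one]
    have h := congrFun (congrFun hV i) j
    rw [Matrix.smul_apply, Matrix.one_apply, smul_eq_mul, mul_ite, mul_one, mul_zero] at h
    exact h
  -- If card ι = m + 1 + s, then S_1 ⊗ ⋀^0 sits in position s + 2 = r - l + 1 of the prolonged
  -- complex, and this is less than r because l ≥ 2.
  have hex : ∀ x ∈ piece S (Fin m) (ι → S) 1 0, contractDiff g x = 0 →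
      ∃ u ∈ piece S (Fin m) (ι → S) 0 1, contractDiff g u = x := by
    intro x hx hgx
    rcases hm.eq_or_lt with hm' | hm'
    · exact contractDiff_exact_of_lt b hrs hg (k := 1) (by omega) 0 (by omega) x hx hgx
    · obtain ⟨s, hs⟩ := Nat.exists_eq_add_of_lt hm'
      exact contractDiff_exact_of_le b hrs hg (k := 1) (s := s) (by omega) 0 (by omega) x hx hgx
  obtain ⟨v, hv⟩ := exists_isDualUpTo_one hex
  refine ⟨J * Matrix.of fun i j => v j i, ?_⟩
  rw [← Matrix.mul_assoc, one_smul]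
  ext i j
  rw [Matrix.one_apply]
  exact hv i j

/-- Denominators are cleared twice: δ^N makes the entries of the section integral, and δ^M turns the
finitely many identities in the localization into identities in R. -/
theorem exists_pow_mem_sectionIdeal {R : Type*} [CommRing R] (δ : R) {B : Matrix (Fin m) (Fin n) R}
    (h : 1 ∈ sectionIdeal (B.map (algebraMap R (Localization.Away δ)))) :
    δ ∈ (sectionIdeal B).radical := by
  obtain ⟨V, hV⟩ := h
  obtain ⟨⟨_, N, rfl⟩, hc⟩ := IsLocalization.exist_integer_multiples_of_finite
    (Submonoid.powers δ) (fun p : Fin n × Fin m => V p.1 p.2)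
  choose W hW using hc
  have h1 : ∀ p : Fin m × Fin m, ∃ c : Submonoid.powers δ,
      (c : R) * (∑ k, B p.1 k * W (k, p.2)) =
        c * (δ ^ N * (1 : Matrix (Fin m) (Fin m) R) p.1 p.2) := by
    rintro ⟨i, j⟩
    refine IsLocalization.exists_of_eq (S := Localization.Away δ) ?_
    have h2 := congrFun (congrFun hV i) j
    rw [one_smul, Matrix.mul_apply] at h2
    rw [map_sum, map_mul]
    have h3 : algebraMap R (Localization.Away δ) ((1 : Matrix (Fin m) (Fin m) R) i j) =
        (1 : Matrix (Fin m) (Fin m) (Localization.Away δ)) i j := by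
      simp only [Matrix.one_apply]; split_ifs <;> simp
    rw [h3, ← h2, Finset.mul_sum]
    refine Finset.sum_congr rfl fun k _ => ?_
    rw [map_mul, hW, Matrix.map_apply, Algebra.smul_def]
    ring
  choose c hc using h1
  obtain ⟨M, hM⟩ := (∏ p, c p).2
  have hM' : ∀ p : Fin m × Fin m, δ ^ M * (∑ k, B p.1 k * W (k, p.2)) =
      δ ^ M * (δ ^ N * (1 : Matrix (Fin m) (Fin m) R) p.1 p.2) := by
    intro p
    have h4 : δ ^ M = (∏ p' ∈ Finset.univ.erase p, (c p' : R)) * c p := by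
      rw [Finset.prod_erase_mul _ _ (Finset.mem_univ p)]
      simpa using hM
    rw [h4, mul_assoc, hc, mul_assoc]
  refine ⟨M + N, Matrix.of fun k j => δ ^ M * W (k, j), ?_⟩
  ext i j
  rw [Matrix.mul_apply, Matrix.smul_apply, pow_add, smul_eq_mul, mul_assoc, ← hM' (i, j),
    Finset.mul_sum]
  refine Finset.sum_congr rfl fun k _ => ?_
  rw [Matrix.of_apply]
  ring

/-- Each maximal minor is inverted in turn; localization is flat, so the regular sequence remains
weakly regular. -/
theorem minorIdeal_le_radical_sectionIdeal {R : Type*} [CommRing R] {A : Matrix (Fin n) (Fin l) R}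
    {B : Matrix (Fin m) (Fin n) R} (hBA : B * A = 0) (hl : 2 ≤ l) (hr : n = m + r) {rs : List R}
    (hrs : IsWeaklyRegular R rs) (hr1 : 1 ≤ r) (hlen : r ≤ rs.length)
    (hB : ∀ a ∈ rs, a ∈ sectionIdeal B) : minorIdeal l A ≤ (sectionIdeal B).radical := by
  have key : ∀ f : Fin l → Fin n, (A.submatrix f id).det ∈ (sectionIdeal B).radical := by
    intro f
    set δ := (A.submatrix f id).det with hδ
    let α := algebraMap R (Localization.Away δ)
    refine exists_pow_mem_sectionIdeal δ ?_
    refine one_mem_sectionIdeal_of_isUnit (A := A.map α) (f := f) (rs := rs.map α) ?_ hl hr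
      (hrs.of_flat (S := Localization.Away δ)) hr1 (by simpa using hlen) ?_ ?_
    · rw [← Matrix.map_mul, hBA, Matrix.map_zero _ (map_zero _)]
    · intro a ha
      obtain ⟨a, ha', rfl⟩ := List.mem_map.1 ha
      obtain ⟨V, hV⟩ := hB a ha'
      refine ⟨V.map α, ?_⟩
      rw [← Matrix.map_mul, hV]
      ext i j
      simp only [Matrix.map_apply, Matrix.smul_apply, Matrix.one_apply, smul_eq_mul, map_mul]
      split_ifs <;> simp [α]
    · rw [Matrix.submatrix_map]
      have h1 : ((A.submatrix f id).map α).det = α δ := (RingHom.map_det α _).symm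
      rw [h1]
      exact IsLocalization.Away.algebraMap_isUnit δ
  rw [minorIdeal_le_iff]
  intro f g
  have h1 : (A.submatrix f g).det =
      (A.submatrix f id).det * ((1 : Matrix (Fin l) (Fin l) R).submatrix id g).det := by
    rw [← Matrix.det_mul]
    congr 1
    ext i j
    simp [Matrix.mul_apply, Matrix.one_apply]
  rw [h1]
  exact Ideal.mul_mem_right _ _ (key f)

end Surjectivity

section Regular

open RingTheory.Sequence

theorem exists_lt_length_of_lt_idealGrade {R : Type*} [CommRing R] {I : Ideal R} {p : ℕ}
    (h : (p : ℕ∞) < idealGrade I) :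
    ∃ rs : List R, (∀ a ∈ rs, a ∈ I) ∧ IsWeaklyRegular R rs ∧ p < rs.length := by
  obtain ⟨⟨rs, h1, h2⟩, h3⟩ := lt_iSup_iff.1 h
  exact ⟨rs, h1, h2, by exact_mod_cast h3⟩

end Regular

/-! ### Exactness of rows and columns in terms of grades -/

section GradeExactness

open RingTheory.Sequence

variable {R : Type*} [CommRing R] {H G F : Type*} [AddCommGroup H] [Module R H]
  [AddCommGroup G] [Module R G] [AddCommGroup F] [Module R F] {l m n r : ℕ}
  {φ : H →ₗ[R] G} {ψ : G →ₗ[R] F} {e : ℤ}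

theorem rowsExact_of_lt_idealGrade (bH : Module.Basis (Fin l) R H)
    (bG : Module.Basis (Fin n) R G) (bF : Module.Basis (Fin m) R F) {i : ℕ}
    (hi : (i : ℕ∞) < idealGrade (minorIdeal l (LinearMap.toMatrix bH bG φ))) (hel : e < l) :
    RowsExact F bH φ e i := by
  have := Module.Free.of_basis bG
  obtain ⟨rs, hI, hrs, hlen⟩ := exists_lt_length_of_lt_idealGrade hi
  have hv : ∀ a ∈ rs, ∃ (N : ℕ) (f : Fin l → Module.Dual R G),
      IsDualUpTo (a ^ N) f fun j => φ (bH j) := fun a ha => by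
    obtain ⟨f, hf⟩ := exists_isDualUpTo_of_mem_sectionIdeal_transpose bH bG
      (minorIdeal_le_sectionIdeal _ (minorIdeal_transpose_le _ (hI a ha)))
    exact ⟨1, f, by rwa [pow_one]⟩
  exact ⟨fun q => d_injective hrs hv (by omega) hel bF q,
    fun p hp q => d_exact hrs hv (by omega) hel bF q⟩

/-- Columns with e.toNat + p ≤ r use the prolonged complex, where exterior degree at least 2 means a
position below r, so `rs` suffices. The other columns start at ⋀^{e.toNat + p} and need a sequence
longer than Q, which is `rs'`. -/
theorem columnsExact_of_isWeaklyRegular (bH : Module.Basis (Fin l) R H)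
    (bG : Module.Basis (Fin n) R G) (bF : Module.Basis (Fin m) R F) (hr : n = m + r) {rs : List R}
    (hrs : IsWeaklyRegular R rs)
    (hI : ∀ a ∈ rs, a ∈ sectionIdeal (LinearMap.toMatrix bG bF ψ)) (hlen : r ≤ rs.length)
    {rs' : List R} (hrs' : IsWeaklyRegular R rs')
    (hI' : ∀ a ∈ rs', a ∈ (sectionIdeal (LinearMap.toMatrix bG bF ψ)).radical) {Q : ℕ}
    (hQ : Q < rs'.length) : ColumnsExact H bF ψ e Q := by
  have := Module.Free.of_basis bG
  have hv : ∀ a, a ∈ (sectionIdeal (LinearMap.toMatrix bG bF ψ)).radical →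
      ∃ (N : ℕ) (v : Fin m → G), IsDualUpTo (a ^ N) (fun j => bF.coord j ∘ₗ ψ) v := by
    rintro a ⟨N, hN⟩
    exact ⟨N, exists_isDualUpTo_of_mem_sectionIdeal bG bF hN⟩
  intro p q hq hpq x hx
  cases q with
  | zero => exact hx
  | succ q =>
    refine (del_exact bF ψ e bH (fun y hy hDy => ?_) x).1 hx
    rcases le_or_gt (e.toNat + p) r with h | h
    · exact contractDiff_exact_of_le bG hrs (fun a ha => hv a (Ideal.le_radical (hI a ha)))
        (s := r - (e.toNat + p)) (by push_cast [h]; omega) q (by omega) y hy hDy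
    · exact contractDiff_exact_of_lt bG hrs' (fun a ha => hv a (hI' a ha)) (by omega) q
        (by omega) y hy hDy

theorem exists_isWeaklyRegular_of_le_idealGrade (bG : Module.Basis (Fin n) R G)
    (bF : Module.Basis (Fin m) R F) (hr1 : 1 ≤ r)
    (hrg : (r : ℕ∞) ≤ idealGrade (minorIdeal m (LinearMap.toMatrix bG bF ψ))) :
    ∃ rs : List R, IsWeaklyRegular R rs ∧ r ≤ rs.length ∧
      ∀ a ∈ rs, a ∈ sectionIdeal (LinearMap.toMatrix bG bF ψ) := by
  -- The grade is a supremum, so a sequence is extracted from the strict inequality s < grade with r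
  -- = s + 1.
  obtain ⟨s, rfl⟩ := Nat.exists_eq_add_of_le' hr1
  obtain ⟨rs, hI, hrs, hlen⟩ := exists_lt_length_of_lt_idealGrade
    (lt_of_lt_of_le (by exact_mod_cast s.lt_succ_self) hrg)
  exact ⟨rs, hrs, hlen, fun a ha => minorIdeal_le_sectionIdeal _ (hI a ha)⟩

theorem columnsExact_of_lt_rank (bH : Module.Basis (Fin l) R H)
    (bG : Module.Basis (Fin n) R G) (bF : Module.Basis (Fin m) R F) (hr : n = m + r) (hr1 : 1 ≤ r)
    (hrg : (r : ℕ∞) ≤ idealGrade (minorIdeal m (LinearMap.toMatrix bG bF ψ))) {Q : ℕ}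
    (hQ : Q < r) : ColumnsExact H bF ψ e Q := by
  obtain ⟨rs, hrs, hlen, hI⟩ := exists_isWeaklyRegular_of_le_idealGrade bG bF hr1 hrg
  exact columnsExact_of_isWeaklyRegular bH bG bF hr hrs hI hlen hrs
    (fun a ha => Ideal.le_radical (hI a ha)) (by omega)

theorem columnsExact_of_lt_idealGrade (bH : Module.Basis (Fin l) R H)
    (bG : Module.Basis (Fin n) R G) (bF : Module.Basis (Fin m) R F) (hψφ : ψ ∘ₗ φ = 0)
    (hl : 2 ≤ l) (hr : n = m + r)
    (hr1 : 1 ≤ r) (hrg : (r : ℕ∞) ≤ idealGrade (minorIdeal m (LinearMap.toMatrix bG bF ψ)))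
    {Q : ℕ} (hQ : (Q : ℕ∞) < idealGrade (minorIdeal l (LinearMap.toMatrix bH bG φ))) :
    ColumnsExact H bF ψ e Q := by
  obtain ⟨rs, hrs, hlen, hI⟩ := exists_isWeaklyRegular_of_le_idealGrade bG bF hr1 hrg
  obtain ⟨rs', hI', hrs', hlen'⟩ := exists_lt_length_of_lt_idealGrade hQ
  have h0 : LinearMap.toMatrix bG bF ψ * LinearMap.toMatrix bH bG φ = 0 := by
    rw [← LinearMap.toMatrix_comp, hψφ, map_zero]
  exact columnsExact_of_isWeaklyRegular bH bG bF hr hrs hI hlen hrs'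
    (fun a ha => minorIdeal_le_radical_sectionIdeal h0 hl hr hrs hr1 hlen hI (hI' a ha)) hlen'

end GradeExactness

end KoszulBicomplex

end

/-! ### The theorem -/

theorem theorem2p3 {R : Type*} [CommRing R] [IsNoetherianRing R]
    {H G F : Type*} [AddCommGroup H] [Module R H] [AddCommGroup G] [Module R G]
    [AddCommGroup F] [Module R F]
    (l n m r : ℕ) (bH : Module.Basis (Fin l) R H) (bG : Module.Basis (Fin n) R G)
    (bF : Module.Basis (Fin m) R F)
    (φ : H →ₗ[R] G) (ψ : G →ₗ[R] F) (hψφ : ψ ∘ₗ φ = 0)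
    (hln : l ≤ n) (hr : n = m + r) (g h : ℕ∞)
    (hg : g = idealGrade (minorIdeal m (LinearMap.toMatrix bG bF ψ)))
    (hh : h = idealGrade (minorIdeal l (LinearMap.toMatrix bH bG φ)))
    (hr1 : 1 ≤ r) (hrg : (r : ℕ∞) ≤ g) (t : ℤ) (ht : t < 0) :
    (0 < t + l →
      1 < l ∧
      (∀ i : ℕ, (i : ℕ∞) < h → (i : ℤ) < max 2 (t + l) →
        Subsingleton (Hbar bH bF (t + l) hψφ i)) ∧
      (∀ i q : ℕ, (i : ℤ) = t + l → (q : ℤ) = t + l - 1 → 2 ≤ i → (i : ℕ∞) < h →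
        ∃ ε : Hpsi H bF ψ (t + l) 0 q ≃ₗ[R] Hbar bH bF (t + l) hψφ i,
          ∀ (z : LinearMap.ker (del (H := H) bF ψ (t + l) 0 q))
            (x : LinearMap.ker (dbar bH bF (t + l) hψφ i)),
            ZigZag bH bF φ ψ (t + l) 0 q i z.1 x.1.1 →
              ε (Hpsi.mk bF ψ (t + l) 0 q z) = Hbar.mk bH bF (t + l) hψφ i x) ∧
      (∀ i p q : ℕ, Odd ((i : ℤ) - t - l) → t + l + 1 ≤ i → (i : ℕ∞) + 1 < h →
        (p : ℤ) = (i - t - l - 1) / 2 → (q : ℤ) = (i + t + l - 1) / 2 →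
        HasNaturalExactSequence bH bF (t + l) hψφ p q i)) ∧
    (t + l ≤ 0 →
      (∀ i : ℕ, i ≤ 2 → (i : ℕ∞) < h → Subsingleton (Hbar bH bF (t + l) hψφ i)) ∧
      (∀ i : ℕ, Odd i → 3 ≤ i → (i : ℕ∞) + 1 < h → i < 2 * r →
        HasNaturalExactSequence bH bF (t + l) hψφ ((i - 1) / 2) ((i - 1) / 2) i)) := by
  subst hg hh
  have hel : t + l < l := by omega
  have hrow : ∀ i : ℕ, (i : ℕ∞) < idealGrade (minorIdeal l (LinearMap.toMatrix bH bG φ)) →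
      RowsExact F bH φ (t + l) i := fun i hi => rowsExact_of_lt_idealGrade bH bG bF hi hel
  refine ⟨fun he => ?_, fun he => ⟨fun i hi2 hi => ?_, fun i hodd hi3 hi hir => ?_⟩⟩
  -- This is t < 0 < t + l; it is what allows column exactness to be controlled by h instead of r.
  · have hl : 2 ≤ l := by omega
    have hcol : ∀ Q : ℕ, (Q : ℕ∞) < idealGrade (minorIdeal l (LinearMap.toMatrix bH bG φ)) →
        ColumnsExact H bF ψ (t + l) Q := fun Q hQ =>
      columnsExact_of_lt_idealGrade bH bG bF hψφ hl hr hr1 hrg hQ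
    have hlt : ∀ {i j : ℕ}, j ≤ i →
        (i : ℕ∞) < idealGrade (minorIdeal l (LinearMap.toMatrix bH bG φ)) →
        (j : ℕ∞) < idealGrade (minorIdeal l (LinearMap.toMatrix bH bG φ)) := fun hji hi =>
      lt_of_le_of_lt (by exact_mod_cast hji) hi
    refine ⟨hl, fun i hi him => ?_, fun i q hie hqe hi2 hi => ?_,
      fun i p q hodd hie hi hp hq => ?_⟩
    · cases i with
      | zero => exact subsingleton_hbar_zero hψφ (hrow 0 hi)
      | succ i =>
        -- The bound i + 1 < max(2, t + l) means i = 0 or i + 2 ≤ t + l.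
        exact subsingleton_hbar_succ hψφ (hrow _ hi) (hcol i (hlt (by omega) hi)) (by omega)
    · obtain rfl : i = q + 1 := by omega
      exact exists_linkEquiv hψφ (hrow _ hi) (hcol q (hlt (by omega) hi)) (by omega)
    · obtain ⟨s, hs⟩ := hodd
      obtain ⟨i, rfl⟩ : ∃ j, i = j + 1 := ⟨i - 1, by omega⟩
      -- Here q ≥ t + l ≥ 1, as i ≥ t + l + 1.
      obtain ⟨q, rfl⟩ : ∃ j, q = j + 1 := ⟨q - 1, by omega⟩
      have hi' : ((i + 2 : ℕ) : ℕ∞) < idealGrade (minorIdeal l (LinearMap.toMatrix bH bG φ)) := by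
        exact_mod_cast hi
      exact hasNaturalExactSequence hψφ (by omega) (by omega) (hrow _ hi')
        (hcol _ (hlt (by omega) hi'))
  · have hcol := columnsExact_of_lt_rank (e := t + l) bH bG bF (Q := 0) hr hr1 hrg hr1
    interval_cases i
    · exact subsingleton_hbar_zero hψφ (hrow 0 hi)
    · exact subsingleton_hbar_succ hψφ (hrow 1 hi) hcol (Or.inl rfl)
    · exact subsingleton_hbar_two hψφ (by omega) (hrow 2 hi)
  · obtain ⟨s, hs⟩ := hodd
    obtain ⟨q, rfl⟩ : ∃ j, s = j + 1 := ⟨s - 1, by omega⟩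
    obtain ⟨i, rfl⟩ : ∃ j, i = j + 1 := ⟨i - 1, by omega⟩
    rw [show (i + 1 - 1) / 2 = q + 1 by omega]
    have hi' : ((i + 2 : ℕ) : ℕ∞) < idealGrade (minorIdeal l (LinearMap.toMatrix bH bG φ)) := by
      exact_mod_cast hi
    -- The bound i < 2r says precisely that the row q + 1 lies below r.
    exact hasNaturalExactSequence hψφ (by omega) (by omega) (hrow _ hi')
      (columnsExact_of_lt_rank bH bG bF hr hr1 hrg (by omega))
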